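/- An \emph{input-driven pushdown automaton with translucent input letters} (NIDPDAwtl) has a finite set $Q$ of states with an initial state $q_0$, a finite input alphabet $\Sigma$ partitioned into $\Sigma_D,\Sigma_R,\Sigma_N$, a finite set $\Gamma$ of pushdown symbols, an endmarker $\vartriangleleft\notin\Sigma$, a bottom symbol $\bot\notin\Gamma$, a translucency mapping $\tau\colon Q\to 2^\Sigma$, and partial transition functions $\delta_D\colon Q\times\Sigma_D\times(\Gamma\cup\{\bot\})\to 2^{Q\times\Gamma}\cup\{\mathtt{accept}\}$, $\delta_R\colon Q\times\Sigma_R\times(\Gamma\cup\{\bot\})\to 2^{Q}\cup\{\mathtt{accept}\}$, $\delta_N\colon Q\times(\Sigma_N\cup\{\vartriangleleft\})\times(\Gamma\cup\{\bot\})\to 2^{Q}\cup\{\mathtt{accept}\}$. It starts in $q_0$ at the left end of $w\vartriangleleft$ ($w\in\Sigma^*$) with pushdown content $\bot$. In state $q$ it skips the letters of $\tau(q)$ to the right of its head and processes the first symbol $a\notin\tau(q)$ (possibly $\vartriangleleft$), depending on $q$, $a$ and the topmost pushdown symbol. If the transition value is $\mathtt{accept}$, the automaton accepts; if it is a set, one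 of its elements gives the next state; if it is undefined, the computation is stuck. A letter $a\in\Sigma$ that is processed is deleted from the input; for $a\in\Sigma_D$ the pushdown symbol given by the chosen element is pushed, for $a\in\Sigma_R$ the topmost symbol is popped ($\bot$ is never removed), and for $a\in\Sigma_N$ the pushdown is unchanged. Processing $\vartriangleleft$ neither deletes $\vartriangleleft$ nor changes the pushdown. In the \emph{returning} mode the head returns to the left end of the remaining input after every step; in the \emph{non-returning} mode it stays at the position of the deleted letter, and returns to the left end only after a step on $\vartriangleleft$. A word is accepted if some computation on it reaches $\mathtt{accept}$. The automaton is \emph{deterministic} if all sets that occur as values of its transition functions (on letters and on $\vartriangleleft$) have at most one element. Let $\mathscr{L}(\mathsf{NIDPDAwtl})$ be the family of languages accepted by such automata in the returning mode, and $\mathscr{L}(\mathsf{nrDIDPDAwtl})$ the family of languages accepted by deterministic such automata in the non-returning mode. For languages $K,K'$ let $K \sqcup\mkern-5mu\sqcup K'$ be their shuffle, the set of all words $x_1y_1x_2y_2\cdots x_ny_n$ with $x_1x_2\cdots x_n\in K$ and $y_1y_2\cdots y_n\in K'$. Let $$L_{nsl}=\{\,a\,\$\#\,a^3\,\$\#^2\,a^5\,\$\#^3\cdots\$\#^{k-1}\,a^{2k-1}\,\$\mathrm{c}^{k}\,a^{2k+1}\mid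 k\ge 0\,\}$$ over the four-letter alphabet $\{a,\$,\#,\mathrm{c}\}$ (where $\mathrm{c}$ is the cent sign) (the word for $k=0$ is $a$, the word for $k=1$ is $a\$\mathrm{c}a^3$), and, over the alphabet $\{a,b,\#\}$, with singletons written as words, let $$L_1=\bigcup_{m,n\ge1}\bigl(b^n\#b^m \sqcup\mkern-5mu\sqcup a^n\bigr),\qquad L_2=\bigcup_{m,n\ge1}\bigl(b^m\#b^n \sqcup\mkern-5mu\sqcup a^n\bigr).$$ Proposition. The families $\mathscr{L}(\mathsf{nrDIDPDAwtl})$ and $\mathscr{L}(\mathsf{NIDPDAwtl})$ are incomparable, that is, neither is a subset of the other. More precisely, $L_{nsl}\in\mathscr{L}(\mathsf{nrDIDPDAwtl})\setminus\mathscr{L}(\mathsf{NIDPDAwtl})$ and $L_1\cup L_2\in\mathscr{L}(\mathsf{NIDPDAwtl})\setminus\mathscr{L}(\mathsf{nrDIDPDAwtl})$. -/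

import Mathlib

/-! ### Input-driven pushdown automata with translucent input letters -/

/-- The action on the pushdown store that is dictated by an input letter. A function from the input
alphabet to `StackOp` is a partition of the alphabet into `Σ_D`, `Σ_R`, `Σ_N`. -/
inductive StackOp where
  | push
  | pop
  | keep

/-- A value of a partial transition function with values in `2^α ∪ {accept}`:
undefined, `accept`, or a set of possible continuations. -/
inductive TransValue (α : Type) where
  | undefined
  | accept
  | goto (S : Set α)

/-- `|δ(…)| ≤ 1` for one value of a transition function. -/
def TransValue.AtMostOne {α : Type} (t : TransValue α) : Prop :=
  ∀ S : Set α, t = TransValue.goto S → S.Subsingleton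

/-- An input-driven pushdown automaton with translucent input letters, over the input alphabet `A`.

A pushdown symbol or the bottom symbol `⊥` is an element of `Option Γ`, where `none` is `⊥`;
a letter or the endmarker is an element of `Option A`, where `none` is the endmarker.
The values of `δD`, `δR`, `δN` on letters outside `Σ_D`, `Σ_R`, `Σ_N`, respectively, are never
used. -/
structure NIDPDAwtl (A : Type) where
  /-- internal states -/
  Q : Type
  /-- pushdown symbols -/
  Γ : Type
  finite_alphabet : Finite A
  finite_states : Finite Q
  finite_stack : Finite Γ
  /-- the signature, that is, the partition of the input alphabet -/
  kind : A → StackOp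
  /-- initial state -/
  q₀ : Q
  /-- translucency mapping -/
  τ : Q → Set A
  δD : Q → A → Option Γ → TransValue (Q × Γ)
  δR : Q → A → Option Γ → TransValue Q
  δN : Q → Option A → Option Γ → TransValue Q

namespace NIDPDAwtl

variable {A : Type}

/-- The automaton is deterministic: there is at most one continuation in every situation
(including the situations in which the endmarker is processed). -/
def Deterministic (M : NIDPDAwtl A) : Prop :=
  (∀ q a z, M.kind a = StackOp.push → (M.δD q a z).AtMostOne) ∧
  (∀ q a z, M.kind a = StackOp.pop → (M.δR q a z).AtMostOne) ∧
  (∀ q a z, M.kind a = StackOp.keep → (M.δN q (some a) z).AtMostOne) ∧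
  (∀ q z, (M.δN q none z).AtMostOne)

/-- `M.Read q a γ q' γ'`: processing the letter `a` in state `q` with pushdown content `γ⊥` may lead
to state `q'` and pushdown content `γ'⊥`. The head of the list is the top of the pushdown store;
`⊥` is not written and never removed (`[].tail = []`). -/
inductive Read (M : NIDPDAwtl A) : M.Q → A → List M.Γ → M.Q → List M.Γ → Prop
  | push {q : M.Q} {a : A} {γ : List M.Γ} {q' : M.Q} {z' : M.Γ} {S : Set (M.Q × M.Γ)}
      (hk : M.kind a = StackOp.push) (hδ : M.δD q a γ.head? = TransValue.goto S)
      (hS : (q', z') ∈ S) : Read M q a γ q' (z' :: γ)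
  | pop {q : M.Q} {a : A} {γ : List M.Γ} {q' : M.Q} {S : Set M.Q}
      (hk : M.kind a = StackOp.pop) (hδ : M.δR q a γ.head? = TransValue.goto S)
      (hS : q' ∈ S) : Read M q a γ q' γ.tail
  | keep {q : M.Q} {a : A} {γ : List M.Γ} {q' : M.Q} {S : Set M.Q}
      (hk : M.kind a = StackOp.keep) (hδ : M.δN q (some a) γ.head? = TransValue.goto S)
      (hS : q' ∈ S) : Read M q a γ q' γ

/-- The transition function yields `accept` on the letter `a`, in state `q` with pushdown
content `γ⊥`. -/
inductive ReadAccept (M : NIDPDAwtl A) : M.Q → A → List M.Γ → Prop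
  | push {q : M.Q} {a : A} {γ : List M.Γ} (hk : M.kind a = StackOp.push)
      (hδ : M.δD q a γ.head? = TransValue.accept) : ReadAccept M q a γ
  | pop {q : M.Q} {a : A} {γ : List M.Γ} (hk : M.kind a = StackOp.pop)
      (hδ : M.δR q a γ.head? = TransValue.accept) : ReadAccept M q a γ
  | keep {q : M.Q} {a : A} {γ : List M.Γ} (hk : M.kind a = StackOp.keep)
      (hδ : M.δN q (some a) γ.head? = TransValue.accept) : ReadAccept M q a γ

/-- Configurations in the returning mode: `run q w γ` stands for `(q w ◁, γ⊥)`. -/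
inductive Config (M : NIDPDAwtl A) where
  | accept
  | run (q : M.Q) (w : List A) (γ : List M.Γ)

/-- One step in the returning mode. -/
inductive Step (M : NIDPDAwtl A) : M.Config → M.Config → Prop
  | letter {q q' : M.Q} {x y : List A} {a : A} {γ γ' : List M.Γ}
      (hx : ∀ c ∈ x, c ∈ M.τ q) (ha : a ∉ M.τ q) (h : M.Read q a γ q' γ') :
      Step M (Config.run q (x ++ a :: y) γ) (Config.run q' (x ++ y) γ')
  | letterAccept {q : M.Q} {x y : List A} {a : A} {γ : List M.Γ}
      (hx : ∀ c ∈ x, c ∈ M.τ q) (ha : a ∉ M.τ q) (h : M.ReadAccept q a γ) :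
      Step M (Config.run q (x ++ a :: y) γ) Config.accept
  | endmarker {q q' : M.Q} {x : List A} {γ : List M.Γ} {S : Set M.Q}
      (hx : ∀ c ∈ x, c ∈ M.τ q) (hδ : M.δN q none γ.head? = TransValue.goto S) (hS : q' ∈ S) :
      Step M (Config.run q x γ) (Config.run q' x γ)
  | endmarkerAccept {q : M.Q} {x : List A} {γ : List M.Γ}
      (hx : ∀ c ∈ x, c ∈ M.τ q) (hδ : M.δN q none γ.head? = TransValue.accept) :
      Step M (Config.run q x γ) Config.accept

/-- The language accepted in the returning mode. -/
def language (M : NIDPDAwtl A) : Language A :=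
  {w | Relation.ReflTransGen M.Step (Config.run M.q₀ w []) Config.accept}

/-- Configurations in the non-returning mode: `run u q w γ` stands for `(u q w ◁, γ⊥)`, with the
input head between `u` and `w`. -/
inductive NRConfig (M : NIDPDAwtl A) where
  | accept
  | run (u : List A) (q : M.Q) (w : List A) (γ : List M.Γ)

/-- One step in the non-returning mode. -/
inductive NRStep (M : NIDPDAwtl A) : M.NRConfig → M.NRConfig → Prop
  | letter {q q' : M.Q} {u x y : List A} {a : A} {γ γ' : List M.Γ}
      (hx : ∀ c ∈ x, c ∈ M.τ q) (ha : a ∉ M.τ q) (h : M.Read q a γ q' γ') :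
      NRStep M (NRConfig.run u q (x ++ a :: y) γ) (NRConfig.run (u ++ x) q' y γ')
  | letterAccept {q : M.Q} {u x y : List A} {a : A} {γ : List M.Γ}
      (hx : ∀ c ∈ x, c ∈ M.τ q) (ha : a ∉ M.τ q) (h : M.ReadAccept q a γ) :
      NRStep M (NRConfig.run u q (x ++ a :: y) γ) NRConfig.accept
  | endmarker {q q' : M.Q} {u x : List A} {γ : List M.Γ} {S : Set M.Q}
      (hx : ∀ c ∈ x, c ∈ M.τ q) (hδ : M.δN q none γ.head? = TransValue.goto S) (hS : q' ∈ S) :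
      NRStep M (NRConfig.run u q x γ) (NRConfig.run [] q' (u ++ x) γ)
  | endmarkerAccept {q : M.Q} {u x : List A} {γ : List M.Γ}
      (hx : ∀ c ∈ x, c ∈ M.τ q) (hδ : M.δN q none γ.head? = TransValue.accept) :
      NRStep M (NRConfig.run u q x γ) NRConfig.accept

/-- The language accepted in the non-returning mode. -/
def nrLanguage (M : NIDPDAwtl A) : Language A :=
  {w | Relation.ReflTransGen M.NRStep (NRConfig.run [] M.q₀ w []) NRConfig.accept}

end NIDPDAwtl

/-! ### Language families -/

/-- A language family: for every alphabet, the languages over this alphabet that belong to it. -/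
def LanguageFamily : Type 1 := (A : Type) → Set (Language A)

/-- Inclusion of language families. -/
def LanguageFamily.Included (F G : LanguageFamily) : Prop :=
  ∀ A : Type, F A ⊆ G A

/-- Neither family is a subset of the other one. -/
def LanguageFamily.Incomparable (F G : LanguageFamily) : Prop :=
  ¬ F.Included G ∧ ¬ G.Included F

/-- The languages accepted by nondeterministic automata in the returning mode. -/
def familyNIDPDAwtl : LanguageFamily := fun A =>
  {L | ∃ M : NIDPDAwtl A, M.language = L}

/-- The languages accepted by deterministic automata in the non-returning mode. -/
def familyNrDIDPDAwtl : LanguageFamily := fun A =>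
  {L | ∃ M : NIDPDAwtl A, M.Deterministic ∧ M.nrLanguage = L}

/-! ### The witness languages -/

/-- The alphabet `{a, $, #, ¢}`. -/
inductive NslLetter where
  | a
  | dollar
  | hash
  | cent

/-- The word `a $# a³ $#² a⁵ $#³ ⋯ $#^(k-1) a^(2k-1) $¢^k a^(2k+1)`; it is `a` for `k = 0`. -/
def nslWord : ℕ → List NslLetter
  | 0 => [NslLetter.a]
  | k + 1 =>
    (List.range k).flatMap (fun i =>
      List.replicate (2 * i + 1) NslLetter.a ++
        NslLetter.dollar :: List.replicate (i + 1) NslLetter.hash) ++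
    List.replicate (2 * k + 1) NslLetter.a ++
    NslLetter.dollar :: List.replicate (k + 1) NslLetter.cent ++
    List.replicate (2 * k + 3) NslLetter.a

/-- The language `L_nsl`. -/
def Lnsl : Language NslLetter := {w | ∃ k : ℕ, w = nslWord k}

/-- The shuffle of two languages: all words `x₁y₁x₂y₂⋯xₙyₙ` with `x₁x₂⋯xₙ ∈ L` and
`y₁y₂⋯yₙ ∈ L'`. -/
def shuffle {A : Type} (L L' : Language A) : Language A :=
  {w | ∃ p : List (List A × List A),
    (p.map Prod.fst).flatten ∈ L ∧ (p.map Prod.snd).flatten ∈ L' ∧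
      w = (p.map fun xy => xy.1 ++ xy.2).flatten}

/-- The alphabet `{a, b, #}`. -/
inductive ABHash where
  | a
  | b
  | hash

/-- The word `b^i # b^j`. -/
def bHashB (i j : ℕ) : List ABHash :=
  List.replicate i ABHash.b ++ ABHash.hash :: List.replicate j ABHash.b

/-- The language of all words in the shuffle of `b^n # b^m` and `a^n`, for `m, n ≥ 1`. -/
def langL₁ : Language ABHash :=
  {w | ∃ m n : ℕ, 1 ≤ m ∧ 1 ≤ n ∧ w ∈ shuffle {bHashB n m} {List.replicate n ABHash.a}}

/-- The language of all words in the shuffle of `b^m # b^n` and `a^n`, for `m, n ≥ 1`. -/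
def langL₂ : Language ABHash :=
  {w | ∃ m n : ℕ, 1 ≤ m ∧ 1 ≤ n ∧ w ∈ shuffle {bHashB m n} {List.replicate n ABHash.a}}

/-! ### Unfolding acceptance in the non-returning mode -/

section

namespace NIDPDAwtl

variable {A : Type}

/-! Upper bound for `Lnsl`. A deterministic non-returning automaton works in sweeps. The first sweep
removes every `$`, one `a` and one `#` per block and one `¢`, and leaves a number on the pushdown
that is one less than the number of dollars. Each later sweep erases a leading `a^2`, shortens every
remaining block by `#a^2`, removes one `¢` and pops one symbol. Blocks may merge when a separator
vanishes; the counter excludes false acceptance, since the number of blocks has to drop by exactly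
one per sweep (`sweepWord_unique`, `eq_of_acc_g0`).

Lower bound for `Lnsl`. In the returning mode, the letters of an accepted word, listed in the order
of processing, form a word that is accepted by always reading the front letter
(`exists_perm_frontAcc`). `Lnsl` has one word per number of `¢`, so this permuted word is the
original one. The automaton thus acts like an ordinary input-driven pushdown automaton, and the long
`a`-block before the last `$` can be pumped down by pigeonhole. If `a` pushes, equal states and top
symbols suffice because enough pushed symbols remain above them (`FrontAcc.frame`); if `a` pops, the
store is soon empty; if `a` is neutral, the store is constant.

Upper bound for the union. The automaton moves to the endmarker, guesses which block of letters `b`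
is to be compared, and matches its letters with letters `a` one by one.

Lower bound for the union. A deterministic non-returning automaton is run symbolically on words
`b^+#b^+a^+`: long blocks are single items, reading a letter of a block costs one unit, and the run
does not depend on the block sizes until a block is exhausted (`acc_iff_of_reach`). A symbolic run
halts, leaves the control states that keep the two blocks of `b` apart, or loops
(`halt_or_exit_or_empty_or_loop`). Halting ignores the sizes, and leaving makes only the sum of the
two `b`-sizes visible, so there is a loop, and it has to grow the store (`exists_growing_loop`).
While `#` is present the second block is not read, and between the blocks only the second one is
read; hence the loop compares `a` with at most one of the blocks.

The store therefore holds `t` periods, with `t` free. If `b` does not pop and the loop reads letters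
`a`, few letters `a` are left to remove what was stored, and `t` and `t + 1` cannot be
distinguished. Otherwise one block is shrunk to a letter and the continuation is analysed on a
periodic store (`halt_or_exit_or_loop_or_descend`). Every continuation contradicts the acceptance
condition (`false_of_push`, `false_of_pop`): consuming the store for one of the two comparisons
ruins the other. -/

/-- Acceptance from a configuration in the non-returning mode. -/
def NRAcc (M : NIDPDAwtl A) (u : List A) (q : M.Q) (w : List A) (γ : List M.Γ) : Prop :=
  Relation.ReflTransGen M.NRStep (NRConfig.run u q w γ) NRConfig.accept

theorem mem_nrLanguage {M : NIDPDAwtl A} {w : List A} :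
    w ∈ M.nrLanguage ↔ M.NRAcc [] M.q₀ w [] := Iff.rfl

theorem nrAcc_iff_step {M : NIDPDAwtl A} {u : List A} {q : M.Q} {w : List A} {γ : List M.Γ} :
    M.NRAcc u q w γ ↔ ∃ c, M.NRStep (NRConfig.run u q w γ) c ∧
      Relation.ReflTransGen M.NRStep c NRConfig.accept := by
  constructor
  · intro h
    rcases Relation.ReflTransGen.cases_head h with h | h
    · cases h
    · exact h
  · rintro ⟨c, h, h'⟩
    exact Relation.ReflTransGen.head h h'

theorem nrAcc_skip {M : NIDPDAwtl A} {u : List A} {q : M.Q} {c : A} {w : List A} {γ : List M.Γ}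
    (hc : c ∈ M.τ q) : M.NRAcc u q (c :: w) γ ↔ M.NRAcc (u ++ [c]) q w γ := by
  rw [nrAcc_iff_step, nrAcc_iff_step]
  constructor
  · rintro ⟨d, h, h'⟩
    generalize hw : c :: w = v at h
    cases h with
    | @letter _ q' _ x y a _ γ' hx ha hr =>
      cases x with
      | nil => simp at hw; exact absurd (hw.1 ▸ hc) ha
      | cons b x =>
        simp at hw
        obtain ⟨rfl, rfl⟩ := hw
        refine ⟨_, NRStep.letter (x := x) (fun c hc => hx c (by simp [hc])) ha hr, ?_⟩
        simpa using h'
    | @letterAccept _ _ x y a _ hx ha hr =>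
      cases x with
      | nil => simp at hw; exact absurd (hw.1 ▸ hc) ha
      | cons b x =>
        simp at hw
        obtain ⟨rfl, rfl⟩ := hw
        exact ⟨_, NRStep.letterAccept (x := x) (fun c hc => hx c (by simp [hc])) ha hr, h'⟩
    | @endmarker _ q' _ x _ S hx hδ hS =>
      subst hw
      refine ⟨_, NRStep.endmarker (x := w) (fun c hc => hx c (by simp [hc])) hδ hS, ?_⟩
      simpa using h'
    | @endmarkerAccept _ _ x _ hx hδ =>
      subst hw
      exact ⟨_, NRStep.endmarkerAccept (x := w) (fun c hc => hx c (by simp [hc])) hδ, h'⟩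
  · rintro ⟨d, h, h'⟩
    cases h with
    | @letter _ q' _ x y a _ γ' hx ha hr =>
      refine ⟨_, NRStep.letter (x := c :: x) (by simpa [hc] using hx) ha hr, ?_⟩
      simpa using h'
    | @letterAccept _ _ x y a _ hx ha hr =>
      exact ⟨_, NRStep.letterAccept (x := c :: x) (by simpa [hc] using hx) ha hr, h'⟩
    | @endmarker _ q' _ x _ S hx hδ hS =>
      refine ⟨_, NRStep.endmarker (x := c :: w) (by simpa [hc] using hx) hδ hS, ?_⟩
      simpa using h'
    | @endmarkerAccept _ _ x _ hx hδ =>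
      exact ⟨_, NRStep.endmarkerAccept (x := c :: w) (by simpa [hc] using hx) hδ, h'⟩

theorem nrAcc_read {M : NIDPDAwtl A} {u : List A} {q : M.Q} {c : A} {w : List A} {γ : List M.Γ}
    (hc : c ∉ M.τ q) : M.NRAcc u q (c :: w) γ ↔
      M.ReadAccept q c γ ∨ ∃ q' γ', M.Read q c γ q' γ' ∧ M.NRAcc u q' w γ' := by
  rw [nrAcc_iff_step]
  constructor
  · rintro ⟨d, h, h'⟩
    generalize hw : c :: w = v at h
    cases h with
    | @letter _ q' _ x y a _ γ' hx ha hr =>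
      cases x with
      | nil =>
        simp at hw
        obtain ⟨rfl, rfl⟩ := hw
        exact Or.inr ⟨_, _, hr, by simpa [NRAcc] using h'⟩
      | cons b x =>
        simp at hw
        exact absurd (hw.1 ▸ hx b (by simp)) hc
    | @letterAccept _ _ x y a _ hx ha hr =>
      cases x with
      | nil =>
        simp at hw
        obtain ⟨rfl, rfl⟩ := hw
        exact Or.inl hr
      | cons b x =>
        simp at hw
        exact absurd (hw.1 ▸ hx b (by simp)) hc
    | endmarker hx => subst hw; exact absurd (hx c (by simp)) hc
    | endmarkerAccept hx => subst hw; exact absurd (hx c (by simp)) hc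
  · rintro (h | ⟨q', γ', h, h'⟩)
    · exact ⟨_, NRStep.letterAccept (x := []) (by simp) hc h, Relation.ReflTransGen.refl⟩
    · exact ⟨_, NRStep.letter (x := []) (by simp) hc h, by simpa [NRAcc] using h'⟩

theorem nrAcc_end {M : NIDPDAwtl A} {u : List A} {q : M.Q} {γ : List M.Γ} :
    M.NRAcc u q [] γ ↔ M.δN q none γ.head? = TransValue.accept ∨
      ∃ S, M.δN q none γ.head? = TransValue.goto S ∧ ∃ q' ∈ S, M.NRAcc [] q' u γ := by
  rw [nrAcc_iff_step]
  constructor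
  · rintro ⟨d, h, h'⟩
    generalize hw : ([] : List A) = v at h
    cases h with
    | letter => simp at hw
    | letterAccept => simp at hw
    | endmarker hx hδ hS => subst hw; exact Or.inr ⟨_, hδ, _, hS, by simpa [NRAcc] using h'⟩
    | endmarkerAccept hx hδ => exact Or.inl hδ
  · rintro (h | ⟨S, h, q', hS, h'⟩)
    · exact ⟨_, NRStep.endmarkerAccept (by simp) h, Relation.ReflTransGen.refl⟩
    · exact ⟨_, NRStep.endmarker (by simp) h hS, by simpa [NRAcc] using h'⟩

theorem nrAcc_skip_append {M : NIDPDAwtl A} {u : List A} {q : M.Q} {x w : List A} {γ : List M.Γ}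
    (hx : ∀ c ∈ x, c ∈ M.τ q) : M.NRAcc u q (x ++ w) γ ↔ M.NRAcc (u ++ x) q w γ := by
  induction x generalizing u with
  | nil => simp
  | cons c x ih =>
    rw [List.cons_append, nrAcc_skip (hx c (by simp)), ih fun d hd => hx d (by simp [hd])]
    simp

theorem read_iff {M : NIDPDAwtl A} {q : M.Q} {c : A} {γ : List M.Γ} {q' : M.Q} {γ' : List M.Γ} :
    M.Read q c γ q' γ' ↔
      (M.kind c = StackOp.push ∧ ∃ S z, M.δD q c γ.head? = TransValue.goto S ∧ (q', z) ∈ S ∧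
        γ' = z :: γ) ∨
      (M.kind c = StackOp.pop ∧ ∃ S, M.δR q c γ.head? = TransValue.goto S ∧ q' ∈ S ∧
        γ' = γ.tail) ∨
      (M.kind c = StackOp.keep ∧ ∃ S, M.δN q (some c) γ.head? = TransValue.goto S ∧ q' ∈ S ∧
        γ' = γ) := by
  constructor
  · rintro (⟨h1, h2, h3⟩ | ⟨h1, h2, h3⟩ | ⟨h1, h2, h3⟩)
    · exact Or.inl ⟨h1, _, _, h2, h3, rfl⟩
    · exact Or.inr (Or.inl ⟨h1, _, h2, h3, rfl⟩)
    · exact Or.inr (Or.inr ⟨h1, _, h2, h3, rfl⟩)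
  · rintro (⟨h1, S, z, h2, h3, rfl⟩ | ⟨h1, S, h2, h3, rfl⟩ | ⟨h1, S, h2, h3, rfl⟩)
    · exact Read.push h1 h2 h3
    · exact Read.pop h1 h2 h3
    · exact Read.keep h1 h2 h3

theorem readAccept_iff {M : NIDPDAwtl A} {q : M.Q} {c : A} {γ : List M.Γ} :
    M.ReadAccept q c γ ↔
      (M.kind c = StackOp.push ∧ M.δD q c γ.head? = TransValue.accept) ∨
      (M.kind c = StackOp.pop ∧ M.δR q c γ.head? = TransValue.accept) ∨
      (M.kind c = StackOp.keep ∧ M.δN q (some c) γ.head? = TransValue.accept) := by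
  constructor
  · rintro (⟨h1, h2⟩ | ⟨h1, h2⟩ | ⟨h1, h2⟩)
    · exact Or.inl ⟨h1, h2⟩
    · exact Or.inr (Or.inl ⟨h1, h2⟩)
    · exact Or.inr (Or.inr ⟨h1, h2⟩)
  · rintro (⟨h1, h2⟩ | ⟨h1, h2⟩ | ⟨h1, h2⟩)
    · exact ReadAccept.push h1 h2
    · exact ReadAccept.pop h1 h2
    · exact ReadAccept.keep h1 h2

end NIDPDAwtl

end

section

/-! ### A deterministic non-returning automaton for `Lnsl` -/

namespace NslAutomaton

/-- The states: `i0, …, i5` are used in the first sweep, `g0, …, h6` in the later ones, `e` at the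
end of each sweep. -/
inductive State where
  | i0 | i1 | i2 | i3 | i4 | i5 | e | g0 | g1 | g2 | h0 | h3 | h4 | h5 | h6

open NIDPDAwtl NslLetter List

/-- With the single pushdown symbol `()`, the store is a counter: it counts the dollars in the first
sweep and loses one unit with the single `¢` deleted in each sweep. -/
def kind : NslLetter → StackOp
  | dollar => StackOp.push
  | cent => StackOp.pop
  | _ => StackOp.keep

def tau : State → Set NslLetter
  | .i3 => {.hash}
  | .i4 => {cent}
  | .i5 => {a}
  | .e => {a}
  | .h3 => {.hash}
  | .h4 => {cent}
  | .h5 => {a}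
  | _ => ∅

def deltaD : State → NslLetter → Option Unit → TransValue (State × Unit)
  | .i1, dollar, _ => .goto {(.i2, ())}
  | .i5, dollar, _ => .goto {(.i2, ())}
  | _, _, _ => .undefined

def deltaR : State → NslLetter → Option Unit → TransValue State
  | .i2, cent, some _ => .goto {.i4}
  | .g2, cent, some _ => .goto {.h4}
  | .h5, cent, some _ => .goto {.h4}
  | _, _, _ => .undefined

/-- The `i`-states take one letter from each block. From `g0` on, two letters `a` are taken per
block. The state `g2` has no translucent letters, so the leading `a`-block has to be exactly `a^2`
when it is left; with bottom on top at the endmarker this is the final acceptance. -/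
def deltaN : State → Option NslLetter → Option Unit → TransValue State
  | .i0, some a, _ => .goto {.i1}
  | .i1, none, _ => .accept
  | .i2, some .hash, _ => .goto {.i3}
  | .i3, some a, _ => .goto {.i5}
  | .i4, some a, _ => .goto {.e}
  | .e, none, _ => .goto {.g0}
  | .g0, some a, _ => .goto {.g1}
  | .g1, some a, _ => .goto {.g2}
  | .g2, none, none => .accept
  | .g2, some .hash, _ => .goto {.h3}
  | .h3, some a, _ => .goto {.h0}
  | .h0, some a, _ => .goto {.h5}
  | .h5, some .hash, _ => .goto {.h3}
  | .h4, some a, _ => .goto {.h6}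
  | .h6, some a, _ => .goto {.e}
  | _, _, _ => .undefined

abbrev aut : NIDPDAwtl NslLetter where
  Q := State
  Γ := Unit
  finite_alphabet := by
    refine Set.finite_univ_iff.mp (Set.Finite.subset (Set.toFinite {a, dollar, .hash, cent}) ?_)
    intro x _
    cases x <;> simp
  finite_states := by
    refine Set.finite_univ_iff.mp (Set.Finite.subset (Set.toFinite
      {.i0, .i1, .i2, .i3, .i4, .i5, .e, .g0, .g1, .g2, .h0, .h3, .h4, .h5, .h6}) ?_)
    intro x _
    cases x <;> simp
  finite_stack := inferInstance
  kind := kind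
  q₀ := .i0
  τ := tau
  δD := deltaD
  δR := deltaR
  δN := deltaN

theorem deterministic : aut.Deterministic := by
  refine ⟨?_, ?_, ?_, ?_⟩
  · intro q c z _ S h
    simp only [aut, deltaD] at h
    split at h <;> simp_all only [TransValue.goto.injEq, reduceCtorEq] <;>
      subst h <;> exact Set.subsingleton_singleton
  · intro q c z _ S h
    simp only [aut, deltaR] at h
    split at h <;> simp_all only [TransValue.goto.injEq, reduceCtorEq] <;>
      subst h <;> exact Set.subsingleton_singleton
  · intro q c z _ S h
    simp only [aut, deltaN] at h
    split at h <;> simp_all only [TransValue.goto.injEq, reduceCtorEq] <;>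
      subst h <;> exact Set.subsingleton_singleton
  · intro q z S h
    simp only [aut, deltaN] at h
    split at h <;> simp_all only [TransValue.goto.injEq, reduceCtorEq] <;>
      subst h <;> exact Set.subsingleton_singleton

/-- Acceptance from a configuration, with the pushdown store given by its height. -/
def Acc (u : List NslLetter) (q : State) (w : List NslLetter) (s : ℕ) : Prop :=
  aut.NRAcc u q w (replicate s ())

variable {u w : List NslLetter} {s : ℕ}

theorem acc_skip {c : NslLetter} {q : State} (h : c ∈ tau q) :
    Acc u q (c :: w) s ↔ Acc (u ++ [c]) q w s := nrAcc_skip h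

theorem acc_keep {c : NslLetter} {q : State} (h : c ∉ tau q) (hk : kind c = .keep) :
    Acc u q (c :: w) s ↔ (deltaN q (some c) (replicate s ()).head? = .accept) ∨
      ∃ q', (∃ S, deltaN q (some c) (replicate s ()).head? = .goto S ∧ q' ∈ S) ∧ Acc u q' w s := by
  unfold Acc
  rw [nrAcc_read (M := aut) h, readAccept_iff]
  simp only [read_iff]
  simp only [aut, hk]
  simp

theorem acc_dollar {q : State} (h : dollar ∉ tau q) :
    Acc u q (dollar :: w) s ↔ (q = .i1 ∨ q = .i5) ∧ Acc u .i2 w (s + 1) := by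
  unfold Acc
  rw [nrAcc_read (M := aut) h, readAccept_iff]
  simp only [read_iff]
  cases q <;> simp [aut, kind, deltaD, List.replicate_succ]
  all_goals exact ⟨fun ⟨_, h⟩ => h, fun h => ⟨(), h⟩⟩

theorem acc_cent {q : State} (h : cent ∉ tau q) :
    Acc u q (cent :: w) s ↔ ∃ s', s = s' + 1 ∧
      ((q = .i2 ∧ Acc u .i4 w s') ∨ ((q = .g2 ∨ q = .h5) ∧ Acc u .h4 w s')) := by
  unfold Acc
  rw [nrAcc_read (M := aut) h, readAccept_iff]
  simp only [read_iff]
  cases s <;> cases q <;> simp [aut, kind, deltaR, List.replicate_succ]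

theorem acc_nil {q : State} : Acc u q [] s ↔
    q = .i1 ∨ (q = .g2 ∧ s = 0) ∨ (q = .e ∧ Acc [] .g0 u s) := by
  unfold Acc
  rw [nrAcc_end]
  cases s <;> cases q <;> simp [aut, deltaN, List.replicate_succ]

/-- The successor state on a letter that does not change the pushdown store. -/
def next : State → NslLetter → Option State
  | .i0, a => some .i1
  | .i2, .hash => some .i3
  | .i3, a => some .i5
  | .i4, a => some .e
  | .g0, a => some .g1
  | .g1, a => some .g2
  | .g2, .hash => some .h3
  | .h3, a => some .h0
  | .h0, a => some .h5
  | .h5, .hash => some .h3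
  | .h4, a => some .h6
  | .h6, a => some .e
  | _, _ => none

theorem acc_next {c : NslLetter} {q : State} (h : c ∉ tau q) (hk : kind c = .keep) :
    Acc u q (c :: w) s ↔ ∃ q', next q c = some q' ∧ Acc u q' w s := by
  rw [acc_keep h hk]
  cases q <;> cases c <;> simp [deltaN, next]

theorem acc_skip_replicate {c : NslLetter} {q : State} (h : c ∈ tau q) (n : ℕ) :
    Acc u q (replicate n c ++ w) s ↔ Acc (u ++ replicate n c) q w s :=
  nrAcc_skip_append (M := aut) (by simp; exact fun _ => h)

/-- `∏ #^(q+j) a^(p+i) t` over the pairs `(q, p)` of a list. -/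
def blocks (j i : ℕ) (t : List NslLetter) (L : List (ℕ × ℕ)) : List NslLetter :=
  L.flatMap fun x => replicate (x.1 + j) .hash ++ (replicate (x.2 + i) a ++ t)

@[simp] theorem blocks_nil {j i : ℕ} {t : List NslLetter} : blocks j i t [] = [] := rfl

@[simp] theorem blocks_cons {j i : ℕ} {t : List NslLetter} {x : ℕ × ℕ} {L : List (ℕ × ℕ)} :
    blocks j i t (x :: L) =
      replicate (x.1 + j) .hash ++ (replicate (x.2 + i) a ++ (t ++ blocks j i t L)) := by
  simp [blocks]

theorem cons_replicate_append {c : NslLetter} (n : ℕ) {v : List NslLetter} :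
    c :: (replicate n c ++ v) = replicate (n + 1) c ++ v := rfl

/-- This and the following lemmas parse the input backwards from acceptance: any letter that does
not fit the expected pattern leaves the automaton stuck. They return the word that is left for the
next sweep. -/
theorem exists_of_acc_e (h : Acc u .e w s) : ∃ r, w = replicate r a ∧ Acc [] .g0 (u ++ w) s := by
  induction w generalizing u with
  | nil => rw [acc_nil] at h; exact ⟨0, rfl, by simpa [replicate_succ] using h⟩
  | cons c w ih =>
    cases c with
    | a =>
      rw [acc_skip (by simp [tau])] at h
      replace h := ih h
      obtain ⟨r, rfl, h⟩ := h
      exact ⟨r + 1, rfl, by simpa [replicate_succ] using h⟩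
    | dollar => rw [acc_dollar (by simp [tau])] at h; simp at h
    | cent => rw [acc_cent (by simp [tau])] at h; simp at h
    | hash => rw [acc_next (by simp [tau]) rfl] at h; simp [next] at h

theorem acc_e (r : ℕ) : Acc u .e (replicate r a) s ↔ Acc [] .g0 (u ++ replicate r a) s := by
  have := acc_skip_replicate (u := u) (s := s) (w := []) (c := a) (q := .e) (by simp [tau]) r
  rw [List.append_nil] at this
  rw [this, acc_nil]
  simp

theorem exists_of_acc_i4 (h : Acc u .i4 w s) : ∃ q r, w = replicate q cent ++ replicate (r + 1) a ∧
    Acc [] .g0 (u ++ (replicate q cent ++ replicate r a)) s := by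
  induction w generalizing u with
  | nil => rw [acc_nil] at h; simp at h
  | cons c w ih =>
    cases c with
    | cent =>
      rw [acc_skip (by simp [tau])] at h
      replace h := ih h
      obtain ⟨q, r, rfl, h⟩ := h
      exact ⟨q + 1, r, rfl, by simpa [replicate_succ] using h⟩
    | dollar => rw [acc_dollar (by simp [tau])] at h; simp at h
    | a =>
      rw [acc_next (by simp [tau]) rfl] at h
      simp only [next, Option.some.injEq, exists_eq_left'] at h
      replace h := exists_of_acc_e h
      obtain ⟨r, rfl, h⟩ := h
      exact ⟨0, r, rfl, by simpa [replicate_succ] using h⟩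
    | hash => rw [acc_next (by simp [tau]) rfl] at h; simp [next] at h

theorem exists_of_acc_h4 (h : Acc u .h4 w s) : ∃ q r, w = replicate q cent ++ replicate (r + 2) a ∧
    Acc [] .g0 (u ++ (replicate q cent ++ replicate r a)) s := by
  induction w generalizing u with
  | nil => rw [acc_nil] at h; simp at h
  | cons c w ih =>
    cases c with
    | cent =>
      rw [acc_skip (by simp [tau])] at h
      replace h := ih h
      obtain ⟨q, r, rfl, h⟩ := h
      exact ⟨q + 1, r, rfl, by simpa [replicate_succ] using h⟩
    | dollar => rw [acc_dollar (by simp [tau])] at h; simp at h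
    | a =>
      rw [acc_next (by simp [tau]) rfl] at h
      simp only [next, Option.some.injEq, exists_eq_left'] at h
      cases w with
      | nil => rw [acc_nil] at h; simp at h
      | cons c w =>
        cases c with
        | a =>
          rw [acc_next (by simp [tau]) rfl] at h
          simp only [next, Option.some.injEq, exists_eq_left'] at h
          replace h := exists_of_acc_e h
          obtain ⟨r, rfl, h⟩ := h
          exact ⟨0, r, rfl, by simpa [replicate_succ] using h⟩
        | dollar => rw [acc_dollar (by simp [tau])] at h; simp at h
        | cent => rw [acc_cent (by simp [tau])] at h; simp at h
        | hash => rw [acc_next (by simp [tau]) rfl] at h; simp [next] at h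
    | hash => rw [acc_next (by simp [tau]) rfl] at h; simp [next] at h

/-- Analysis of the first sweep, after a `$`, within a `#`-block, and within an `a`-block. -/
theorem exists_of_acc_i : 
    (Acc u .i2 w s → ∃ L q r s', w = blocks 1 1 [dollar] L ++
      (replicate (q + 1) cent ++ replicate (r + 1) a) ∧ s' + 1 = s + L.length ∧
      Acc [] .g0 (u ++ (blocks 0 0 [] L ++ (replicate q cent ++ replicate r a))) s') ∧
    (Acc u .i3 w s → ∃ k p L q r s', w = replicate k .hash ++ (replicate (p + 1) a ++ (dollar ::
      (blocks 1 1 [dollar] L ++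
      (replicate (q + 1) cent ++ replicate (r + 1) a)))) ∧ s' = s + L.length ∧
      Acc [] .g0 (u ++ (replicate k .hash ++ (replicate p a ++ (blocks 0 0 [] L ++
        (replicate q cent ++ replicate r a))))) s') ∧
    (Acc u .i5 w s → ∃ p L q r s', w = replicate p a ++ (dollar :: (blocks 1 1 [dollar] L ++
      (replicate (q + 1) cent ++ replicate (r + 1) a))) ∧ s' = s + L.length ∧
      Acc [] .g0 (u ++ (replicate p a ++ (blocks 0 0 [] L ++
        (replicate q cent ++ replicate r a)))) s') := by
  induction w generalizing u s with
  | nil => simp [acc_nil]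
  | cons c w ih =>
    refine ⟨fun h => ?_, fun h => ?_, fun h => ?_⟩
    · cases c with
      | a => rw [acc_next (by simp [tau]) rfl] at h; simp [next] at h
      | dollar => rw [acc_dollar (by simp [tau])] at h; simp at h
      | cent =>
        rw [acc_cent (by simp [tau])] at h
        simp at h
        obtain ⟨s', rfl, h⟩ := h
        replace h := exists_of_acc_i4 h
        obtain ⟨q, r, rfl, h⟩ := h
        exact ⟨[], q, r, s', rfl, by simp, h⟩
      | hash =>
        rw [acc_next (by simp [tau]) rfl] at h
        simp only [next, Option.some.injEq, exists_eq_left'] at h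
        replace h := ih.2.1 h
        obtain ⟨k, p, L, q, r, s', rfl, rfl, h⟩ := h
        exact ⟨(k, p) :: L, q, r, s + L.length, by simp [cons_replicate_append], by simp [add_assoc],
          by simpa [replicate_succ] using h⟩
    · cases c with
      | a => 
        rw [acc_next (by simp [tau]) rfl] at h
        simp only [next, Option.some.injEq, exists_eq_left'] at h
        replace h := ih.2.2 h
        obtain ⟨p, L, q, r, s', rfl, rfl, h⟩ := h
        exact ⟨0, p, L, q, r, _, rfl, rfl, by simpa [replicate_succ] using h⟩
      | dollar => rw [acc_dollar (by simp [tau])] at h; simp at h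
      | cent => rw [acc_cent (by simp [tau])] at h; simp at h
      | hash =>
        rw [acc_skip (by simp [tau])] at h
        replace h := ih.2.1 h
        obtain ⟨k, p, L, q, r, s', rfl, rfl, h⟩ := h
        exact ⟨k + 1, p, L, q, r, _, rfl, rfl, by simpa [replicate_succ] using h⟩
    · cases c with
      | a => 
        rw [acc_skip (by simp [tau])] at h
        replace h := ih.2.2 h
        obtain ⟨p, L, q, r, s', rfl, rfl, h⟩ := h
        exact ⟨p + 1, L, q, r, _, rfl, rfl, by simpa [replicate_succ] using h⟩
      | dollar =>
        rw [acc_dollar (by simp [tau])] at h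
        simp at h
        replace h := ih.1 h
        obtain ⟨L, q, r, s', rfl, hs, h⟩ := h
        exact ⟨0, L, q, r, s', rfl, by omega, by simpa [replicate_succ] using h⟩
      | cent => rw [acc_cent (by simp [tau])] at h; simp at h
      | hash => rw [acc_next (by simp [tau]) rfl] at h; simp [next] at h

/-- Analysis of a later sweep, at the beginning or within an `a`-block, within a `#`-block, and
at the second letter of an `a`-block. -/
theorem exists_of_acc_h : 
    (Acc u .h5 w s → ∃ p L q r s', w = replicate p a ++ (blocks 1 2 [] L ++
      (replicate (q + 1) cent ++ replicate (r + 2) a)) ∧ s = s' + 1 ∧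
      Acc [] .g0 (u ++ (replicate p a ++ (blocks 0 0 [] L ++
        (replicate q cent ++ replicate r a)))) s') ∧
    (Acc u .h3 w s → ∃ k p L q r s', w = replicate k .hash ++ (replicate (p + 2) a ++ 
      (blocks 1 2 [] L ++
      (replicate (q + 1) cent ++ replicate (r + 2) a))) ∧ s = s' + 1 ∧
      Acc [] .g0 (u ++ (replicate k .hash ++ (replicate p a ++ (blocks 0 0 [] L ++
        (replicate q cent ++ replicate r a))))) s') ∧
    (Acc u .h0 w s → ∃ p L q r s', w = replicate (p + 1) a ++ (blocks 1 2 [] L ++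
      (replicate (q + 1) cent ++ replicate (r + 2) a)) ∧ s = s' + 1 ∧
      Acc [] .g0 (u ++ (replicate p a ++ (blocks 0 0 [] L ++
        (replicate q cent ++ replicate r a)))) s') := by
  induction w generalizing u s with
  | nil => simp [acc_nil]
  | cons c w ih =>
    refine ⟨fun h => ?_, fun h => ?_, fun h => ?_⟩
    · cases c with
      | a => 
        rw [acc_skip (by simp [tau])] at h
        replace h := ih.1 h
        obtain ⟨p, L, q, r, s', rfl, rfl, h⟩ := h
        exact ⟨p + 1, L, q, r, _, rfl, rfl, by simpa [replicate_succ] using h⟩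
      | dollar => rw [acc_dollar (by simp [tau])] at h; simp at h
      | cent =>
        rw [acc_cent (by simp [tau])] at h
        simp at h
        obtain ⟨s', rfl, h⟩ := h
        replace h := exists_of_acc_h4 h
        obtain ⟨q, r, rfl, h⟩ := h
        exact ⟨0, [], q, r, s', rfl, by simp, h⟩
      | hash =>
        rw [acc_next (by simp [tau]) rfl] at h
        simp only [next, Option.some.injEq, exists_eq_left'] at h
        replace h := ih.2.1 h
        obtain ⟨k, p, L, q, r, s', rfl, rfl, h⟩ := h
        exact ⟨0, (k, p) :: L, q, r, _, by simp [cons_replicate_append], rfl,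
          by simpa [replicate_succ] using h⟩
    · cases c with
      | a => 
        rw [acc_next (by simp [tau]) rfl] at h
        simp only [next, Option.some.injEq, exists_eq_left'] at h
        replace h := ih.2.2 h
        obtain ⟨p, L, q, r, s', rfl, rfl, h⟩ := h
        exact ⟨0, p, L, q, r, _, rfl, rfl, by simpa [replicate_succ] using h⟩
      | dollar => rw [acc_dollar (by simp [tau])] at h; simp at h
      | cent => rw [acc_cent (by simp [tau])] at h; simp at h
      | hash =>
        rw [acc_skip (by simp [tau])] at h
        replace h := ih.2.1 h
        obtain ⟨k, p, L, q, r, s', rfl, rfl, h⟩ := h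
        exact ⟨k + 1, p, L, q, r, _, rfl, rfl, by simpa [replicate_succ] using h⟩
    · cases c with
      | a => 
        rw [acc_next (by simp [tau]) rfl] at h
        simp only [next, Option.some.injEq, exists_eq_left'] at h
        replace h := ih.1 h
        obtain ⟨p, L, q, r, s', rfl, rfl, h⟩ := h
        exact ⟨p, L, q, r, _, rfl, rfl, by simpa [replicate_succ] using h⟩
      | dollar => rw [acc_dollar (by simp [tau])] at h; simp at h
      | cent => rw [acc_cent (by simp [tau])] at h; simp at h
      | hash => rw [acc_next (by simp [tau]) rfl] at h; simp [next] at h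

/-- In contrast to `h5`, no `a` can be skipped here, so the parse starts directly with a `#`-block
or with `¢`. -/
theorem exists_of_acc_g2 (h : Acc u .g2 w s) : (w = [] ∧ s = 0) ∨ ∃ L q r s', w = blocks 1 2 [] L ++
      (replicate (q + 1) cent ++ replicate (r + 2) a) ∧ s = s' + 1 ∧
      Acc [] .g0 (u ++ (blocks 0 0 [] L ++ (replicate q cent ++ replicate r a))) s' := by
  cases w with
  | nil => rw [acc_nil] at h; simp at h; exact Or.inl ⟨rfl, h⟩
  | cons c w =>
    right
    cases c with
    | a => rw [acc_next (by simp [tau]) rfl] at h; simp [next] at h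
    | dollar => rw [acc_dollar (by simp [tau])] at h; simp at h
    | cent =>
      rw [acc_cent (by simp [tau])] at h
      simp at h
      obtain ⟨s', rfl, h⟩ := h
      replace h := exists_of_acc_h4 h
      obtain ⟨q, r, rfl, h⟩ := h
      exact ⟨[], q, r, s', rfl, by simp, h⟩
    | hash =>
      rw [acc_next (by simp [tau]) rfl] at h
      simp only [next, Option.some.injEq, exists_eq_left'] at h
      replace h := exists_of_acc_h.2.1 h
      obtain ⟨k, p, L, q, r, s', rfl, rfl, h⟩ := h
      exact ⟨(k, p) :: L, q, r, _, by simp [cons_replicate_append], rfl,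
        by simpa [replicate_succ] using h⟩

theorem exists_of_acc_g0 (h : Acc [] .g0 w s) : ∃ v, w = a :: a :: v ∧ Acc [] .g2 v s := by
  cases w with
  | nil => rw [acc_nil] at h; simp at h
  | cons c w =>
    cases c with
    | dollar => rw [acc_dollar (by simp [tau])] at h; simp at h
    | cent => rw [acc_cent (by simp [tau])] at h; simp at h
    | hash => rw [acc_next (by simp [tau]) rfl] at h; simp [next] at h
    | a => 
      rw [acc_next (by simp [tau]) rfl] at h
      simp only [next, Option.some.injEq, exists_eq_left'] at h
      cases w with
      | nil => rw [acc_nil] at h; simp at h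
      | cons c w =>
        cases c with
        | dollar => rw [acc_dollar (by simp [tau])] at h; simp at h
        | cent => rw [acc_cent (by simp [tau])] at h; simp at h
        | hash => rw [acc_next (by simp [tau]) rfl] at h; simp [next] at h
        | a => 
          rw [acc_next (by simp [tau]) rfl] at h
          simp only [next, Option.some.injEq, exists_eq_left'] at h
          exact ⟨w, rfl, h⟩

end NslAutomaton

end

/-! ### Correctness of the sweeps -/

section

namespace NslAutomaton

open NIDPDAwtl NslLetter List

variable {u w : List NslLetter} {s : ℕ}

theorem replicate_append_cons_inj {α : Type} {c x y : α} (hx : x ≠ c) (hy : y ≠ c) {m n : ℕ}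
    {v w : List α} (h : replicate m c ++ x :: v = replicate n c ++ y :: w) :
    m = n ∧ x :: v = y :: w := by
  induction m generalizing n with
  | zero =>
    cases n with
    | zero => exact ⟨rfl, h⟩
    | succ n => simp [replicate_succ, hx] at h
  | succ m ih =>
    cases n with
    | zero => simp [replicate_succ, hy.symm] at h
    | succ n =>
      simp only [replicate_succ, cons_append, cons.injEq, true_and] at h
      simpa using ih h

/-- The word `a^p ∏ #^k a^m ¢^q a^r`. -/
def sweepWord (p : ℕ) (L : List (ℕ × ℕ)) (q r : ℕ) : List NslLetter :=
  replicate p a ++ (blocks 0 0 [] L ++ (replicate q cent ++ replicate r a))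

theorem sweepWord_cons (p k m : ℕ) (L : List (ℕ × ℕ)) (q r : ℕ) :
    sweepWord p ((k, m) :: L) q r =
      replicate p a ++ (replicate k .hash ++ sweepWord m L q r) := by
  simp [sweepWord]

theorem sweepWord_zero_block (p m : ℕ) (L : List (ℕ × ℕ)) (q r : ℕ) :
    sweepWord p ((0, m) :: L) q r = sweepWord (p + m) L q r := by
  simp only [sweepWord, blocks_cons, replicate_zero, nil_append, add_zero, replicate_add,
    append_assoc]

theorem sweepWord_zero_merge (p k k' m' : ℕ) (L : List (ℕ × ℕ)) (q r : ℕ) :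
    sweepWord p ((k, 0) :: (k', m') :: L) q r = sweepWord p ((k + k', m') :: L) q r := by
  simp only [sweepWord, blocks_cons, replicate_zero, nil_append, add_zero, replicate_add,
    append_assoc]

def isCent : NslLetter → Bool
  | cent => true
  | _ => false

def isHash : NslLetter → Bool
  | .hash => true
  | _ => false

theorem count_cent_sweepWord (p : ℕ) (L : List (ℕ × ℕ)) (q r : ℕ) :
    (sweepWord p L q r).countP isCent = q := by
  have : (blocks 0 0 [] L).countP isCent = 0 := by
    induction L with
    | nil => rfl
    | cons x L ih => simp [ih, countP_replicate, isCent]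
  simp [sweepWord, this, countP_replicate, isCent]

theorem count_hash_sweepWord_nil (p q r : ℕ) :
    (sweepWord p [] q r).countP isHash = 0 := by
  simp [sweepWord, countP_replicate, isHash]

/-- A presentation as `sweepWord` in which all blocks are nonempty is the shortest one, and no other
one has the same length. -/
theorem sweepWord_unique {p' q' r' : ℕ} {L' : List (ℕ × ℕ)} (hL : ∀ x ∈ L', 0 < x.1 ∧ 0 < x.2)
    (hq : 0 < q') {p q r : ℕ} {L : List (ℕ × ℕ)} (h : sweepWord p L q r = sweepWord p' L' q' r') :
    L'.length ≤ L.length ∧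
      (L.length = L'.length → p = p' ∧ L = L' ∧ q = q' ∧ r = r') := by
  have hqq : q = q' := by
    rw [← count_cent_sweepWord p L q r, h, count_cent_sweepWord]
  subst hqq
  obtain ⟨q, rfl⟩ := Nat.exists_eq_succ_of_ne_zero hq.ne'
  induction hn : L.length using Nat.strong_induction_on generalizing p p' L L' with
  | _ n ih =>
  subst hn
  match L, L' with
  | [], [] =>
    refine ⟨le_rfl, fun _ => ?_⟩
    simp only [sweepWord, blocks_nil, nil_append, replicate_succ, cons_append] at h
    replace h := replicate_append_cons_inj (by simp) (by simp) h
    obtain ⟨rfl, h⟩ := h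
    simp at h
    exact ⟨rfl, rfl, rfl, h⟩
  | [], (k', m') :: L' =>
    have h1 := count_hash_sweepWord_nil p (q + 1) r
    have := hL (k', m') (by simp)
    rw [h, sweepWord_cons] at h1
    simp [countP_replicate, isHash] at h1
    omega
  -- An empty `#`-block merges its `a`-block with the preceding one. This gives a shorter
  -- presentation of the same word, so equality of lengths is impossible here.
  | (0, m) :: L, L' =>
    rw [sweepWord_zero_block] at h
    obtain ⟨h1, h2⟩ := ih L.length (by simp) hL h rfl
    refine ⟨by simp; omega, fun h3 => ?_⟩
    simp at h3
    omega
  | (k + 1, m) :: L, [] =>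
    have h1 := count_hash_sweepWord_nil p' (q + 1) r'
    rw [← h, sweepWord_cons] at h1
    simp [countP_replicate, isHash] at h1
  | (k + 1, m) :: L, (k', m') :: L' =>
    obtain ⟨hk, hm⟩ := hL (k', m') (by simp)
    simp only at hk hm
    obtain ⟨k', rfl⟩ := Nat.exists_eq_succ_of_ne_zero hk.ne'
    obtain ⟨m', rfl⟩ := Nat.exists_eq_succ_of_ne_zero hm.ne'
    -- An empty `a`-block merges two `#`-blocks, again shortening the presentation. If it is the
    -- last block, the words differ: a `¢` would follow the `#`s directly, while the other
    -- presentation has an `a` there.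
    match m, L with
    | 0, (k2, m2) :: L =>
      rw [sweepWord_zero_merge] at h
      obtain ⟨h1, h2⟩ := ih ((k + 1 + k2, m2) :: L).length (by simp) hL h rfl
      refine ⟨by simp at h1 ⊢; omega, fun h3 => ?_⟩
      simp at h1 h3
      omega
    | 0, [] =>
      rw [sweepWord_cons, sweepWord_cons] at h
      simp only [replicate_succ (n := k), replicate_succ (n := k'), cons_append] at h
      replace h := replicate_append_cons_inj (by simp) (by simp) h
      obtain ⟨rfl, h⟩ := h
      simp only [← cons_append, ← replicate_succ] at h
      simp only [sweepWord, replicate_succ, blocks_nil, replicate_zero, nil_append] at h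
      simp only [← replicate_succ (a := NslLetter.hash), cons_append] at h
      have := (replicate_append_cons_inj (by simp) (by simp) h).2
      simp at this
    | m + 1, L =>
      rw [sweepWord_cons, sweepWord_cons] at h
      simp only [replicate_succ (n := k), replicate_succ (n := k'), cons_append] at h
      replace h := replicate_append_cons_inj (by simp) (by simp) h
      obtain ⟨rfl, h⟩ := h
      simp only [← cons_append, ← replicate_succ] at h
      have h0 := h
      rw [sweepWord, sweepWord, replicate_succ (n := m), replicate_succ (n := m')] at h
      replace h := replicate_append_cons_inj (by simp) (by simp) h
      obtain ⟨hkk, h⟩ := h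
      rw [hkk] at h0
      have h0 := append_cancel_left h0
      obtain ⟨h1, h2⟩ := ih L.length (by simp) (fun x hx => hL x (by simp [hx])) h0 rfl
      refine ⟨by simpa using h1, fun h3 => ?_⟩
      obtain ⟨h4, rfl, -, h5⟩ := h2 (by simpa using h3)
      simp at hkk h4
      simp [hkk, h4, h5]

/-- The blocks of the word that is left after the first sweep. -/
def goodBlocks (s : ℕ) : List (ℕ × ℕ) := (range s).map fun i => (i, 2 * i + 2)

/-- The leading `(0, 2)` is what a later sweep erases entirely; the remaining blocks exceed those of
the next smaller word by one `#` and two `a`. -/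
theorem goodBlocks_succ (s : ℕ) :
    goodBlocks (s + 1) = (0, 2) :: (goodBlocks s).map fun x => (x.1 + 1, x.2 + 2) := by
  simp [goodBlocks, range_succ_eq_map, Function.comp_def, Nat.mul_add]

theorem blocks_map (i j : ℕ) (t : List NslLetter) (L : List (ℕ × ℕ)) :
    blocks 0 0 t (L.map fun x => (x.1 + i, x.2 + j)) = blocks i j t L := by
  simp [blocks, flatMap_map]

theorem eq_of_acc_g0_cent {q r : ℕ} (h : Acc [] .g0 (replicate q cent ++ replicate r a) s) :
    q = 0 ∧ r = 2 ∧ s = 0 := by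
  obtain ⟨v, h1, h2⟩ := exists_of_acc_g0 h
  cases q with
  | succ q => simp [replicate_succ] at h1
  | zero =>
    match r, h1 with
    | 0, h1 => simp at h1
    | 1, h1 => simp at h1
    | r + 2, h1 =>
      simp [replicate_succ] at h1
      subst h1
      rcases exists_of_acc_g2 h2 with ⟨h2, h3⟩ | ⟨L, q, r', s', h2, -⟩
      · simpa [h3] using h2
      · have := congrArg (countP isCent) h2
        simp [countP_replicate, isCent] at this

/-- The counter is at least the number of blocks. A sweep lowers the counter by one, while the parse
that it enforces has at most `L.length - 1` blocks. By induction the parse is the good one and has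
exactly as many blocks as the new counter, so nothing merged and `L` is recovered. -/
theorem eq_of_acc_g0 {L : List (ℕ × ℕ)} {q r : ℕ} (hL : L.length ≤ s)
    (h : Acc [] .g0 (sweepWord 0 L q r) s) : L = goodBlocks s ∧ q = s ∧ r = 2 * s + 2 := by
  induction s generalizing L q r with
  | zero =>
    have : L = [] := by simpa using hL
    subst this
    obtain ⟨rfl, rfl, -⟩ := eq_of_acc_g0_cent (q := q) (r := r) (by simpa [sweepWord] using h)
    simp [goodBlocks]
  | succ s ih =>
    match L with
    | [] => 
      have := eq_of_acc_g0_cent (q := q) (r := r) (by simpa [sweepWord] using h)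
      omega
    | (k + 1, m) :: L =>
      obtain ⟨v, h1, h2⟩ := exists_of_acc_g0 h
      simp [sweepWord, replicate_succ] at h1
    | (0, m) :: L =>
      rw [sweepWord_zero_block] at h
      obtain ⟨v, h1, h2⟩ := exists_of_acc_g0 h
      rcases exists_of_acc_g2 h2 with ⟨h2, h3⟩ | ⟨L', q', r', s', rfl, hs, h2⟩
      · omega
      simp at hs
      subst hs
      replace h1 : sweepWord (0 + m) L q r =
          sweepWord 2 (L'.map fun x => (x.1 + 1, x.2 + 2)) (q' + 1) (r' + 2) := by
        rw [h1, sweepWord, blocks_map]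
        rfl
      -- The blocks parsed by the sweep contain at least one `#` and two `a`, and there is at least
      -- one `¢` to separate the last `a`-block from the tail, so this presentation is the shortest
      -- one.
      obtain ⟨h3, h4⟩ := sweepWord_unique (by simp; omega) (by simp) h1
      simp only [length_map] at h3 h4
      simp only [length_cons] at hL
      obtain ⟨rfl, rfl, rfl⟩ := ih (L := L') (by omega) (by simpa [sweepWord] using h2)
      obtain ⟨h5, rfl, rfl, rfl⟩ := h4 (by simp [goodBlocks] at h3 ⊢; omega)
      rw [goodBlocks_succ]
      simp at h5
      simp [h5]
      omega

theorem acc_i4 (q r : ℕ) (h : Acc [] .g0 (u ++ (replicate q cent ++ replicate r a)) s) :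
    Acc u .i4 (replicate q cent ++ replicate (r + 1) a) s := by
  rw [acc_skip_replicate (by simp [tau]), replicate_succ, acc_next (by simp [tau]) rfl]
  exact ⟨_, rfl, (acc_e r).2 (by simpa using h)⟩

theorem acc_h4 (q r : ℕ) (h : Acc [] .g0 (u ++ (replicate q cent ++ replicate r a)) s) :
    Acc u .h4 (replicate q cent ++ replicate (r + 2) a) s := by
  rw [acc_skip_replicate (by simp [tau]), replicate_succ, acc_next (by simp [tau]) rfl]
  refine ⟨_, rfl, ?_⟩
  rw [replicate_succ, acc_next (by simp [tau]) rfl]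
  exact ⟨_, rfl, (acc_e r).2 (by simpa using h)⟩

theorem acc_i2 {L : List (ℕ × ℕ)} {q r : ℕ}
    (h : Acc [] .g0 (u ++ (blocks 0 0 [] L ++ (replicate q cent ++ replicate r a)))
      (s + L.length)) :
    Acc u .i2 (blocks 1 1 [dollar] L ++ (replicate (q + 1) cent ++ replicate (r + 1) a))
      (s + 1) := by
  induction L generalizing u s with
  | nil =>
    rw [blocks_nil, nil_append, replicate_succ (n := q), cons_append, acc_cent (by simp [tau])]
    exact ⟨s, rfl, Or.inl ⟨rfl, acc_i4 _ _ (by simpa using h)⟩⟩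
  | cons x L ih =>
    obtain ⟨k, m⟩ := x
    simp only [blocks_cons, append_assoc]
    rw [replicate_succ, cons_append, acc_next (by simp [tau]) rfl]
    refine ⟨_, rfl, ?_⟩
    rw [acc_skip_replicate (by simp [tau]), replicate_succ, cons_append,
      acc_next (by simp [tau]) rfl]
    refine ⟨_, rfl, ?_⟩
    rw [acc_skip_replicate (by simp [tau]), singleton_append, acc_dollar (by simp [tau])]
    refine ⟨by simp, ih ?_⟩
    convert h using 1
    · simp
    · simp; omega

theorem acc_h5 {p : ℕ} {L : List (ℕ × ℕ)} {q r : ℕ}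
    (h : Acc [] .g0 (u ++ (replicate p a ++ 
      (blocks 0 0 [] L ++ (replicate q cent ++ replicate r a)))) s) :
    Acc u .h5 (replicate p a ++ (blocks 1 2 [] L ++ (replicate (q + 1) cent ++
      replicate (r + 2) a))) (s + 1) := by
  induction L generalizing u p with
  | nil =>
    rw [acc_skip_replicate (by simp [tau]), blocks_nil, nil_append, replicate_succ (n := q),
      cons_append, acc_cent (by simp [tau])]
    exact ⟨s, rfl, Or.inr ⟨by simp, acc_h4 _ _ (by simpa using h)⟩⟩
  | cons x L ih =>
    obtain ⟨k, m⟩ := x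
    simp only [blocks_cons, append_assoc]
    rw [acc_skip_replicate (by simp [tau]), replicate_succ (n := k), cons_append, 
      acc_next (by simp [tau]) rfl]
    refine ⟨_, rfl, ?_⟩
    rw [acc_skip_replicate (by simp [tau]), replicate_succ, cons_append,
      acc_next (by simp [tau]) rfl]
    refine ⟨_, rfl, ?_⟩
    rw [replicate_succ, cons_append, acc_next (by simp [tau]) rfl]
    exact ⟨_, rfl, ih (by simpa using h)⟩

/-- `g2` and `h5` have the same moves on `#` and `¢`; this lets `acc_h5` with an empty `a`-block be
used at the start of a sweep. -/
theorem acc_g2_of_acc_h5 {c : NslLetter} (hc : c ≠ a) (h : Acc u .h5 (c :: w) s) :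
    Acc u .g2 (c :: w) s := by
  cases c with
  | a => simp at hc
  | dollar => rw [acc_dollar (by simp [tau])] at h; simp at h
  | cent => rw [acc_cent (by simp [tau])] at h ⊢; simpa using h
  | hash => rw [acc_next (by simp [tau]) rfl] at h ⊢; simpa [next] using h

theorem acc_g0 (s : ℕ) : Acc [] .g0 (sweepWord 0 (goodBlocks s) s (2 * s + 2)) s := by
  induction s with
  | zero =>
    change Acc [] .g0 [a, a] 0
    rw [acc_next (by simp [tau]) rfl]
    refine ⟨_, rfl, ?_⟩
    rw [acc_next (by simp [tau]) rfl]
    exact ⟨_, rfl, acc_nil.2 (by simp)⟩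
  | succ s ih =>
    rw [goodBlocks_succ, sweepWord_zero_block, sweepWord, blocks_map]
    change Acc [] .g0 (a :: a :: _) _
    rw [acc_next (by simp [tau]) rfl]
    refine ⟨_, rfl, ?_⟩
    rw [acc_next (by simp [tau]) rfl]
    refine ⟨_, rfl, ?_⟩
    have := acc_h5 (u := []) (p := 0) (by simpa [sweepWord] using ih)
    revert this
    generalize hv : replicate 0 a ++ _ = v
    simp only [replicate_zero, nil_append] at hv ⊢
    rw [show 2 * (s + 1) + 2 = 2 * s + 2 + 2 by ring, hv]
    cases v with
    | nil => simp at hv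
    | cons c v =>
      refine acc_g2_of_acc_h5 ?_
      rintro rfl
      -- After the leading `a^2` comes a `¢` if `s = 0` and a `#` otherwise.
      cases s <;> simp [goodBlocks, range_succ_eq_map, replicate_succ] at hv

/-- The factors are regrouped so that each `#`-block is joined with the `a`-block after it; this is
the form in which the first sweep parses the word. -/
theorem nslWord_succ (k : ℕ) : nslWord (k + 1) = a :: dollar ::
    (blocks 1 1 [dollar] (goodBlocks k) ++ (replicate (k + 1) cent ++ replicate (2 * k + 3) a)) := by
  have : (range k).flatMap (fun i => replicate (2 * i + 1) NslLetter.a ++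
        NslLetter.dollar :: replicate (i + 1) NslLetter.hash) ++ 
        (replicate (2 * k + 1) NslLetter.a ++ [dollar]) =
      a :: dollar :: blocks 1 1 [dollar] (goodBlocks k) := by
    induction k with
    | zero => rfl
    | succ k ih =>
      rw [range_succ, flatMap_append]
      simp only [flatMap_singleton]
      have h2 : blocks 1 1 [dollar] (goodBlocks (k + 1)) = blocks 1 1 [dollar] (goodBlocks k) ++
          (replicate (k + 1) .hash ++ (replicate (2 * (k + 1) + 1) a ++ [dollar])) := by
        simp [goodBlocks, range_succ, blocks, Nat.mul_add]
      rw [h2, ← cons_append, ← cons_append, ← ih]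
      simp
  rw [nslWord, ← cons_append, ← cons_append, ← this]
  simp

theorem language_eq : aut.nrLanguage = Lnsl := by
  ext w
  have h0 : w ∈ aut.nrLanguage ↔ Acc [] .i0 w 0 := Iff.rfl
  rw [h0]
  constructor
  · intro h
    cases w with
    | nil => rw [acc_nil] at h; simp at h
    | cons c w =>
    cases c with
    | dollar => rw [acc_dollar (by simp [tau])] at h; simp at h
    | cent => rw [acc_cent (by simp [tau])] at h; simp at h
    | hash => rw [acc_next (by simp [tau]) rfl] at h; simp [next] at h
    | a => 
    rw [acc_next (by simp [tau]) rfl] at h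
    simp only [next, Option.some.injEq, exists_eq_left'] at h
    cases w with
    | nil => exact ⟨0, rfl⟩
    | cons c w =>
    cases c with
    | a => rw [acc_next (by simp [tau]) rfl] at h; simp [next] at h
    | cent => rw [acc_cent (by simp [tau])] at h; simp at h
    | hash => rw [acc_next (by simp [tau]) rfl] at h; simp [next] at h
    | dollar =>
      rw [acc_dollar (by simp [tau])] at h
      replace h := exists_of_acc_i.1 h.2
      obtain ⟨L, q, r, s, rfl, hs, h⟩ := h
      have hs : L.length = s := by omega
      obtain ⟨rfl, rfl, rfl⟩ := eq_of_acc_g0 hs.le (by simpa [sweepWord] using h)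
      exact ⟨q + 1, (nslWord_succ q).symm⟩
  · rintro ⟨k, rfl⟩
    cases k with
    | zero =>
      change Acc [] .i0 [a] 0
      rw [acc_next (by simp [tau]) rfl]
      exact ⟨_, rfl, acc_nil.2 (by simp)⟩
    | succ k =>
      rw [nslWord_succ, acc_next (by simp [tau]) rfl]
      refine ⟨_, rfl, ?_⟩
      rw [acc_dollar (by simp [tau])]
      refine ⟨by simp, acc_i2 ?_⟩
      have := acc_g0 k
      simpa [sweepWord, goodBlocks] using this

theorem lnsl_mem : Lnsl ∈ familyNrDIDPDAwtl NslLetter :=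
  ⟨aut, deterministic, language_eq⟩

end NslAutomaton

end

section

/-! ### The shuffle languages, and a nondeterministic returning automaton for them -/

namespace ABHash

open List

def isA : ABHash → Bool
  | a => true
  | _ => false

@[simp] theorem isA_a : isA a = true := rfl

/-- The word without its letters `a`. -/
def eraseA (w : List ABHash) : List ABHash := w.filter fun c => !isA c

@[simp] theorem eraseA_nil : eraseA [] = [] := rfl
@[simp] theorem eraseA_append (v w : List ABHash) : eraseA (v ++ w) = eraseA v ++ eraseA w :=
  filter_append ..
@[simp] theorem eraseA_a (w : List ABHash) : eraseA (a :: w) = eraseA w := rfl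
@[simp] theorem eraseA_b (w : List ABHash) : eraseA (b :: w) = b :: eraseA w := rfl
@[simp] theorem eraseA_hash (w : List ABHash) : eraseA (.hash :: w) = .hash :: eraseA w := rfl
@[simp] theorem countP_isA_a (w : List ABHash) : countP isA (a :: w) = countP isA w + 1 :=
  countP_cons_of_pos rfl
@[simp] theorem countP_isA_b (w : List ABHash) : countP isA (b :: w) = countP isA w := by
  simp [isA]
@[simp] theorem countP_isA_hash (w : List ABHash) : countP isA (.hash :: w) = countP isA w := by
  simp [isA]
@[simp] theorem countP_isA_replicate_a (n : ℕ) : countP isA (replicate n a) = n := by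
  simp [countP_replicate, isA]
@[simp] theorem countP_isA_replicate_b (n : ℕ) : countP isA (replicate n b) = 0 := by
  simp [countP_replicate, isA]
@[simp] theorem eraseA_replicate_a (n : ℕ) : eraseA (replicate n a) = [] := by
  simp [eraseA, isA]
@[simp] theorem eraseA_replicate_b (n : ℕ) : eraseA (replicate n b) = replicate n b := by
  simp [eraseA, isA]
@[simp] theorem eraseA_bHashB (i j : ℕ) : eraseA (bHashB i j) = bHashB i j := by
  simp [bHashB]
@[simp] theorem countP_isA_bHashB (i j : ℕ) : countP isA (bHashB i j) = 0 := by
  simp [bHashB]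

/-- Since the first word contains no `a` and the second one nothing else, the two parts of a
shuffled word can be told apart letter by letter. -/
theorem mem_shuffle_iff {v w : List ABHash} (hv : countP isA v = 0) (n : ℕ) :
    w ∈ shuffle {v} {replicate n a} ↔ eraseA w = v ∧ countP isA w = n := by
  constructor
  · rintro ⟨p, h1, h2, rfl⟩
    change (p.map Prod.fst).flatten = v at h1
    change (p.map Prod.snd).flatten = replicate n a at h2
    subst h1
    have key : ∀ p : List (List ABHash × List ABHash),
        countP isA (p.map Prod.fst).flatten = 0 → (∀ c ∈ (p.map Prod.snd).flatten, c = a) →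
        eraseA (p.map fun xy => xy.1 ++ xy.2).flatten = (p.map Prod.fst).flatten ∧
        countP isA (p.map fun xy => xy.1 ++ xy.2).flatten = (p.map Prod.snd).flatten.length := by
      intro p
      induction p with
      | nil => simp
      | cons x p ih =>
        intro h1 h2
        simp only [map_cons, flatten_cons, countP_append, Nat.add_eq_zero_iff] at h1
        obtain ⟨h3, h4⟩ := ih h1.2 (fun c hc => h2 c (by simp at hc ⊢; exact Or.inr hc))
        have h5 : x.2 = replicate x.2.length a :=
          eq_replicate_iff.2 ⟨rfl, fun c hc => h2 c (by simp [hc])⟩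
        have h6 : eraseA x.1 = x.1 := by
          have := h1.1
          rw [countP_eq_zero] at this
          exact filter_eq_self.2 fun c hc => by simpa using this c hc
        have h7 : eraseA x.2 = [] := by rw [h5]; simp
        have h8 : countP isA x.2 = x.2.length := by rw [h5]; simp
        simp only [map_cons, flatten_cons, eraseA_append, countP_append, length_append]
        rw [h3, h4, h6, h7, h8, h1.1]
        simp
    obtain ⟨h3, h4⟩ := key p hv (by rw [h2]; simp)
    exact ⟨h3, by rw [h4, h2]; simp⟩
  · rintro ⟨rfl, rfl⟩
    -- Each letter becomes a factor of its own, paired with the empty word.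
    refine ⟨w.map fun c => if isA c then ([], [c]) else ([c], []), ?_, ?_, ?_⟩
    · change _ = _
      clear hv
      induction w with
      | nil => rfl
      | cons c w ih => cases c <;> simpa [isA] using ih
    · change _ = _
      clear hv
      induction w with
      | nil => rfl
      | cons c w ih => cases c <;> simpa [isA, replicate_succ] using ih
    · clear hv
      induction w with
      | nil => rfl
      | cons c w ih => cases c <;> simpa [isA] using ih

theorem mem_union_iff {w : List ABHash} : w ∈ langL₁ + langL₂ ↔
    ∃ i j n, 1 ≤ i ∧ 1 ≤ j ∧ (n = i ∨ n = j) ∧ eraseA w = bHashB i j ∧ countP isA w = n := by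
  rw [Language.add_def]
  constructor
  · rintro (⟨m, n, hm, hn, h⟩ | ⟨m, n, hm, hn, h⟩)
    · rw [mem_shuffle_iff (by simp)] at h
      exact ⟨n, m, n, hn, hm, Or.inl rfl, h⟩
    · rw [mem_shuffle_iff (by simp)] at h
      exact ⟨m, n, n, hm, hn, Or.inr rfl, h⟩
  · rintro ⟨i, j, n, hi, hj, rfl | rfl, h⟩
    · exact Or.inl ⟨j, n, hj, hi, (mem_shuffle_iff (by simp) _).2 h⟩
    · exact Or.inr ⟨i, n, hi, hj, (mem_shuffle_iff (by simp) _).2 h⟩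

theorem bHashB_succ (i j : ℕ) : bHashB (i + 1) j = b :: bHashB i j := rfl

theorem bHashB_zero (j : ℕ) : bHashB 0 j = .hash :: replicate j b := rfl

theorem eraseA_eq_cons {w v : List ABHash} {c : ABHash} (h : eraseA w = c :: v) :
    ∃ k y, w = replicate k a ++ c :: y ∧ eraseA y = v := by
  induction w with
  | nil => simp at h
  | cons d w ih =>
    cases d with
    | a =>
      replace h := ih h
      obtain ⟨k, y, rfl, h⟩ := h
      exact ⟨k + 1, y, rfl, h⟩
    | b => simp at h; obtain ⟨rfl, h⟩ := h; exact ⟨0, w, rfl, h⟩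
    | hash => simp at h; obtain ⟨rfl, h⟩ := h; exact ⟨0, w, rfl, h⟩

theorem exists_of_countP_isA {w : List ABHash} {n : ℕ} (h : countP isA w = n + 1) :
    ∃ x y, w = x ++ a :: y ∧ a ∉ x := by
  induction w with
  | nil => simp at h
  | cons d w ih =>
    cases d with
    | a => exact ⟨[], w, rfl, by simp⟩
    | b => obtain ⟨x, y, rfl, hx⟩ := ih h; exact ⟨b :: x, y, rfl, by simpa using hx⟩
    | hash => obtain ⟨x, y, rfl, hx⟩ := ih h; exact ⟨.hash :: x, y, rfl, by simpa using hx⟩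

theorem eq_of_eraseA_eq {w v : List ABHash} (h : eraseA w = v) (h' : countP isA w = 0) : w = v := by
  rw [← h]
  rw [countP_eq_zero] at h'
  exact (filter_eq_self.2 fun c hc => by simpa using h' c hc).symm

end ABHash

/-! ### The guess-and-match automaton -/

namespace UnionAutomaton

open NIDPDAwtl ABHash List

inductive State where
  | s0 | p0 | p1 | p2 | p3 | p4 | q0 | q1 | q2 | q3 | qf

def tau : State → Set ABHash
  | .s0 => Set.univ
  | .p0 => {a}
  | .p1 => {b, .hash}
  | .p2 => {a}
  | .q0 => {a}
  | .q1 => {a}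
  | .q2 => {a}
  | .q3 => {b, .hash}
  | _ => ∅

/-- The successor states. -/
def next : State → Option ABHash → Set State
  | .s0, none => {.p0, .q0}
  | .p0, some b => {.p1}
  | .p1, some a => {.p2}
  | .p2, some b => {.p1}
  | .p2, some .hash => {.p3}
  | .p3, some b => {.p4}
  | .p4, some b => {.p4}
  | .q0, some b => {.q1}
  | .q1, some b => {.q1}
  | .q1, some .hash => {.q2}
  | .q2, some b => {.q3}
  | .q3, some a => {.q2, .qf}
  | _, _ => ∅

/-- Missing moves are encoded as `goto ∅` instead of `undefined`; both leave the automaton stuck. -/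
def deltaN : State → Option ABHash → TransValue State
  | .p4, none => .accept
  | .qf, none => .accept
  | q, c => .goto (next q c)

abbrev aut : NIDPDAwtl ABHash where
  Q := State
  Γ := Unit
  finite_alphabet := by
    refine Set.finite_univ_iff.mp (Set.Finite.subset (Set.toFinite {a, b, .hash}) ?_)
    intro x _
    cases x <;> simp
  finite_states := by
    refine Set.finite_univ_iff.mp (Set.Finite.subset (Set.toFinite
      {.s0, .p0, .p1, .p2, .p3, .p4, .q0, .q1, .q2, .q3, .qf}) ?_)
    intro x _
    cases x <;> simp
  finite_stack := inferInstance
  kind := fun _ => .keep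
  q₀ := .s0
  τ := tau
  δD := fun _ _ _ => .undefined
  δR := fun _ _ _ => .undefined
  δN := fun q c _ => deltaN q c

/-- Acceptance from a configuration with empty pushdown store. -/
def Acc (q : State) (w : List ABHash) : Prop :=
  Relation.ReflTransGen aut.Step (.run q w []) .accept

theorem acc_letter {q q' : State} {x y : List ABHash} {c : ABHash} (hx : ∀ d ∈ x, d ∈ tau q)
    (hc : c ∉ tau q) (h : q' ∈ next q (some c)) (h' : Acc q' (x ++ y)) : Acc q (x ++ c :: y) := by
  unfold Acc at *
  refine Relation.ReflTransGen.head (Step.letter (q' := q') (γ' := []) hx hc ?_) h'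
  refine Read.keep (S := next q (some c)) rfl ?_ h
  cases q <;> rfl

theorem acc_s0 {q : State} {w : List ABHash} (h : q ∈ next .s0 none) (h' : Acc q w) :
    Acc .s0 w := by
  unfold Acc at *
  refine Relation.ReflTransGen.head (Step.endmarker (q' := q) (S := next .s0 none) ?_ rfl h) h'
  exact fun _ _ => Set.mem_univ _

theorem acc_of_accept {q : State} (h : q = .p4 ∨ q = .qf) : Acc q [] := by
  refine Relation.ReflTransGen.single (Step.endmarkerAccept (by simp) ?_)
  rcases h with rfl | rfl <;> rfl

/-- The language accepted from a state. -/
def Inv : State → List ABHash → Prop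
  | .s0, w => w ∈ langL₁ + langL₂
  | .p0, w => ∃ n m, eraseA w = bHashB (n + 1) (m + 1) ∧ countP isA w = n + 1
  | .p1, w => ∃ n m, eraseA w = bHashB n (m + 1) ∧ countP isA w = n + 1
  | .p2, w => ∃ n m, eraseA w = bHashB n (m + 1) ∧ countP isA w = n
  | .p3, w => ∃ m, w = replicate (m + 1) b
  | .p4, w => ∃ m, w = replicate m b
  | .q0, w => ∃ m n, eraseA w = bHashB (m + 1) (n + 1) ∧ countP isA w = n + 1
  | .q1, w => ∃ m n, eraseA w = bHashB m (n + 1) ∧ countP isA w = n + 1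
  | .q2, w => ∃ n, eraseA w = replicate (n + 1) b ∧ countP isA w = n + 1
  | .q3, w => ∃ n, eraseA w = replicate n b ∧ countP isA w = n + 1
  | .qf, w => w = []

theorem inv_s0_iff {w : List ABHash} : Inv .s0 w ↔ Inv .p0 w ∨ Inv .q0 w := by
  simp only [Inv]
  rw [mem_union_iff]
  constructor
  · rintro ⟨i, j, n, hi, hj, h, h1, h2⟩
    obtain ⟨i, rfl⟩ := Nat.exists_eq_succ_of_ne_zero (Nat.one_le_iff_ne_zero.1 hi)
    obtain ⟨j, rfl⟩ := Nat.exists_eq_succ_of_ne_zero (Nat.one_le_iff_ne_zero.1 hj)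
    rcases h with rfl | rfl
    · exact Or.inl ⟨i, j, h1, h2⟩
    · exact Or.inr ⟨i, j, h1, h2⟩
  · rintro (⟨n, m, h1, h2⟩ | ⟨n, m, h1, h2⟩)
    · exact ⟨_, _, _, by simp, by simp, Or.inl rfl, h1, h2⟩
    · exact ⟨_, _, _, by simp, by simp, Or.inr rfl, h1, h2⟩

/-- The languages in `Inv` are closed under undoing a step. With the acceptance conditions of `p4`
and `qf`, this gives soundness by induction from the accepting end. -/
theorem inv_letter {q q' : State} {x y : List ABHash} {c : ABHash} (hx : ∀ d ∈ x, d ∈ tau q)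
    (hc : c ∉ tau q) (h : q' ∈ next q (some c)) (h' : Inv q' (x ++ y)) : Inv q (x ++ c :: y) := by
  have hA : tau q = {a} → ∃ k, x = replicate k a := fun hq =>
    ⟨x.length, eq_replicate_iff.2 ⟨rfl, fun d hd => by simpa [hq] using hx d hd⟩⟩
  have hE : tau q = ∅ → x = [] := fun hq =>
    eq_nil_iff_forall_not_mem.2 fun d hd => by simpa [hq] using hx d hd
  cases q <;> cases c <;> simp [next, tau] at h hc hA hE
  case p0.b | q0.b =>
    obtain ⟨k, rfl⟩ := hA
    subst h
    obtain ⟨n, m, h1, h2⟩ := h'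
    refine ⟨n, m, ?_, ?_⟩ <;> simp_all [bHashB_succ]
  case p2.b =>
    obtain ⟨k, rfl⟩ := hA
    subst h
    obtain ⟨n, m, h1, h2⟩ := h'
    refine ⟨n + 1, m, ?_, ?_⟩ <;> simp_all [bHashB_succ]
  case q1.b =>
    obtain ⟨k, rfl⟩ := hA
    subst h
    obtain ⟨n, m, h1, h2⟩ := h'
    refine ⟨n + 1, m, ?_, ?_⟩ <;> simp_all [bHashB_succ]
  case p1.a =>
    subst h
    obtain ⟨n, m, h1, h2⟩ := h'
    refine ⟨n, m, ?_, ?_⟩ <;> simp_all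
    omega
  case p2.hash =>
    obtain ⟨k, rfl⟩ := hA
    subst h
    obtain ⟨m, h1⟩ := h'
    have h2 := congrArg (countP isA) h1
    simp at h2
    refine ⟨0, m, ?_, ?_⟩ <;> simp_all [bHashB_zero]
  case p3.b =>
    subst hE h
    obtain ⟨m, h1⟩ := h'
    exact ⟨m, by simp_all [replicate_succ]⟩
  case p4.b =>
    subst hE h
    obtain ⟨m, h1⟩ := h'
    exact ⟨m + 1, by simp_all [replicate_succ]⟩
  case q1.hash =>
    obtain ⟨k, rfl⟩ := hA
    subst h
    obtain ⟨n, h1, h2⟩ := h'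
    refine ⟨0, n, ?_, ?_⟩ <;> simp_all [bHashB_zero]
  case q2.b =>
    obtain ⟨k, rfl⟩ := hA
    subst h
    obtain ⟨n, h1, h2⟩ := h'
    refine ⟨n, ?_, ?_⟩ <;> simp_all [replicate_succ]
  case q3.a =>
    rcases h with rfl | rfl
    · obtain ⟨n, h1, h2⟩ := h'
      refine ⟨n + 1, ?_, ?_⟩ <;> simp_all
      omega
    · simp only [Inv, append_eq_nil_iff] at h'
      obtain ⟨rfl, rfl⟩ := h'
      exact ⟨0, by simp, by simp⟩

theorem inv_of_acc {q : State} {w : List ABHash} (h : Acc q w) : Inv q w := by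
  have key : ∀ c : aut.Config, Relation.ReflTransGen aut.Step c .accept →
      ∀ q w γ, c = .run q w γ → Inv q w := by
    intro c hc
    induction hc using Relation.ReflTransGen.head_induction_on with
    | refl => intro q w γ h; cases h
    | head hs _ ih =>
      rintro q w γ rfl
      cases hs with
      | @letter _ q' x y c _ γ' hx hc hr =>
        rcases read_iff.1 hr with ⟨h1, -⟩ | ⟨h1, -⟩ | ⟨-, S, h1, h2, -⟩
        · cases h1
        · cases h1
        · refine inv_letter hx hc ?_ (ih _ _ _ rfl)
          cases q <;> cases c <;> cases h1 <;> exact h2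
      | @letterAccept _ x y c _ hx hc hr =>
        rcases readAccept_iff.1 hr with ⟨h1, -⟩ | ⟨h1, -⟩ | ⟨-, h1⟩
        · cases h1
        · cases h1
        · cases q <;> cases c <;> cases h1
      | @endmarker _ q' _ _ S hx h1 h2 =>
        have h3 := ih _ _ _ rfl
        -- Every other value on the endmarker is `accept` or the empty set of continuations.
        have hq : q = State.s0 := by
          clear hx ih h3
          revert h1
          cases q <;> intro h1 <;> cases h1 <;> first | rfl | exact False.elim h2
        subst hq
        cases h1
        rw [inv_s0_iff]
        rcases h2 with rfl | rfl
        · exact Or.inl h3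
        · exact Or.inr h3
      | @endmarkerAccept _ _ _ hx h1 =>
        have hw : tau q = ∅ → w = [] := fun hq =>
          eq_nil_iff_forall_not_mem.2 fun d hd => by
            have := hx d hd
            rw [show aut.τ q = tau q from rfl, hq] at this
            exact this
        cases q <;> cases h1
        · exact ⟨0, hw rfl⟩
        · exact hw rfl
  exact key _ h _ _ _ rfl

theorem acc_p4 (m : ℕ) : Acc .p4 (replicate m b) := by
  induction m with
  | zero => exact acc_of_accept (Or.inl rfl)
  | succ m ih => exact acc_letter (x := []) (by simp) (by simp [tau]) (by simp [next]) ih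

theorem acc_p3 (m : ℕ) : Acc .p3 (replicate (m + 1) b) :=
  acc_letter (x := []) (by simp) (by simp [tau]) (by simp [next]) (acc_p4 m)

theorem acc_p2 {n m : ℕ} {w : List ABHash} (h : eraseA w = bHashB n (m + 1))
    (h' : countP isA w = n) : Acc .p2 w := by
  induction n generalizing w with
  | zero =>
    rw [eq_of_eraseA_eq h h', bHashB_zero]
    exact acc_letter (x := []) (q' := .p3) (by simp) (by simp [tau]) (by simp [next]) (acc_p3 m)
  | succ n ih =>
    rw [bHashB_succ] at h
    replace h := eraseA_eq_cons h
    obtain ⟨k, y, rfl, h⟩ := h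
    refine acc_letter (q' := .p1) (by simp [tau]) (by simp [tau]) (by simp [next]) ?_
    obtain ⟨x, z, hxz, hx⟩ := exists_of_countP_isA (w := replicate k a ++ y) (n := n)
      (by simpa using h')
    rw [hxz]
    have h1 := congrArg eraseA hxz
    have h2 := congrArg (countP isA) hxz
    refine acc_letter (q' := .p2) ?_ (by simp [tau]) (by simp [next]) (ih ?_ ?_)
    · intro d hd
      cases d <;> simp_all [tau]
    · simp at h1 ⊢; rw [← h1, h]
    · simp at h2 h' ⊢; omega

theorem acc_p0 {w : List ABHash} (h : Inv .p0 w) : Acc .p0 w := by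
  obtain ⟨n, m, h, h'⟩ := h
  rw [bHashB_succ] at h
  replace h := eraseA_eq_cons h
  obtain ⟨k, y, rfl, h⟩ := h
  refine acc_letter (q' := .p1) (by simp [tau]) (by simp [tau]) (by simp [next]) ?_
  obtain ⟨x, z, hxz, hx⟩ := exists_of_countP_isA (w := replicate k a ++ y) (n := n)
    (by simpa using h')
  rw [hxz]
  have h1 := congrArg eraseA hxz
  have h2 := congrArg (countP isA) hxz
  refine acc_letter (q' := .p2) ?_ (by simp [tau]) (by simp [next]) (acc_p2 (n := n) (m := m) ?_ ?_)
  · intro d hd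
    cases d <;> simp_all [tau]
  · simp at h1 ⊢; rw [← h1, h]
  · simp at h2 h' ⊢; omega

theorem acc_q2 {n : ℕ} {w : List ABHash} (h : eraseA w = replicate (n + 1) b)
    (h' : countP isA w = n + 1) : Acc .q2 w := by
  induction n generalizing w with
  | zero =>
    replace h := eraseA_eq_cons h
    obtain ⟨k, y, rfl, h⟩ := h
    refine acc_letter (q' := .q3) (by simp [tau]) (by simp [tau]) (by simp [next]) ?_
    obtain ⟨x, z, hxz, hx⟩ := exists_of_countP_isA (w := replicate k a ++ y) (n := 0)
      (by simpa using h')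
    rw [hxz]
    have h1 := congrArg eraseA hxz
    have h2 := congrArg (countP isA) hxz
    refine acc_letter (q' := .qf) ?_ (by simp [tau]) (by simp [next]) ?_
    · intro d hd
      cases d <;> simp_all [tau]
    · rw [eq_of_eraseA_eq (w := x ++ z) (v := [])]
      · exact acc_of_accept (Or.inr rfl)
      · simp at h1 ⊢; rw [h] at h1; simpa using h1.symm
      · rw [countP_append]; simp at h2 h'; omega
  | succ n ih =>
    replace h := eraseA_eq_cons h
    obtain ⟨k, y, rfl, h⟩ := h
    refine acc_letter (q' := .q3) (by simp [tau]) (by simp [tau]) (by simp [next]) ?_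
    obtain ⟨x, z, hxz, hx⟩ := exists_of_countP_isA (w := replicate k a ++ y) (n := n + 1)
      (by simpa using h')
    rw [hxz]
    have h1 := congrArg eraseA hxz
    have h2 := congrArg (countP isA) hxz
    refine acc_letter (q' := .q2) ?_ (by simp [tau]) (by simp [next]) (ih ?_ ?_)
    · intro d hd
      cases d <;> simp_all [tau]
    · simp at h1 ⊢; rw [← h1, h]
    · simp at h2 h' ⊢; omega

theorem acc_q1 {m n : ℕ} {w : List ABHash} (h : eraseA w = bHashB m (n + 1))
    (h' : countP isA w = n + 1) : Acc .q1 w := by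
  induction m generalizing w with
  | zero =>
    replace h := eraseA_eq_cons h
    obtain ⟨k, y, rfl, h⟩ := h
    exact acc_letter (q' := .q2) (by simp [tau]) (by simp [tau]) (by simp [next])
      (acc_q2 (by simpa using h) (by simpa using h'))
  | succ m ih =>
    replace h := eraseA_eq_cons h
    obtain ⟨k, y, rfl, h⟩ := h
    exact acc_letter (q' := .q1) (by simp [tau]) (by simp [tau]) (by simp [next])
      (ih (by simpa [bHashB] using h) (by simpa using h'))

theorem acc_q0 {w : List ABHash} (h : Inv .q0 w) : Acc .q0 w := by
  obtain ⟨n, m, h, h'⟩ := h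
  replace h := eraseA_eq_cons h
  obtain ⟨k, y, rfl, h⟩ := h
  exact acc_letter (q' := .q1) (by simp [tau]) (by simp [tau]) (by simp [next])
    (acc_q1 (by simpa [bHashB] using h) (by simpa using h'))

theorem union_mem : langL₁ + langL₂ ∈ familyNIDPDAwtl ABHash := by
  refine ⟨aut, Set.ext fun w => ?_⟩
  change Acc .s0 w ↔ Inv .s0 w
  refine ⟨inv_of_acc, fun h => ?_⟩
  rcases inv_s0_iff.1 h with h | h
  · exact acc_s0 (by simp [next]) (acc_p0 h)
  · exact acc_s0 (by simp [next]) (acc_q0 h)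

end UnionAutomaton

end

section

/-! ### `Lnsl` is not accepted in the returning mode -/

namespace NIDPDAwtl

open List

variable {A : Type}

/-- Acceptance by a computation in the returning mode in which every letter that is processed is the
first one of the remaining input. -/
inductive FrontAcc (M : NIDPDAwtl A) : M.Q → List A → List M.Γ → Prop
  | letter {q q' : M.Q} {c : A} {w : List A} {γ γ' : List M.Γ} (hc : c ∉ M.τ q)
      (h : M.Read q c γ q' γ') (h' : FrontAcc M q' w γ') : FrontAcc M q (c :: w) γ
  | letterAccept {q : M.Q} {c : A} {w : List A} {γ : List M.Γ} (hc : c ∉ M.τ q)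
      (h : M.ReadAccept q c γ) : FrontAcc M q (c :: w) γ
  | endmarker {q q' : M.Q} {w : List A} {γ : List M.Γ} {S : Set M.Q}
      (hw : ∀ c ∈ w, c ∈ M.τ q) (hδ : M.δN q none γ.head? = TransValue.goto S) (hS : q' ∈ S)
      (h' : FrontAcc M q' w γ) : FrontAcc M q w γ
  | endmarkerAccept {q : M.Q} {w : List A} {γ : List M.Γ}
      (hw : ∀ c ∈ w, c ∈ M.τ q) (hδ : M.δN q none γ.head? = TransValue.accept) :
      FrontAcc M q w γ

/-- Listing the letters of an accepted word in the order in which they are processed. -/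
theorem exists_perm_frontAcc {M : NIDPDAwtl A} {c : M.Config}
    (h : Relation.ReflTransGen M.Step c Config.accept) :
    ∀ q w γ, c = Config.run q w γ → ∃ w', w' ~ w ∧ M.FrontAcc q w' γ := by
  induction h using Relation.ReflTransGen.head_induction_on with
  | refl => intro q w γ h; cases h
  | head hs _ ih =>
    rintro q w γ rfl
    cases hs with
    | letter hx hc hr =>
      obtain ⟨w', hp, h⟩ := ih _ _ _ rfl
      exact ⟨_ :: w', (hp.cons _).trans perm_middle.symm, .letter hc hr h⟩
    | letterAccept hx hc hr => exact ⟨_, perm_middle.symm, .letterAccept hc hr⟩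
    | endmarker hx hδ hS =>
      obtain ⟨w', hp, h⟩ := ih _ _ _ rfl
      exact ⟨w', hp, .endmarker (fun c hc => hx c (hp.mem_iff.1 hc)) hδ hS h⟩
    | endmarkerAccept hx hδ => exact ⟨w, .refl _, .endmarkerAccept hx hδ⟩

theorem FrontAcc.acc {M : NIDPDAwtl A} {q : M.Q} {w : List A} {γ : List M.Γ}
    (h : M.FrontAcc q w γ) : Relation.ReflTransGen M.Step (Config.run q w γ) Config.accept := by
  induction h with
  | letter hc h _ ih =>
    exact Relation.ReflTransGen.head (Step.letter (x := []) (by simp) hc h) (by simpa using ih)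
  | letterAccept hc h =>
    exact Relation.ReflTransGen.single (Step.letterAccept (x := []) (by simp) hc h)
  | endmarker hw hδ hS _ ih => exact Relation.ReflTransGen.head (Step.endmarker hw hδ hS) ih
  | endmarkerAccept hw hδ => exact Relation.ReflTransGen.single (Step.endmarkerAccept hw hδ)

/-- `M.FrontRun v q u γ q' γ'`: with remaining input `uv`, the prefix `u` can be processed from left
to right, leading from state `q` and pushdown content `γ` to `q'` and `γ'`. -/
inductive FrontRun (M : NIDPDAwtl A) (v : List A) :
    M.Q → List A → List M.Γ → M.Q → List M.Γ → Prop
  | refl {q : M.Q} {γ : List M.Γ} : FrontRun M v q [] γ q γ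
  | letter {q q' q'' : M.Q} {c : A} {u : List A} {γ γ' γ'' : List M.Γ} (hc : c ∉ M.τ q)
      (h : M.Read q c γ q' γ') (h' : FrontRun M v q' u γ' q'' γ'') :
      FrontRun M v q (c :: u) γ q'' γ''
  | endmarker {q q' q'' : M.Q} {u : List A} {γ γ'' : List M.Γ} {S : Set M.Q}
      (hu : ∀ c ∈ u ++ v, c ∈ M.τ q) (hδ : M.δN q none γ.head? = TransValue.goto S) (hS : q' ∈ S)
      (h' : FrontRun M v q' u γ q'' γ'') : FrontRun M v q u γ q'' γ''

variable {M : NIDPDAwtl A}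

/-- Either acceptance happens before `u` has been consumed, and then `v` mattered only through the
letters tested for translucency at the endmarker, or the computation passes through the boundary.
The tests survive if `v` is replaced by a word with fewer kinds of letters; hence the relation `⊆`
on lists. -/
theorem FrontAcc.split {q : M.Q} {u v : List A} {γ : List M.Γ} (h : M.FrontAcc q (u ++ v) γ) :
    (∀ v', v' ⊆ v → M.FrontAcc q (u ++ v') γ) ∨
      ∃ q' γ', M.FrontRun v q u γ q' γ' ∧ M.FrontAcc q' v γ' := by
  generalize hw : u ++ v = w at h
  induction h generalizing u with
  | @letter q q' c w γ γ' hc h h' ih =>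
    cases u with
    | nil => subst hw; exact Or.inr ⟨_, _, .refl, .letter hc h h'⟩
    | cons d u =>
      simp at hw
      obtain ⟨rfl, rfl⟩ := hw
      rcases ih rfl with ih | ⟨q1, γ1, h1, h2⟩
      · exact Or.inl fun v' hv => .letter hc h (ih v' hv)
      · exact Or.inr ⟨q1, γ1, .letter hc h h1, h2⟩
  | @letterAccept q c w γ hc h =>
    cases u with
    | nil => subst hw; exact Or.inr ⟨_, _, .refl, .letterAccept hc h⟩
    | cons d u =>
      simp at hw
      obtain ⟨rfl, rfl⟩ := hw
      exact Or.inl fun v' hv => .letterAccept hc h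
  | endmarker hx hδ hS h' ih =>
    subst hw
    rcases ih rfl with ih | ⟨q1, γ1, h1, h2⟩
    · refine Or.inl fun v' hv => .endmarker ?_ hδ hS (ih v' hv)
      intro c hc
      rcases mem_append.1 hc with hc | hc
      · exact hx c (mem_append_left _ hc)
      · exact hx c (mem_append_right _ (hv hc))
    · exact Or.inr ⟨q1, γ1, .endmarker hx hδ hS h1, h2⟩
  | endmarkerAccept hx hδ =>
    subst hw
    refine Or.inl fun v' hv => .endmarkerAccept ?_ hδ
    intro c hc
    rcases mem_append.1 hc with hc | hc
    · exact hx c (mem_append_left _ hc)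
    · exact hx c (mem_append_right _ (hv hc))

theorem FrontRun.frontAcc {q q' : M.Q} {u v v' : List A} {γ γ' : List M.Γ}
    (h : M.FrontRun v q u γ q' γ') (hv : v' ⊆ v) (h' : M.FrontAcc q' v' γ') :
    M.FrontAcc q (u ++ v') γ := by
  induction h with
  | refl => exact h'
  | letter hc h _ ih => exact .letter hc h (ih h')
  | endmarker hx hδ hS _ ih =>
    refine .endmarker ?_ hδ hS (ih h')
    intro c hc
    rcases mem_append.1 hc with hc | hc
    · exact hx c (mem_append_left _ hc)
    · exact hx c (mem_append_right _ (hv hc))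

theorem FrontRun.split {q q' : M.Q} {u₁ u₂ v : List A} {γ γ' : List M.Γ}
    (h : M.FrontRun v q (u₁ ++ u₂) γ q' γ') :
    ∃ q₁ γ₁, M.FrontRun (u₂ ++ v) q u₁ γ q₁ γ₁ ∧ M.FrontRun v q₁ u₂ γ₁ q' γ' := by
  generalize hw : u₁ ++ u₂ = w at h
  induction h generalizing u₁ with
  | refl =>
    simp at hw
    obtain ⟨rfl, rfl⟩ := hw
    exact ⟨_, _, .refl, .refl⟩
  | letter hc h h' ih =>
    cases u₁ with
    | nil => subst hw; exact ⟨_, _, .refl, .letter hc h h'⟩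
    | cons d u =>
      simp at hw
      obtain ⟨rfl, rfl⟩ := hw
      obtain ⟨q₁, γ₁, h1, h2⟩ := ih rfl
      exact ⟨q₁, γ₁, .letter hc h h1, h2⟩
  | endmarker hx hδ hS h' ih =>
    subst hw
    obtain ⟨q₁, γ₁, h1, h2⟩ := ih rfl
    exact ⟨q₁, γ₁, .endmarker (by simpa using hx) hδ hS h1, h2⟩

theorem FrontRun.append {q q₁ q' : M.Q} {u₁ u₂ v : List A} {γ γ₁ γ' : List M.Γ}
    (h : M.FrontRun (u₂ ++ v) q u₁ γ q₁ γ₁) (h' : M.FrontRun v q₁ u₂ γ₁ q' γ') :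
    M.FrontRun v q (u₁ ++ u₂) γ q' γ' := by
  induction h with
  | refl => exact h'
  | letter hc h _ ih => exact .letter hc h (ih h')
  | endmarker hx hδ hS _ ih => exact .endmarker (by simpa using hx) hδ hS (ih h')

theorem Read.length_le {q q' : M.Q} {c : A} {γ γ' : List M.Γ} (h : M.Read q c γ q' γ') :
    γ'.length ≤ γ.length + 1 := by
  cases h <;> simp; omega

theorem FrontRun.length_le {q q' : M.Q} {u v : List A} {γ γ' : List M.Γ}
    (h : M.FrontRun v q u γ q' γ') : γ'.length ≤ γ.length + u.length := by
  induction h with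
  | refl => simp
  | letter hc h _ ih => have := h.length_le; simp; omega
  | endmarker _ _ _ _ ih => exact ih

/-- The effect of a letter on the pushdown store. -/
def StackStep (M : NIDPDAwtl A) (c : A) (γ γ' : List M.Γ) : Prop :=
  (M.kind c = .keep → γ' = γ) ∧ (M.kind c = .pop → γ' = γ.tail) ∧
    (M.kind c = .push → ∃ z, γ' = z :: γ)

theorem Read.stackStep {q q' : M.Q} {c : A} {γ γ' : List M.Γ} (h : M.Read q c γ q' γ') :
    M.StackStep c γ γ' := by
  cases h <;> simp_all [StackStep]

theorem FrontRun.eq_of_nil {q q' : M.Q} {v : List A} {γ γ' : List M.Γ}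
    (h : M.FrontRun v q [] γ q' γ') : γ' = γ := by
  generalize hw : [] = w at h
  induction h with
  | refl => rfl
  | letter => simp at hw
  | endmarker _ _ _ _ ih => exact ih hw

theorem FrontRun.stackStep {q q' : M.Q} {c : A} {v : List A} {γ γ' : List M.Γ}
    (h : M.FrontRun v q [c] γ q' γ') : M.StackStep c γ γ' := by
  generalize hw : [c] = w at h
  induction h with
  | refl => simp at hw
  | letter hc h h' ih =>
    simp at hw
    obtain ⟨rfl, rfl⟩ := hw
    rw [h'.eq_of_nil]
    exact h.stackStep
  | endmarker _ _ _ _ ih => exact ih hw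

/-- The intermediate configurations of a run on a power of a letter. -/
theorem FrontRun.exists_configs {q q' : M.Q} {c : A} {v : List A} {n : ℕ} {γ γ' : List M.Γ}
    (h : M.FrontRun v q (replicate n c) γ q' γ') (h' : M.FrontAcc q' v γ') :
    ∃ f : ℕ → M.Q × List M.Γ, f 0 = (q, γ) ∧
      (∀ j ≤ n, M.FrontRun (replicate (n - j) c ++ v) q (replicate j c) γ (f j).1 (f j).2) ∧
      (∀ j ≤ n, M.FrontAcc (f j).1 (replicate (n - j) c ++ v) (f j).2) ∧
      ∀ j < n, M.StackStep c (f j).2 (f (j + 1)).2 := by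
  induction n generalizing q γ with
  | zero =>
    refine ⟨fun _ => (q, γ), rfl, ?_, ?_, by simp⟩
    · intro j hj
      obtain rfl : j = 0 := by omega
      exact .refl
    · intro j _
      simpa using h.frontAcc (Subset.refl _) h'
  | succ n ih =>
    obtain ⟨q₁, γ₁, h1, h2⟩ := FrontRun.split (u₁ := [c]) (u₂ := replicate n c) h
    obtain ⟨f, h3, h4, h5, h6⟩ := ih h2
    refine ⟨fun j => Nat.casesOn j (q, γ) f, rfl, ?_, ?_, ?_⟩
    · intro j hj
      cases j with
      | zero => exact .refl
      | succ j =>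
        rw [Nat.add_sub_add_right]
        refine FrontRun.append (u₁ := [c]) (q₁ := q₁) (γ₁ := γ₁) ?_ (h4 j (by omega))
        rw [← append_assoc, replicate_append_replicate, Nat.add_sub_cancel' (by omega)]
        exact h1
    · intro j hj
      cases j with
      | zero => exact h.frontAcc (Subset.refl _) h'
      | succ j => rw [Nat.add_sub_add_right]; exact h5 j (by omega)
    · intro j hj
      cases j with
      | zero => simpa [h3] using h1.stackStep
      | succ j => exact h6 j (by omega)

/-- `M.Safe d w`: while `w` is processed from left to right, the pushdown store does not shrink by
more than `d` symbols. -/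
def Safe (M : NIDPDAwtl A) : ℕ → List A → Prop
  | _, [] => True
  | d, c :: w => match M.kind c with
    | .push => M.Safe (d + 1) w
    | .keep => M.Safe d w
    | .pop => 1 ≤ d ∧ M.Safe (d - 1) w

theorem safe_of_kind_push {c : A} (hc : M.kind c = .push) (d n : ℕ) : M.Safe d (replicate n c) := by
  induction n generalizing d with
  | zero => trivial
  | succ n ih => rw [replicate_succ, Safe, hc]; exact ih _

/-- Each letter of `w` removes at most one symbol, and the letters `c` remove none. -/
theorem safe_append {c : A} (hc : M.kind c = .push) (n : ℕ) {d : ℕ} {w : List A}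
    (hw : w.length ≤ d) : M.Safe d (w ++ replicate n c) := by
  induction w generalizing d with
  | nil => exact safe_of_kind_push hc d n
  | cons b w ih =>
    simp at hw
    rw [cons_append, Safe]
    split
    · exact ih (by omega)
    · exact ih (by omega)
    · exact ⟨by omega, ih (by omega)⟩

theorem safe_replicate_append {c : A} (hc : M.kind c = .push) {n d : ℕ} {w : List A}
    (h : M.Safe (d + n) w) : M.Safe d (replicate n c ++ w) := by
  induction n generalizing d with
  | zero => exact h
  | succ n ih =>
    rw [replicate_succ, cons_append, Safe, hc]
    exact ih (by rwa [show d + 1 + n = d + (n + 1) by ring])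

/-- At most the part `δ` above `z` is ever removed, so the top symbol is always at or above `z` and
the symbols below `z` are never inspected. -/
theorem FrontAcc.frame {q : M.Q} {w : List A} {δ ρ ρ' : List M.Γ} {z : M.Γ}
    (h : M.FrontAcc q w (δ ++ z :: ρ)) (hw : M.Safe δ.length w) :
    M.FrontAcc q w (δ ++ z :: ρ') := by
  have hd : ∀ δ : List M.Γ, (δ ++ z :: ρ).head? = (δ ++ z :: ρ').head? := by
    intro δ; cases δ <;> rfl
  generalize hγ : δ ++ z :: ρ = γ at h
  induction h generalizing δ with
  | @letter q q' c w γ γ' hc h h' ih =>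
    subst hγ
    cases h with
    | @push z' S hk hδ hS =>
      rw [Safe, hk] at hw
      exact .letter hc (.push hk (hd δ ▸ hδ) hS) (ih (δ := z' :: δ) hw rfl)
    | keep hk hδ hS =>
      rw [Safe, hk] at hw
      exact .letter hc (.keep hk (hd δ ▸ hδ) hS) (ih hw rfl)
    | pop hk hδ hS =>
      rw [Safe, hk] at hw
      cases δ with
      | nil => simp at hw
      | cons y δ =>
        exact .letter hc (.pop hk (hd (y :: δ) ▸ hδ) hS) (ih (δ := δ) (by simpa using hw.2) rfl)
  | letterAccept hc h =>
    subst hγ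
    refine .letterAccept hc ?_
    rw [readAccept_iff] at h ⊢
    rwa [← hd δ]
  | endmarker hx hδ hS h' ih =>
    subst hγ
    exact .endmarker hx (hd δ ▸ hδ) hS (ih hw rfl)
  | endmarkerAccept hx hδ =>
    subst hγ
    exact .endmarkerAccept hx (hd δ ▸ hδ)

end NIDPDAwtl

/-! ### Pumping down the last `a`-block before the final `$` -/

namespace NslAutomaton

open NIDPDAwtl NslLetter List

theorem count_cent_nslWord (k : ℕ) : (nslWord k).countP isCent = k := by
  cases k with
  | zero => rfl
  | succ k =>
    have : countP isCent (blocks 1 1 [dollar] (goodBlocks k)) = 0 := by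
      induction goodBlocks k with
      | nil => rfl
      | cons x L ih => simp [ih, countP_replicate, isCent]
    rw [nslWord_succ]
    simp [this, countP_replicate, isCent]

/-- Used twice: to identify the word listed in processing order with the input, and to rule out a
pumped word with an unchanged number of `¢`. -/
theorem eq_of_countP_eq {v w : List NslLetter} (hv : v ∈ Lnsl) (hw : w ∈ Lnsl)
    (h : v.countP isCent = w.countP isCent) : v = w := by
  obtain ⟨k, rfl⟩ := hv
  obtain ⟨l, rfl⟩ := hw
  rw [count_cent_nslWord, count_cent_nslWord] at h
  rw [h]

/-- The prefix `a$#a³$#²⋯a^(2k-1)$#^k`. -/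
def nslPrefix (k : ℕ) : List NslLetter :=
  (range k).flatMap fun i => replicate (2 * i + 1) a ++ dollar :: replicate (i + 1) .hash

theorem nslPrefix_succ (k : ℕ) : nslPrefix (k + 1) =
    nslPrefix k ++ (replicate (2 * k + 1) a ++ dollar :: replicate (k + 1) .hash) := by
  simp [nslPrefix, range_succ]

theorem nslWord_succ' (k : ℕ) : nslWord (k + 1) = nslPrefix k ++ (replicate (2 * k + 1) a ++
    (dollar :: replicate (k + 1) cent ++ replicate (2 * k + 3) a)) := by
  simp [nslWord, nslPrefix]

/-- By induction the height is at most `k + 1` before the block `a^(2k+1)`, which therefore empties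
the store; the following `$#^(k+1)` adds at most `k + 2` symbols. -/
theorem length_le_of_frontRun {M : NIDPDAwtl NslLetter} (ha : M.kind a = .pop) {k : ℕ}
    {v : List NslLetter} {q q' : M.Q} {γ : List M.Γ} (h : M.FrontRun v q (nslPrefix k) [] q' γ) :
    γ.length ≤ k + 1 := by
  induction k generalizing v q' γ with
  | zero =>
    have := h.length_le
    simp [nslPrefix] at this
    simp [this]
  | succ k ih =>
    rw [nslPrefix_succ] at h
    obtain ⟨q1, γ1, h1, h2⟩ := h.split
    obtain ⟨q2, γ2, h3, h4⟩ := h2.split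
    have h5 := ih h1
    have h6 := h4.length_le
    have key : ∀ n v q γ q' γ', M.FrontRun v q (replicate n a) γ q' γ' →
        γ'.length ≤ γ.length - n := by
      intro n
      induction n with
      | zero => intro v q γ q' γ' h; simpa using h.length_le
      | succ n ih =>
        intro v q γ q' γ' h
        obtain ⟨q1, γ1, h1, h2⟩ := FrontRun.split (u₁ := [a]) (u₂ := replicate n a) h
        have h3 := h1.stackStep.2.1 ha
        have h4 := ih _ _ _ _ _ h2
        rw [h3] at h4
        simp at h4
        omega
    have h7 := key _ _ _ _ _ _ h3
    simp at h6
    omega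

/-- Pigeonhole principle for the elements `g s, …, g (s + n)`. -/
theorem exists_lt_map_eq {α : Type} [Finite α] (g : ℕ → α) (s : ℕ) {n : ℕ} (hn : Nat.card α ≤ n) :
    ∃ i j, s ≤ i ∧ i < j ∧ j ≤ s + n ∧ g i = g j := by
  have := Fintype.ofFinite α
  obtain ⟨i, j, hij, h⟩ := Fintype.exists_ne_map_eq_of_card_lt
    (fun i : Fin (n + 1) => g (s + i)) (by
      rw [Fintype.card_fin, ← Nat.card_eq_fintype_card]; omega)
  rcases lt_or_gt_of_ne hij with hij | hij
  · exact ⟨s + i, s + j, by omega, by simpa using hij, by omega, h⟩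
  · exact ⟨s + j, s + i, by omega, by simpa using hij, by omega, h.symm⟩

theorem lnsl_not_mem : Lnsl ∉ familyNIDPDAwtl NslLetter := by
  rintro ⟨M, hM⟩
  have := M.finite_states
  have := M.finite_stack
  obtain ⟨k, hk1, hk2⟩ : ∃ k, Nat.card M.Q ≤ k ∧ Nat.card (M.Q × Option M.Γ) + 2 ≤ k :=
    ⟨_, le_max_left _ _, le_max_right _ _⟩
  have hacc : M.FrontAcc M.q₀ (nslWord (k + 1)) [] := by
    have : nslWord (k + 1) ∈ M.language := hM ▸ ⟨_, rfl⟩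
    obtain ⟨w', hp, h⟩ := exists_perm_frontAcc this _ _ _ rfl
    have hw' : w' ∈ M.language := h.acc
    rw [hM] at hw' this
    -- A permutation preserves the number of `¢`, so the permuted word equals the input.
    rwa [← eq_of_countP_eq hw' this (hp.countP_eq _)]
  rw [nslWord_succ'] at hacc
  set v := dollar :: replicate (k + 1) cent ++ replicate (2 * k + 3) a with hv
  have hcount : countP isCent v = k + 1 := by
    simp [hv, countP_replicate, isCent]
  have hne : ∀ m v', M.FrontAcc M.q₀ (nslPrefix k ++ (replicate m a ++ v')) [] →
      countP isCent v' = k + 1 → m + v'.length = (2 * k + 1) + v.length := by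
    intro m v' h hc
    have h1 : _ ∈ M.language := h.acc
    have h2 := hacc.acc
    change _ ∈ M.language at h2
    rw [hM] at h1 h2
    have := congrArg length (eq_of_countP_eq h1 h2 ?_)
    · simpa using this
    · simp [countP_replicate, isCent, hc, hcount]
  rw [← append_assoc] at hacc
  rcases hacc.split with h | ⟨q', γ', hrun, hacc'⟩
  -- Early acceptance would not notice a missing `a` in the tail.
  · have := h (dollar :: replicate (k + 1) cent ++ replicate (2 * k + 2) a) ?_
    · rw [append_assoc] at this
      have := hne _ _ this (by simp [countP_replicate, isCent])
      simp [hv] at this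
    · intro c hc
      simp [hv] at hc ⊢
      exact hc
  obtain ⟨q₁, γ₁, hrun1, hrun2⟩ := hrun.split
  obtain ⟨f, hf0, hf1, hf2, hf3⟩ := hrun2.exists_configs hacc'
  -- Continuing after `i` letters as if `j` had been read would accept the word without `j - i` of
  -- the letters `a`.
  have hpump : ∀ i j, i < j → j ≤ 2 * k + 1 →
      ¬ M.FrontAcc (f i).1 (replicate (2 * k + 1 - j) a ++ v) (f i).2 := by
    intro i j hij hj h
    have hsub : replicate (2 * k + 1 - j) a ++ v ⊆ replicate (2 * k + 1 - i) a ++ v := by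
      intro c hc
      simp only [mem_append, mem_replicate] at hc ⊢
      rcases hc with hc | hc
      · exact Or.inl ⟨by omega, hc.2⟩
      · exact Or.inr hc
    have h1 := (hf1 i (by omega)).frontAcc hsub h
    have h2 := hrun1.frontAcc (v' := replicate i a ++ (replicate (2 * k + 1 - j) a ++ v)) ?_ h1
    · rw [← append_assoc (replicate i a), replicate_append_replicate] at h2
      have := hne _ _ h2 hcount
      omega
    · intro c hc
      simp only [mem_append, mem_replicate] at hc ⊢
      rcases hc with hc | hc | hc
      · exact Or.inl ⟨by omega, hc.2⟩
      · exact Or.inl ⟨by omega, hc.2⟩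
      · exact Or.inr hc
  have hsame : ∀ i j, i < j → j ≤ 2 * k + 1 → f i ≠ f j := by
    intro i j hij hj h
    exact hpump i j hij hj (h ▸ hf2 j hj)
  rcases ha : M.kind a with _ | _ | _
  -- Starting at index `1` ensures that a pushed symbol is on top. Stopping at `k - 1` leaves at
  -- least `k + 2` letters `a`, enough pushes to cover all pops of `$¢^(k+1)`.
  · obtain ⟨i, j, hi, hij, hj, h⟩ := exists_lt_map_eq (fun i => ((f i).1, (f i).2.head?)) 1
      (n := k - 2) (by omega)
    obtain ⟨zi, hzi⟩ := (hf3 (i - 1) (by omega)).2.2 ha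
    obtain ⟨zj, hzj⟩ := (hf3 (j - 1) (by omega)).2.2 ha
    rw [Nat.sub_add_cancel (by omega)] at hzi hzj
    simp only [hzi, hzj, head?_cons, Prod.mk.injEq, Option.some.injEq] at h
    obtain ⟨h1, rfl⟩ := h
    refine hpump i j hij (by omega) ?_
    have := hf2 j (by omega)
    rw [hzj, ← h1] at this
    rw [hzi]
    refine FrontAcc.frame (δ := []) this (safe_replicate_append ha ?_)
    refine safe_append ha _ ?_
    simp
    omega
  · have hlen := length_le_of_frontRun ha hrun1
    have hnil : ∀ j ≤ 2 * k + 1, (f j).2.length ≤ k + 1 - j := by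
      intro j
      induction j with
      | zero => intro _; simpa [hf0] using hlen
      | succ j ih =>
        intro hj
        have := ih (by omega)
        rw [(hf3 j (by omega)).2.1 ha]
        simp
        omega
    -- After `k + 1` letters the store is empty, so equal states are equal configurations.
    obtain ⟨i, j, hi, hij, hj, h⟩ := exists_lt_map_eq (fun i => (f i).1) (k + 1) (n := k) hk1
    refine hsame i j hij (by omega) (Prod.ext h ?_)
    have h1 := hnil i (by omega)
    have h2 := hnil j (by omega)
    rw [length_eq_zero_iff.1 (by omega : (f i).2.length = 0),
      length_eq_zero_iff.1 (by omega : (f j).2.length = 0)]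
  · have hst : ∀ j ≤ 2 * k + 1, (f j).2 = γ₁ := by
      intro j
      induction j with
      | zero => intro _; rw [hf0]
      | succ j ih => intro hj; rw [(hf3 j (by omega)).1 ha]; exact ih (by omega)
    obtain ⟨i, j, hi, hij, hj, h⟩ := exists_lt_map_eq (fun i => (f i).1) 0 (n := k) hk1
    exact hsame i j hij (by omega) (Prod.ext h (by rw [hst i (by omega), hst j (by omega)]))

end NslAutomaton

end

section

/-! ### Deterministic pushdown systems with costs -/

/-- The result of a deterministic step: the computation halts (accepting iff `p`), or it goes on. -/
inductive Outcome (α : Type) where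
  | halt (p : Prop)
  | go (x : α)

/-- A power of a word. -/
def wordPow {Z : Type} (τ : List Z) (n : ℕ) : List Z := (List.replicate n τ).flatten

theorem wordPow_succ {Z : Type} (τ : List Z) (n : ℕ) : wordPow τ (n + 1) = τ ++ wordPow τ n := by
  simp [wordPow, List.replicate_succ]

theorem wordPow_add {Z : Type} (τ : List Z) (m n : ℕ) :
    wordPow τ (m + n) = wordPow τ m ++ wordPow τ n := by
  simp [wordPow, ← List.replicate_append_replicate]

@[simp] theorem wordPow_zero {Z : Type} (τ : List Z) : wordPow τ 0 = [] := rfl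

@[simp] theorem wordPow_one {Z : Type} (τ : List Z) : wordPow τ 1 = τ := by simp [wordPow]

@[simp] theorem length_wordPow {Z : Type} (τ : List Z) (n : ℕ) :
    (wordPow τ n).length = n * τ.length := by
  simp [wordPow]

namespace PushdownSystem

variable {C Z V : Type} [AddCommMonoid V]

/-- `Reach rule S n c σ v c' σ'`: the pushdown system given by `rule` gets from control state `c` and
pushdown content `σ` to `c'` and `σ'` in `n` steps and at cost `v`, all steps starting in control
states from `S`. -/
inductive Reach (rule : C → Z → Outcome (C × List Z × V)) (S : Set C) :
    ℕ → C → List Z → V → C → List Z → Prop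
  | refl {c : C} {σ : List Z} : Reach rule S 0 c σ 0 c σ
  | step {n : ℕ} {c c' c'' : C} {z : Z} {l ρ σ : List Z} {v w : V} (hc : c ∈ S)
      (h : rule c z = .go (c', l, v)) (h' : Reach rule S n c' (l ++ ρ) w c'' σ) :
      Reach rule S (n + 1) c (z :: ρ) (v + w) c'' σ

variable {rule : C → Z → Outcome (C × List Z × V)} {S : Set C}

theorem Reach.trans {n m : ℕ} {c c' c'' : C} {σ σ' σ'' : List Z} {v w : V}
    (h : Reach rule S n c σ v c' σ') (h' : Reach rule S m c' σ' w c'' σ'') :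
    Reach rule S (n + m) c σ (v + w) c'' σ'' := by
  induction h with
  | refl => simpa using h'
  | step hc h _ ih =>
    have h2 := Reach.step (rule := rule) hc h (ih h')
    rwa [← add_assoc, Nat.add_right_comm] at h2

theorem Reach.frame {n : ℕ} {c c' : C} {σ σ' : List Z} {v : V}
    (h : Reach rule S n c σ v c' σ') (ρ : List Z) :
    Reach rule S n c (σ ++ ρ) v c' (σ' ++ ρ) := by
  induction h with
  | refl => exact .refl
  | step hc h _ ih => exact .step hc h (by simpa using ih)

theorem Reach.mem_or_eq {n : ℕ} {c c' : C} {σ σ' : List Z} {v : V}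
    (h : Reach rule S n c σ v c' σ') : c ∈ S ∨ c = c' := by
  cases h with
  | refl => exact Or.inr rfl
  | step hc => exact Or.inl hc

theorem Reach.single {c c' : C} {z : Z} {l ρ : List Z} {v : V} (hc : c ∈ S)
    (h : rule c z = .go (c', l, v)) : Reach rule S 1 c (z :: ρ) v c' (l ++ ρ) := by
  simpa using Reach.step (rule := rule) (ρ := ρ) hc h .refl

theorem Reach.loop {n : ℕ} {c : C} {z : Z} {τ : List Z} {v : V}
    (h : Reach rule S n c [z] v c (z :: τ)) (t : ℕ) :
    Reach rule S (t * n) c [z] (t • v) c (z :: wordPow τ t) := by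
  induction t with
  | zero => simpa using Reach.refl
  | succ t ih =>
    rw [Nat.succ_mul, succ_nsmul, wordPow_succ]
    exact ih.trans (h.frame (wordPow τ t))

/-- By determinism two runs from the same configuration are comparable. The one ending with an empty
store cannot be continued, so it extends the other. -/
theorem Reach.of_empty {n m : ℕ} {c c' c'' : C} {σ σ' : List Z} {v w : V}
    (h : Reach rule S n c σ v c' σ') (h' : Reach rule S m c σ w c'' []) :
    ∃ k u, Reach rule S k c' σ' u c'' [] ∧ w = v + u := by
  induction h generalizing m w with
  | refl => exact ⟨m, w, h', by simp⟩
  | step hc h _ ih =>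
    cases h' with
    | step hc' h1 h2 =>
      rw [h] at h1
      cases h1
      obtain ⟨k, u, h3, rfl⟩ := ih h2
      exact ⟨k, u, h3, by rw [add_assoc]⟩

theorem exists_low (f : ℕ → ℕ) (K : ℕ) : ∃ k, K < k ∧ ∀ j, k ≤ j → f k ≤ f j := by
  obtain ⟨k, hk, h⟩ := Nat.sInf_mem (s := f '' Set.Ioi K) ⟨_, K + 1, by simp, rfl⟩
  refine ⟨k, hk, fun j hj => ?_⟩
  rw [h]
  exact Nat.sInf_le ⟨j, lt_of_lt_of_le hk hj, rfl⟩

/-- A computation halts, or leaves `S`, or empties the pushdown store, or runs into a loop. -/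
theorem halt_or_exit_or_empty_or_loop [Finite Z] (hS : S.Finite) (c : C) (σ : List Z) :
    (∃ n v c' z ρ p, Reach rule S n c σ v c' (z :: ρ) ∧ rule c' z = .halt p) ∨
    (∃ n v c' σ', Reach rule S n c σ v c' σ' ∧ c' ∉ S) ∨
    (∃ n v c', Reach rule S n c σ v c' []) ∨
    ∃ n v c' z ρ m w τ, Reach rule S n c σ v c' (z :: ρ) ∧ c' ∈ S ∧ 0 < m ∧
      Reach rule S m c' [z] w c' (z :: τ) := by
  by_contra! ⟨h1, h2, h3, h4⟩
  let next : C × List Z × V → C × List Z × V := fun x => match x with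
    | (c, [], v) => (c, [], v)
    | (c, z :: ρ, v) => match rule c z with
      | .halt _ => (c, z :: ρ, v)
      | .go (c', l, w) => (c', l ++ ρ, v + w)
  let traj : ℕ → C × List Z × V := fun k => next^[k] (c, σ, 0)
  have hsucc : ∀ k, traj (k + 1) = next (traj k) := fun k => Function.iterate_succ_apply' _ _ _
  have hgo : ∀ n v c' z ρ, Reach rule S n c σ v c' (z :: ρ) → ∃ c'' l w,
      rule c' z = .go (c'', l, w) := by
    intro n v c' z ρ h
    rcases hr : rule c' z with p | ⟨c'', l, w⟩
    · exact absurd hr (h1 n v c' z ρ p h)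
    · exact ⟨c'', l, w, rfl⟩
  have hreach : ∀ k, Reach rule S k c σ (traj k).2.2 (traj k).1 (traj k).2.1 := by
    intro k
    induction k with
    | zero => exact .refl
    | succ k ih =>
      rw [hsucc]
      generalize traj k = x at ih
      obtain ⟨c', σ', v⟩ := x
      cases σ' with
      | nil => exact absurd ih (h3 _ _ _)
      | cons z ρ =>
        obtain ⟨c'', l, w, hr⟩ := hgo _ _ _ _ _ ih
        simp only [next, hr]
        exact ih.trans (.single (h2 _ _ _ _ ih) hr)
  have hmem : ∀ k, (traj k).1 ∈ S := fun k => h2 _ _ _ _ (hreach k)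
  -- At such a time everything below the top symbol stays untouched forever. Two low times with
  -- equal control state and top symbol therefore give a loop that needs only the top symbol.
  let low : Set ℕ := {k | ∀ j, k ≤ j → (traj k).2.1.length ≤ (traj j).2.1.length}
  have hlow : low.Infinite := Set.infinite_of_forall_exists_gt fun K => by
    obtain ⟨k, hk, h⟩ := exists_low (fun k => (traj k).2.1.length) K
    exact ⟨k, h, hk⟩
  obtain ⟨k, hk, k', hk', hne, heq⟩ := hlow.exists_ne_map_eq_of_mapsTo
    (f := fun k => ((traj k).1, (traj k).2.1.head?)) (t := S ×ˢ Set.univ)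
    (fun k _ => ⟨hmem k, trivial⟩) (hS.prod Set.finite_univ)
  wlog hlt : k < k' generalizing k k'
  · exact this k' hk' k hk hne.symm heq.symm (by omega)
  obtain ⟨j, rfl⟩ := Nat.exists_eq_add_of_lt hlt
  simp only [Prod.mk.injEq] at heq
  obtain ⟨hc, hz⟩ := heq
  have hst : ∃ z ρ, (traj k).2.1 = z :: ρ := by
    cases h : (traj k).2.1 with
    | nil => exact absurd (h ▸ hreach k) (h3 _ _ _)
    | cons z ρ => exact ⟨z, ρ, rfl⟩
  obtain ⟨z, ρ, hzρ⟩ := hst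
  have key : ∀ j, ∃ w β, Reach rule S j (traj k).1 [z] w (traj (k + j)).1 β ∧
      (traj (k + j)).2.1 = β ++ ρ := by
    intro j
    induction j with
    | zero => exact ⟨0, [z], .refl, hzρ⟩
    | succ j ih =>
      obtain ⟨w, β, h5, h6⟩ := ih
      have h7 := hk (k + j) (by omega)
      rw [hzρ, h6] at h7
      cases β with
      | nil => simp at h7
      | cons y β =>
        have h8 := hreach (k + j)
        rw [h6] at h8
        obtain ⟨c'', l, w', hr⟩ := hgo _ _ _ _ _ h8
        have h9 : next (traj (k + j)) = (c'', l ++ (β ++ ρ), (traj (k + j)).2.2 + w') := by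
          generalize traj (k + j) = x at h6 hr
          obtain ⟨x1, x2, x3⟩ := x
          simp only at h6 hr
          subst h6
          simp [next, hr]
        rw [← add_assoc, hsucc, h9]
        exact ⟨w + w', l ++ β, h5.trans (.single (hmem _) hr), by simp⟩
  obtain ⟨w, β, h5, h6⟩ := key (j + 1)
  rw [← add_assoc] at h5 h6
  have h7 := hk (k + j + 1) (by omega)
  rw [hzρ, h6] at h7
  cases β with
  | nil => simp at h7
  | cons y τ =>
    rw [hzρ, h6] at hz
    simp at hz
    subst hz
    rw [← hc] at h5
    exact h4 k _ (traj k).1 z ρ (j + 1) w τ (hzρ ▸ hreach k) (hmem k) (by omega) h5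

/-- The analogue of `halt_or_exit_or_empty_or_loop` for an infinite periodic pushdown store. -/
theorem halt_or_exit_or_loop_or_descend [Finite Z] (hS : S.Finite) (c : C) (σ τ : List Z) :
    (∃ i n v c' z ρ p, Reach rule S n c (σ ++ wordPow τ i) v c' (z :: ρ) ∧ rule c' z = .halt p) ∨
    (∃ i n v c' σ', Reach rule S n c (σ ++ wordPow τ i) v c' σ' ∧ c' ∉ S) ∨
    (∃ i n v c' z ρ m w τ', Reach rule S n c (σ ++ wordPow τ i) v c' (z :: ρ) ∧ c' ∈ S ∧ 0 < m ∧
      Reach rule S m c' [z] w c' (z :: τ')) ∨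
    ∃ i j n v c' m w, Reach rule S n c (σ ++ wordPow τ i) v c' [] ∧ c' ∈ S ∧ 0 < j ∧
      Reach rule S m c' (wordPow τ j) w c' [] := by
  by_contra! ⟨h1, h2, h3, h4⟩
  have h5 : ∀ i, ∃ n v c', Reach rule S n c (σ ++ wordPow τ i) v c' [] := by
    intro i
    rcases halt_or_exit_or_empty_or_loop (rule := rule) hS c (σ ++ wordPow τ i) with
      ⟨n, v, c', z, ρ, p, h, h'⟩ | ⟨n, v, c', σ', h, h'⟩ | h |
      ⟨n, v, c', z, ρ, m, w, τ', h, h', hm, h''⟩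
    · exact absurd h' (h1 _ _ _ _ _ _ _ h)
    · exact absurd (h2 _ _ _ _ _ h) h'
    · exact h
    · exact absurd h'' (h3 _ _ _ _ _ _ _ _ _ h h' hm)
  choose n v s hs using h5
  have hmem : ∀ i, s i ∈ S := fun i => h2 _ _ _ _ _ (hs i)
  -- In the remaining case every finite store is emptied; two numbers of periods lead to the same
  -- control state, and the run on the larger store passes through the end of the run on the smaller
  -- one.
  obtain ⟨i, -, i', -, hne, heq⟩ := Set.infinite_univ.exists_ne_map_eq_of_mapsTo
    (f := s) (t := S) (fun i _ => hmem i) hS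
  wlog hlt : i < i' generalizing i i'
  · exact this i' i hne.symm heq.symm (by omega)
  obtain ⟨j, rfl⟩ := Nat.exists_eq_add_of_lt hlt
  have h6 := (hs i).frame (wordPow τ (j + 1))
  rw [List.append_assoc, ← wordPow_add, ← add_assoc] at h6
  obtain ⟨k, u, h7, -⟩ := h6.of_empty (hs (i + j + 1))
  rw [← heq] at h7
  exact h4 i (j + 1) _ _ _ _ _ (hs i) (hmem i) (by omega) h7

end PushdownSystem

end

/-! ### Deterministic automata as pushdown systems -/

section

open List

/-- The truth value of an outcome, given the truth values of its continuations. -/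
def Outcome.Holds {α : Type} (o : Outcome α) (f : α → Prop) : Prop :=
  match o with
  | .halt p => p
  | .go x => f x

def Outcome.map {α β : Type} (f : α → β) : Outcome α → Outcome β
  | .halt p => .halt p
  | .go x => .go (f x)

@[simp] theorem Outcome.map_eq_go {α β : Type} {f : α → β} {o : Outcome α} {y : β} :
    o.map f = .go y ↔ ∃ x, o = .go x ∧ f x = y := by
  cases o <;> simp [Outcome.map]

@[simp] theorem Outcome.map_eq_halt {α β : Type} {f : α → β} {o : Outcome α} {p : Prop} :
    o.map f = .halt p ↔ o = .halt p := by
  cases o <;> simp [Outcome.map]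

@[simp] theorem Outcome.holds_map {α β : Type} {f : α → β} {o : Outcome α} {g : β → Prop} :
    (o.map f).Holds g ↔ o.Holds (g ∘ f) := by
  cases o <;> simp [Outcome.map, Outcome.Holds]

open Classical in
/-- The outcome of a deterministic choice. -/
noncomputable def TransValue.outcome {α : Type} : TransValue α → Outcome α
  | .undefined => .halt False
  | .accept => .halt True
  | .goto S => if h : S.Nonempty then .go h.some else .halt False

/-- With at most one continuation, the arbitrary choice made in `outcome` loses no computation. -/
theorem TransValue.AtMostOne.holds_iff {α : Type} {v : TransValue α} (hv : v.AtMostOne)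
    {f : α → Prop} :
    v.outcome.Holds f ↔ v = .accept ∨ ∃ S, v = .goto S ∧ ∃ x ∈ S, f x := by
  cases v with
  | undefined => simp [TransValue.outcome, Outcome.Holds]
  | accept => simp [TransValue.outcome, Outcome.Holds]
  | goto S =>
    by_cases h : S.Nonempty
    · simp only [TransValue.outcome, h, dite_true, Outcome.Holds]
      constructor
      · intro h'
        exact Or.inr ⟨S, rfl, _, h.some_mem, h'⟩
      · rintro (h' | ⟨S', h', x, hx, hf⟩)
        · cases h'
        · cases h'
          rwa [hv S rfl h.some_mem hx]
    · simp only [TransValue.outcome, h, dite_false, Outcome.Holds, false_iff]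
      rintro (h' | ⟨S', h', x, hx, hf⟩)
      · cases h'
      · cases h'
        exact h ⟨x, hx⟩

namespace PushdownSystem

variable {C Z V : Type}

/-- Acceptance within a given number of steps. -/
def AcceptsWithin (rule : C → Z → Outcome (C × List Z × V)) : ℕ → C → List Z → Prop
  | 0, _, _ => False
  | _ + 1, _, [] => False
  | k + 1, c, t :: ρ => (rule c t).Holds fun x => AcceptsWithin rule k x.1 (x.2.1 ++ ρ)

variable {rule : C → Z → Outcome (C × List Z × V)}

theorem AcceptsWithin.succ {k : ℕ} {c : C} {σ : List Z} (h : AcceptsWithin rule k c σ) :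
    AcceptsWithin rule (k + 1) c σ := by
  induction k generalizing c σ with
  | zero => exact h.elim
  | succ k ih =>
    cases σ with
    | nil => exact h.elim
    | cons t ρ =>
      rw [AcceptsWithin] at h ⊢
      cases hr : rule c t with
      | halt p => simpa [hr, Outcome.Holds] using h
      | go x =>
        simp only [hr, Outcome.Holds] at h ⊢
        exact ih h

theorem AcceptsWithin.mono {k k' : ℕ} {c : C} {σ : List Z} (h : AcceptsWithin rule k c σ)
    (hk : k ≤ k') : AcceptsWithin rule k' c σ := by
  induction hk with
  | refl => exact h
  | step _ ih => exact ih.succ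

theorem acceptsWithin_go {k : ℕ} {c c' : C} {t : Z} {l ρ : List Z} {v : V}
    (h : rule c t = .go (c', l, v)) :
    AcceptsWithin rule (k + 1) c (t :: ρ) ↔ AcceptsWithin rule k c' (l ++ ρ) := by
  simp [AcceptsWithin, h, Outcome.Holds]

/-- Acceptance. -/
def Accepts (rule : C → Z → Outcome (C × List Z × V)) (c : C) (σ : List Z) : Prop :=
  ∃ k, AcceptsWithin rule k c σ

theorem accepts_iff {c : C} {t : Z} {ρ : List Z} :
    Accepts rule c (t :: ρ) ↔ (rule c t).Holds fun x => Accepts rule x.1 (x.2.1 ++ ρ) := by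
  cases hr : rule c t with
  | halt p =>
    simp only [Outcome.Holds]
    constructor
    · rintro ⟨k, h⟩
      cases k with
      | zero => exact h.elim
      | succ k => simpa [AcceptsWithin, hr, Outcome.Holds] using h
    · intro h
      exact ⟨1, by simpa [AcceptsWithin, hr, Outcome.Holds] using h⟩
  | go x =>
    simp only [Outcome.Holds]
    constructor
    · rintro ⟨k, h⟩
      cases k with
      | zero => exact h.elim
      | succ k => exact ⟨k, by simpa [AcceptsWithin, hr, Outcome.Holds] using h⟩
    · rintro ⟨k, h⟩
      exact ⟨k + 1, by simpa [AcceptsWithin, hr, Outcome.Holds] using h⟩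

end PushdownSystem

namespace NIDPDAwtl

variable {A ι : Type}

/-- The effect of reading a letter on the state and on the topmost pushdown symbol. -/
noncomputable def letterOutcome (M : NIDPDAwtl A) (q : M.Q) (c : A) (t : Option M.Γ) :
    Outcome (M.Q × List (Option M.Γ)) :=
  match M.kind c with
  | .push => (M.δD q c t).outcome.map fun p => (p.1, [some p.2, t])
  | .pop => (M.δR q c t).outcome.map fun p => (p, match t with | none => [none] | some _ => [])
  | .keep => (M.δN q (some c) t).outcome.map fun p => (p, [t])

/-- A word in which some blocks of equal letters are abbreviated. The block `i` consists of `n i + 1`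
letters `lett i`, where `n` and `lett` are given separately. -/
abbrev Shape (A ι : Type) := List (A ⊕ ι)

abbrev Control (M : NIDPDAwtl A) (ι : Type) := Shape A ι × M.Q × Shape A ι

/-- The items on both sides of the head. -/
def Control.items {M : NIDPDAwtl A} (c : M.Control ι) : Shape A ι := c.1 ++ c.2.2

/-- The remaining input after reading the first letter of an item. -/
def afterRead (x : A ⊕ ι) (w : Shape A ι) : Shape A ι :=
  match x with
  | .inl _ => w
  | .inr i => .inr i :: w

/-- The cost of reading the first letter of an item. -/
def readCost [DecidableEq ι] (x : A ⊕ ι) : ι → ℕ :=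
  match x with
  | .inl _ => 0
  | .inr i => Pi.single i 1

open Classical in
/-- The pushdown system that simulates a deterministic automaton on abbreviated words. -/
noncomputable def shapeRule [DecidableEq ι] (M : NIDPDAwtl A) (lett : ι → A) :
    M.Control ι → Option M.Γ → Outcome (M.Control ι × List (Option M.Γ) × (ι → ℕ))
  | (u, q, []), t => (M.δN q none t).outcome.map fun q' => (([], q', u), [t], 0)
  | (u, q, x :: w), t =>
    if Sum.elim id lett x ∈ M.τ q then .go ((u ++ [x], q, w), [t], 0)
    else (M.letterOutcome q (Sum.elim id lett x) t).map fun p =>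
      ((u, p.1, afterRead x w), p.2, readCost x)

/-- The pushdown content with `⊥` written explicitly. -/
def marked {Γ : Type} (γ : List Γ) : List (Option Γ) := γ.map some ++ [none]

theorem marked_eq {Γ : Type} (γ : List Γ) : marked γ = γ.head? :: (marked γ).tail := by
  cases γ <;> simp [marked]

theorem Deterministic.letterOutcome_holds {M : NIDPDAwtl A} (hM : M.Deterministic) {q : M.Q} {c : A}
    {γ : List M.Γ} {f : M.Q → List (Option M.Γ) → Prop} :
    ((M.letterOutcome q c γ.head?).Holds fun p => f p.1 (p.2 ++ (marked γ).tail)) ↔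
      M.ReadAccept q c γ ∨ ∃ q' γ', M.Read q c γ q' γ' ∧ f q' (marked γ') := by
  obtain ⟨h1, h2, h3, -⟩ := hM
  simp only [read_iff, readAccept_iff]
  unfold letterOutcome
  cases hk : M.kind c with
  | push =>
    simp only [Outcome.holds_map, (h1 q c _ hk).holds_iff, reduceCtorEq, false_and, or_false,
      true_and]
    refine or_congr Iff.rfl ⟨?_, ?_⟩
    · rintro ⟨S, h, ⟨q', z⟩, hS, hf⟩
      refine ⟨q', _, ⟨S, z, h, hS, rfl⟩, ?_⟩
      have := marked_eq γ
      simp only [Function.comp, cons_append, nil_append] at hf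
      rw [← this] at hf
      exact hf
    · rintro ⟨q', _, ⟨S, z, h, hS, rfl⟩, hf⟩
      refine ⟨S, h, (q', z), hS, ?_⟩
      simp only [Function.comp, cons_append, nil_append]
      rw [← marked_eq γ]
      exact hf
  | pop =>
    simp only [Outcome.holds_map, (h2 q c _ hk).holds_iff, reduceCtorEq, false_and, or_false,
      true_and, false_or]
    have key : (match γ.head? with | none => [none] | some _ => []) ++ (marked γ).tail =
        marked γ.tail := by
      cases γ <;> simp [marked]
    refine or_congr Iff.rfl ⟨?_, ?_⟩
    · rintro ⟨S, h, q', hS, hf⟩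
      refine ⟨q', _, ⟨S, h, hS, rfl⟩, ?_⟩
      rw [← key]
      exact hf
    · rintro ⟨q', _, ⟨S, h, hS, rfl⟩, hf⟩
      refine ⟨S, h, q', hS, ?_⟩
      rw [← key] at hf
      exact hf
  | keep =>
    simp only [Outcome.holds_map, (h3 q c _ hk).holds_iff, reduceCtorEq, false_and,
      true_and, false_or]
    refine or_congr Iff.rfl ⟨?_, ?_⟩
    · rintro ⟨S, h, q', hS, hf⟩
      refine ⟨q', _, ⟨S, h, hS, rfl⟩, ?_⟩
      rw [marked_eq γ]
      exact hf
    · rintro ⟨q', _, ⟨S, h, hS, rfl⟩, hf⟩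
      refine ⟨S, h, q', hS, ?_⟩
      rw [marked_eq] at hf
      exact hf

/-- A control state without abbreviations. -/
def plain (M : NIDPDAwtl A) (ι : Type) (u : List A) (q : M.Q) (w : List A) : M.Control ι :=
  (u.map .inl, q, w.map .inl)

theorem Deterministic.shapeRule_nil_holds {M : NIDPDAwtl A} [DecidableEq ι] (hM : M.Deterministic)
    {lett : ι → A} {u : List A} {q : M.Q} {γ : List M.Γ}
    {f : M.Control ι → List (Option M.Γ) → Prop} :
    ((M.shapeRule lett (M.plain ι u q []) γ.head?).Holds fun x =>
        f x.1 (x.2.1 ++ (marked γ).tail)) ↔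
      M.δN q none γ.head? = TransValue.accept ∨
      ∃ S, M.δN q none γ.head? = TransValue.goto S ∧ ∃ q' ∈ S, f (M.plain ι [] q' u) (marked γ) := by
  simp only [plain, map_nil, shapeRule, Outcome.holds_map, (hM.2.2.2 q _).holds_iff]
  simp only [Function.comp, cons_append, nil_append, ← marked_eq γ]

theorem shapeRule_skip {M : NIDPDAwtl A} [DecidableEq ι]
    {lett : ι → A} {u w : List A} {q : M.Q} {c : A} {t : Option M.Γ} (hc : c ∈ M.τ q) :
    M.shapeRule lett (M.plain ι u q (c :: w)) t = .go (M.plain ι (u ++ [c]) q w, [t], 0) := by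
  simp [plain, shapeRule, hc]

theorem Deterministic.shapeRule_read_holds {M : NIDPDAwtl A} [DecidableEq ι] (hM : M.Deterministic)
    {lett : ι → A} {u w : List A} {q : M.Q} {c : A} {γ : List M.Γ} (hc : c ∉ M.τ q)
    {f : M.Control ι → List (Option M.Γ) → Prop} :
    ((M.shapeRule lett (M.plain ι u q (c :: w)) γ.head?).Holds fun x =>
        f x.1 (x.2.1 ++ (marked γ).tail)) ↔
      M.ReadAccept q c γ ∨ ∃ q' γ', M.Read q c γ q' γ' ∧ f (M.plain ι u q' w) (marked γ') := by
  rw [← hM.letterOutcome_holds (f := fun q' σ => f (M.plain ι u q' w) σ)]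
  simp only [plain, map_cons, shapeRule, Sum.elim_inl, id, hc, if_false, Outcome.holds_map,
    afterRead]
  rfl

theorem Deterministic.nrAcc_of_acceptsWithin {M : NIDPDAwtl A} [DecidableEq ι]
    (hM : M.Deterministic) {lett : ι → A} {k : ℕ} {u w : List A} {q : M.Q} {γ : List M.Γ}
    (h : PushdownSystem.AcceptsWithin (M.shapeRule lett) k (M.plain ι u q w) (marked γ)) :
    M.NRAcc u q w γ := by
  induction k generalizing u w q γ with
  | zero => exact h.elim
  | succ k ih =>
    rw [marked_eq γ] at h
    cases w with
    | nil =>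
      rw [PushdownSystem.AcceptsWithin, hM.shapeRule_nil_holds
        (f := fun x σ => PushdownSystem.AcceptsWithin (M.shapeRule lett) k x σ)] at h
      rw [nrAcc_end]
      exact h.imp_right fun ⟨S, h1, q', h2, h3⟩ => ⟨S, h1, q', h2, ih h3⟩
    | cons c w =>
      by_cases hc : c ∈ M.τ q
      · rw [nrAcc_skip hc]
        rw [PushdownSystem.acceptsWithin_go (shapeRule_skip hc), cons_append, nil_append,
          ← marked_eq] at h
        exact ih h
      · rw [nrAcc_read hc]
        rw [PushdownSystem.AcceptsWithin, hM.shapeRule_read_holds hc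
          (f := fun x σ => PushdownSystem.AcceptsWithin (M.shapeRule lett) k x σ)] at h
        exact h.imp_right fun ⟨q', γ', h1, h2⟩ => ⟨q', γ', h1, ih h2⟩

theorem accepts_skip {M : NIDPDAwtl A} [DecidableEq ι] {lett : ι → A} {u x w : List A} {q : M.Q}
    {γ : List M.Γ} (hx : ∀ c ∈ x, c ∈ M.τ q) :
    PushdownSystem.Accepts (M.shapeRule lett) (M.plain ι u q (x ++ w)) (marked γ) ↔
      PushdownSystem.Accepts (M.shapeRule lett) (M.plain ι (u ++ x) q w) (marked γ) := by
  induction x generalizing u with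
  | nil => simp
  | cons c x ih =>
    rw [marked_eq γ, PushdownSystem.accepts_iff, cons_append, shapeRule_skip (hx c (by simp))]
    simp only [Outcome.Holds, cons_append, nil_append]
    rw [← marked_eq, ih fun d hd => hx d (by simp [hd])]
    simp

theorem Deterministic.accepts_of_nrAcc {M : NIDPDAwtl A} [DecidableEq ι]
    (hM : M.Deterministic) {lett : ι → A} {u w : List A} {q : M.Q} {γ : List M.Γ}
    (h : M.NRAcc u q w γ) :
    PushdownSystem.Accepts (M.shapeRule lett) (M.plain ι u q w) (marked γ) := by
  have key : ∀ c : M.NRConfig, Relation.ReflTransGen M.NRStep c NRConfig.accept →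
      match c with
      | .accept => True
      | .run u q w γ =>
        PushdownSystem.Accepts (M.shapeRule lett) (M.plain ι u q w) (marked γ) := by
    intro c hc
    induction hc using Relation.ReflTransGen.head_induction_on with
    | refl => trivial
    | head h' _ ih =>
      cases h' with
      | letter hx ha hr =>
        dsimp only at ih ⊢
        rw [accepts_skip hx, marked_eq, PushdownSystem.accepts_iff, hM.shapeRule_read_holds ha
          (f := fun x σ => PushdownSystem.Accepts (M.shapeRule lett) x σ)]
        exact Or.inr ⟨_, _, hr, ih⟩
      | letterAccept hx ha hr =>
        dsimp only at ih ⊢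
        rw [accepts_skip hx, marked_eq, PushdownSystem.accepts_iff, hM.shapeRule_read_holds ha
          (f := fun x σ => PushdownSystem.Accepts (M.shapeRule lett) x σ)]
        exact Or.inl hr
      | @endmarker _ _ _ x _ _ hx hδ hS =>
        dsimp only at ih ⊢
        rw [← append_nil x, accepts_skip hx, marked_eq, PushdownSystem.accepts_iff,
          hM.shapeRule_nil_holds (f := fun x σ => PushdownSystem.Accepts (M.shapeRule lett) x σ)]
        exact Or.inr ⟨_, hδ, _, hS, ih⟩
      | @endmarkerAccept _ _ x _ hx hδ =>
        dsimp only at ih ⊢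
        rw [← append_nil x, accepts_skip hx, marked_eq, PushdownSystem.accepts_iff,
          hM.shapeRule_nil_holds (f := fun x σ => PushdownSystem.Accepts (M.shapeRule lett) x σ)]
        exact Or.inl hδ
  exact key _ h

theorem Deterministic.accepts_iff_nrAcc {M : NIDPDAwtl A} [DecidableEq ι]
    (hM : M.Deterministic) {lett : ι → A} {u w : List A} {q : M.Q} {γ : List M.Γ} :
    PushdownSystem.Accepts (M.shapeRule lett) (M.plain ι u q w) (marked γ) ↔ M.NRAcc u q w γ :=
  ⟨fun ⟨_, h⟩ => hM.nrAcc_of_acceptsWithin h, hM.accepts_of_nrAcc⟩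

end NIDPDAwtl

end

/-! ### Invariants of symbolic runs: items, costs, height -/

section

open List

namespace NIDPDAwtl

variable {A ι : Type} {M : NIDPDAwtl A} {lett : ι → A}

theorem items_subperm [DecidableEq ι] {c c' : M.Control ι} {t : Option M.Γ} {l : List (Option M.Γ)} {v : ι → ℕ}
    (h : M.shapeRule lett c t = .go (c', l, v)) : c'.items <+~ c.items := by
  obtain ⟨u, q, w⟩ := c
  cases w with
  | nil =>
    simp only [shapeRule, Outcome.map_eq_go, Prod.mk.injEq] at h
    obtain ⟨q', -, rfl, -⟩ := h
    simp [Control.items, Subperm.refl]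
  | cons x w =>
    rw [shapeRule] at h
    split_ifs at h
    · cases h
      simp [Control.items, Subperm.refl]
    · simp only [Outcome.map_eq_go, Prod.mk.injEq] at h
      obtain ⟨p, -, rfl, -⟩ := h
      cases x with
      | inl a => exact (List.Sublist.append_left (sublist_cons_self _ _) _).subperm
      | inr i => exact Subperm.refl _

theorem mem_items_of_cost [DecidableEq ι] {c c' : M.Control ι} {t : Option M.Γ} {l : List (Option M.Γ)} {v : ι → ℕ}
    (h : M.shapeRule lett c t = .go (c', l, v)) {i : ι} (hi : v i ≠ 0) : .inr i ∈ c.items := by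
  obtain ⟨u, q, w⟩ := c
  cases w with
  | nil =>
    simp only [shapeRule, Outcome.map_eq_go, Prod.mk.injEq] at h
    obtain ⟨q', -, -, -, rfl⟩ := h
    simp at hi
  | cons x w =>
    rw [shapeRule] at h
    split_ifs at h
    · cases h
      simp at hi
    · simp only [Outcome.map_eq_go, Prod.mk.injEq] at h
      obtain ⟨p, -, -, -, rfl⟩ := h
      cases x with
      | inl a => simp [readCost] at hi
      | inr j =>
        by_cases hij : i = j
        · subst hij; simp [Control.items]
        · simp [readCost, hij] at hi

/-- The effect of a letter on the height of the pushdown store. -/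
def _root_.StackOp.height : StackOp → ℤ
  | .push => 1
  | .pop => -1
  | .keep => 0

theorem length_of_letterOutcome {q q' : M.Q} {a : A} {t : Option M.Γ} {l : List (Option M.Γ)}
    (h : M.letterOutcome q a t = .go (q', l)) (ht : t ≠ none) :
    none ∉ l ∧ (l.length : ℤ) = 1 + (M.kind a).height := by
  unfold letterOutcome at h
  cases hk : M.kind a <;> simp only [hk, Outcome.map_eq_go, Prod.mk.injEq] at h <;>
    obtain ⟨p, -, -, rfl⟩ := h
  · simp [StackOp.height, Ne.symm ht]
  · obtain ⟨g, rfl⟩ := Option.ne_none_iff_exists'.1 ht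
    simp [StackOp.height]
  · simp [StackOp.height, Ne.symm ht]

theorem letterOutcome_none {q q' : M.Q} {a : A} {l : List (Option M.Γ)}
    (h : M.letterOutcome q a none = .go (q', l)) : ∃ l', none ∉ l' ∧ l = l' ++ [none] := by
  unfold letterOutcome at h
  cases hk : M.kind a <;> simp only [hk, Outcome.map_eq_go, Prod.mk.injEq] at h <;>
    obtain ⟨p, -, -, rfl⟩ := h
  · exact ⟨[some p.2], by simp, rfl⟩
  · exact ⟨[], by simp, rfl⟩
  · exact ⟨[], by simp, rfl⟩

theorem le_length_of_letterOutcome {q q' : M.Q} {a : A} {t : Option M.Γ} {l : List (Option M.Γ)}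
    (h : M.letterOutcome q a t = .go (q', l)) (ha : M.kind a ≠ .pop) : 1 ≤ l.length := by
  unfold letterOutcome at h
  cases hk : M.kind a <;> simp only [hk, Outcome.map_eq_go, Prod.mk.injEq] at h
  · obtain ⟨p, -, -, rfl⟩ := h; simp
  · exact absurd hk ha
  · obtain ⟨p, -, -, rfl⟩ := h; simp

/-- The total effect of the single letters of a shape on the height of the pushdown store. -/
def Shape.height (M : NIDPDAwtl A) (s : Shape A ι) : ℤ :=
  (s.map (Sum.elim (fun a => (M.kind a).height) fun _ => 0)).sum

@[simp] theorem Shape.height_append (s s' : Shape A ι) :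
    Shape.height M (s ++ s') = Shape.height M s + Shape.height M s' := by
  simp [Shape.height]

@[simp] theorem Shape.height_cons (x : A ⊕ ι) (s : Shape A ι) :
    Shape.height M (x :: s) = Sum.elim (fun a => (M.kind a).height) (fun _ => 0) x +
      Shape.height M s := by
  simp [Shape.height]

@[simp] theorem Shape.height_nil : Shape.height (ι := ι) M [] = 0 := rfl

/-- A conservation law: the store height changes by the heights of the deleted single letters and of
the block letters paid for. It fails with `⊥` on top, where a pop changes nothing. -/
theorem length_of_shapeRule [DecidableEq ι] [Fintype ι] {c c' : M.Control ι} {t : Option M.Γ}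
    {l : List (Option M.Γ)} {v : ι → ℕ}
    (h : M.shapeRule lett c t = .go (c', l, v)) (ht : t ≠ none) :
    none ∉ l ∧ (l.length : ℤ) + c'.items.height M =
      1 + c.items.height M + ∑ i, (M.kind (lett i)).height * v i := by
  obtain ⟨u, q, w⟩ := c
  cases w with
  | nil =>
    simp only [shapeRule, Outcome.map_eq_go, Prod.mk.injEq] at h
    obtain ⟨q', -, rfl, rfl, rfl⟩ := h
    simp [Control.items, Ne.symm ht]
  | cons x w =>
    rw [shapeRule] at h
    split_ifs at h
    · cases h
      simp [Control.items, Ne.symm ht]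
    · simp only [Outcome.map_eq_go, Prod.mk.injEq] at h
      obtain ⟨p, hp, rfl, rfl, rfl⟩ := h
      obtain ⟨h1, h2⟩ := length_of_letterOutcome hp ht
      refine ⟨h1, ?_⟩
      rw [h2]
      cases x with
      | inl a => simp [Control.items, afterRead, readCost]; ring
      | inr i =>
        simp [Control.items, afterRead, readCost, Pi.single_apply]
        ring

theorem shapeRule_none [DecidableEq ι] {c c' : M.Control ι} {l : List (Option M.Γ)} {v : ι → ℕ}
    (h : M.shapeRule lett c none = .go (c', l, v)) : ∃ l', none ∉ l' ∧ l = l' ++ [none] := by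
  obtain ⟨u, q, w⟩ := c
  cases w with
  | nil =>
    simp only [shapeRule, Outcome.map_eq_go, Prod.mk.injEq] at h
    obtain ⟨q', -, rfl, rfl, rfl⟩ := h
    exact ⟨[], by simp, rfl⟩
  | cons x w =>
    rw [shapeRule] at h
    split_ifs at h
    · cases h
      exact ⟨[], by simp, rfl⟩
    · simp only [Outcome.map_eq_go, Prod.mk.injEq] at h
      obtain ⟨p, hp, rfl, rfl, rfl⟩ := h
      exact letterOutcome_none hp

end NIDPDAwtl

open NIDPDAwtl PushdownSystem

namespace NIDPDAwtl

variable {A ι : Type} [DecidableEq ι] {M : NIDPDAwtl A} {lett : ι → A} {S : Set (M.Control ι)}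

theorem items_subperm_of_reach {m : ℕ} {c c' : M.Control ι} {σ σ' : List (Option M.Γ)} {v : ι → ℕ}
    (h : Reach (M.shapeRule lett) S m c σ v c' σ') : c'.items <+~ c.items := by
  induction h with
  | refl => exact Subperm.refl _
  | step _ h _ ih => exact ih.trans (items_subperm h)

theorem mem_items_of_reach {m : ℕ} {c c' : M.Control ι} {σ σ' : List (Option M.Γ)} {v : ι → ℕ}
    (h : Reach (M.shapeRule lett) S m c σ v c' σ') {i : ι} (hi : v i ≠ 0) : .inr i ∈ c.items := by
  induction h with
  | refl => simp at hi
  | @step _ _ _ _ _ _ _ _ v w _ h _ ih =>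
    by_cases hv : v i = 0
    · exact (items_subperm h).subset (ih (by simpa [hv] using hi))
    · exact mem_items_of_cost h hv

theorem length_of_reach [Fintype ι] {m : ℕ} {c c' : M.Control ι} {σ σ' : List (Option M.Γ)}
    {v : ι → ℕ} (h : Reach (M.shapeRule lett) S m c σ v c' σ') (hσ : none ∉ σ) :
    none ∉ σ' ∧ (σ'.length : ℤ) + c'.items.height M =
      σ.length + c.items.height M + ∑ i, (M.kind (lett i)).height * v i := by
  induction h with
  | refl => simpa using hσ
  | @step _ _ _ _ z _ ρ _ v w _ h _ ih =>
    obtain ⟨h1, h2⟩ := length_of_shapeRule h (fun hz => hσ (by simp [hz]))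
    obtain ⟨h3, h4⟩ := ih (by simp at hσ ⊢; tauto)
    refine ⟨h3, ?_⟩
    rw [h4]
    simp only [length_append, length_cons, Pi.add_apply, Nat.cast_add, mul_add,
      Finset.sum_add_distrib]
    push_cast
    linarith

theorem bottom_of_reach [Fintype ι] {m : ℕ} {c c' : M.Control ι} {σ σ' : List (Option M.Γ)}
    {v : ι → ℕ} (h : Reach (M.shapeRule lett) S m c σ v c' σ')
    (hσ : ∃ ρ, none ∉ ρ ∧ σ = ρ ++ [none]) : ∃ ρ, none ∉ ρ ∧ σ' = ρ ++ [none] := by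
  induction h with
  | refl => exact hσ
  | @step _ _ _ _ z l ρ _ v w _ h _ ih =>
    apply ih
    obtain ⟨ρ', h1, h2⟩ := hσ
    cases ρ' with
    | nil =>
      simp at h2
      obtain ⟨rfl, rfl⟩ := h2
      simpa using shapeRule_none h
    | cons y ρ' =>
      simp at h2 h1
      obtain ⟨rfl, rfl⟩ := h2
      refine ⟨l ++ ρ', ?_, by simp⟩
      simp only [mem_append, not_or]
      exact ⟨(length_of_shapeRule h fun hz => h1.1 hz.symm).1, h1.2⟩

end NIDPDAwtl

end

/-! ### Symbolic runs and acceptance of actual words -/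

section

open List

open NIDPDAwtl PushdownSystem

namespace NIDPDAwtl

variable {A ι : Type} {M : NIDPDAwtl A} {lett : ι → A} {S : Set (M.Control ι)}

/-- The word that is abbreviated by a shape. -/
def Shape.word (lett : ι → A) (n : ι → ℕ) (s : Shape A ι) : List A :=
  s.flatMap (Sum.elim (fun a => [a]) fun i => replicate (n i + 1) (lett i))

@[simp] theorem Shape.word_nil (n : ι → ℕ) : Shape.word lett n [] = [] := rfl

@[simp] theorem Shape.word_append (n : ι → ℕ) (s s' : Shape A ι) :
    Shape.word lett n (s ++ s') = Shape.word lett n s ++ Shape.word lett n s' := by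
  simp [Shape.word]

@[simp] theorem Shape.word_inl_cons (n : ι → ℕ) (a : A) (s : Shape A ι) :
    Shape.word lett n (.inl a :: s) = a :: Shape.word lett n s := rfl

@[simp] theorem Shape.word_inr_cons (n : ι → ℕ) (i : ι) (s : Shape A ι) :
    Shape.word lett n (.inr i :: s) = replicate (n i + 1) (lett i) ++ Shape.word lett n s := rfl

theorem Shape.word_add_single [DecidableEq ι] (n : ι → ℕ) {i : ι} {s : Shape A ι} (hi : .inr i ∉ s) :
    Shape.word lett (n + Pi.single i 1) s = Shape.word lett n s := by
  induction s with
  | nil => rfl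
  | cons x s ih =>
    simp only [mem_cons, not_or] at hi
    cases x with
    | inl a => simp [ih hi.2]
    | inr j =>
      have : j ≠ i := fun h => hi.1 (by rw [h])
      simp [ih hi.2, this]

/-- The control state that is abbreviated by a control state with blocks. -/
def Control.expand (lett : ι → A) (n : ι → ℕ) (c : M.Control ι) : M.Control ι :=
  M.plain ι (Shape.word lett n c.1) c.2.1 (Shape.word lett n c.2.2)

theorem acceptsWithin_skip [DecidableEq ι] {k : ℕ} {u x w : List A} {q : M.Q} {t : Option M.Γ}
    {ρ : List (Option M.Γ)} (hx : ∀ c ∈ x, c ∈ M.τ q) :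
    AcceptsWithin (M.shapeRule lett) (k + x.length) (M.plain ι u q (x ++ w)) (t :: ρ) ↔
      AcceptsWithin (M.shapeRule lett) k (M.plain ι (u ++ x) q w) (t :: ρ) := by
  induction x generalizing u with
  | nil => simp
  | cons c x ih =>
    rw [length_cons, ← add_assoc, cons_append, acceptsWithin_go (shapeRule_skip (hx c (by simp))),
      cons_append, nil_append, ih fun d hd => hx d (by simp [hd])]
    simp

theorem word_singleton_subset {n : ι → ℕ} {x : A ⊕ ι} {d : A} (h : d ∈ Shape.word lett n [x]) :
    d = Sum.elim id lett x := by
  cases x with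
  | inl a => simpa [Shape.word] using h
  | inr i => exact (mem_replicate (n := n i + 1).1 (by simpa [Shape.word] using h)).2

theorem length_word_singleton_pos {n : ι → ℕ} (x : A ⊕ ι) :
    1 ≤ (Shape.word lett n [x]).length := by
  cases x <;> simp [Shape.word]

theorem acceptsWithin_expand_of_go [DecidableEq ι] {c d : M.Control ι} {t : Option M.Γ}
    {l ρ : List (Option M.Γ)} {v : ι → ℕ} (h : M.shapeRule lett c t = .go (d, l, v)) :
    (∀ k, AcceptsWithin (M.shapeRule lett) (k + 1) c (t :: ρ) →
      AcceptsWithin (M.shapeRule lett) k d (l ++ ρ)) ∧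
    (Accepts (M.shapeRule lett) d (l ++ ρ) → Accepts (M.shapeRule lett) c (t :: ρ)) :=
  ⟨fun _ => (acceptsWithin_go h).1, fun ⟨k, hk⟩ => ⟨k + 1, (acceptsWithin_go h).2 hk⟩⟩

/-- A block stands for `n i + 1` letters, so paying one unit still leaves a nonempty block and the
same shape. `Nodup` ensures that the payment affects only the occurrence being read. -/
theorem expand_step [DecidableEq ι] {c c' : M.Control ι} (hc : c.items.Nodup) {t : Option M.Γ}
    {l ρ : List (Option M.Γ)} {v : ι → ℕ} (h : M.shapeRule lett c t = .go (c', l, v)) (n : ι → ℕ) :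
    (∀ k, AcceptsWithin (M.shapeRule lett) (k + 1) (c.expand lett (n + v)) (t :: ρ) →
      AcceptsWithin (M.shapeRule lett) k (c'.expand lett n) (l ++ ρ)) ∧
    (Accepts (M.shapeRule lett) (c'.expand lett n) (l ++ ρ) →
      Accepts (M.shapeRule lett) (c.expand lett (n + v)) (t :: ρ)) := by
  obtain ⟨u, q, w⟩ := c
  cases w with
  | nil =>
    simp only [shapeRule, Outcome.map_eq_go, Prod.mk.injEq] at h
    obtain ⟨q', hq', rfl, rfl, rfl⟩ := h
    refine acceptsWithin_expand_of_go (v := 0) ?_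
    simp [Control.expand, plain, shapeRule, hq']
  | cons x w =>
    rw [shapeRule] at h
    split_ifs at h with hx
    · cases h
      have key : ∀ d ∈ Shape.word lett n [x], d ∈ M.τ q := fun d hd =>
        word_singleton_subset hd ▸ hx
      have h1 := fun k => acceptsWithin_skip (M := M) (lett := lett) (t := t) (ρ := ρ) (k := k)
        (u := Shape.word lett n u) (w := Shape.word lett n w) key
      have h2 : Shape.word lett n (x :: w) = Shape.word lett n [x] ++ Shape.word lett n w := by
        rw [← Shape.word_append]; rfl
      have h3 := length_word_singleton_pos (lett := lett) (n := n) x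
      constructor
      · intro k hk
        have := (h1 k).1 ?_
        · simpa [Control.expand] using this
        -- Skipping a whole block is one symbolic step but several actual ones; the step bound is
        -- first enlarged to the length of the block, which is at least one.
        · refine AcceptsWithin.mono (k := k + 1) ?_ (by omega)
          simpa [Control.expand, h2] using hk
      · rintro ⟨k, hk⟩
        have h4 := (h1 k).2 (by simpa [Control.expand] using hk)
        exact ⟨_, by simpa [Control.expand, h2] using h4⟩
    · simp only [Outcome.map_eq_go, Prod.mk.injEq] at h
      obtain ⟨p, hp, rfl, rfl, rfl⟩ := h
      refine acceptsWithin_expand_of_go (v := 0) ?_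
      cases x with
      | inl a =>
        simp only [Sum.elim_inl, id] at hx hp
        simp [Control.expand, plain, shapeRule, hx, hp, readCost, afterRead]
      | inr i =>
        simp only [Sum.elim_inr] at hx hp
        have h1 : .inr i ∉ u ∧ .inr i ∉ w := by
          have h2 := (nodup_cons.1 (nodup_middle.1 hc)).1
          simpa using h2
        simp [Control.expand, plain, shapeRule, hx, hp, readCost, afterRead,
          Shape.word_add_single n h1.1, Shape.word_add_single n h1.2, replicate_succ]

theorem finite_controls [Finite A] [Finite ι] (N : ℕ) :
    {c : M.Control ι | c.items.length ≤ N}.Finite := by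
  have := M.finite_states
  have h := List.finite_length_le (A ⊕ ι) N
  refine (h.prod (Set.finite_univ.prod h)).subset fun c hc => ?_
  have hc : (c.1 ++ c.2.2).length ≤ N := hc
  rw [length_append] at hc
  exact ⟨show c.1.length ≤ N by omega, trivial, show c.2.2.length ≤ N by omega⟩

/-- Acceptance from an abbreviated control state. -/
def Control.Acc [DecidableEq ι] (lett : ι → A) (n : ι → ℕ) (c : M.Control ι)
    (σ : List (Option M.Γ)) : Prop :=
  Accepts (M.shapeRule lett) (c.expand lett n) σ

variable [DecidableEq ι]

theorem nodup_of_reach {m : ℕ} {c c' : M.Control ι} {σ σ' : List (Option M.Γ)} {v : ι → ℕ}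
    (h : Reach (M.shapeRule lett) S m c σ v c' σ') (hc : c.items.Nodup) : c'.items.Nodup := by
  obtain ⟨s, h1, h2⟩ := items_subperm_of_reach h
  exact (h1.nodup_iff).1 (hc.sublist h2)

theorem acceptsWithin_of_reach {m : ℕ} {c c' : M.Control ι} {σ σ' : List (Option M.Γ)} {v : ι → ℕ}
    (h : Reach (M.shapeRule lett) S m c σ v c' σ') (hc : c.items.Nodup) {n : ι → ℕ} {k : ℕ}
    {ρ : List (Option M.Γ)}
    (hk : AcceptsWithin (M.shapeRule lett) (k + m) (c.expand lett (n + v)) (σ ++ ρ)) :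
    AcceptsWithin (M.shapeRule lett) k (c'.expand lett n) (σ' ++ ρ) := by
  induction h with
  | refl => simpa using hk
  | @step m c c' c'' z l ρ' σ v w hS h h' ih =>
    apply ih (nodup_of_reach (S := S) (.single (ρ := []) hS h) hc)
    rw [← add_assoc, add_comm v w, ← add_assoc, cons_append] at hk
    simpa using (expand_step hc h (n + w)).1 _ hk

theorem acc_iff_of_reach {m : ℕ} {c c' : M.Control ι} {σ σ' : List (Option M.Γ)} {v : ι → ℕ}
    (h : Reach (M.shapeRule lett) S m c σ v c' σ') (hc : c.items.Nodup) (n : ι → ℕ)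
    (ρ : List (Option M.Γ)) : c.Acc lett (n + v) (σ ++ ρ) ↔ c'.Acc lett n (σ' ++ ρ) := by
  constructor
  · rintro ⟨k, hk⟩
    exact ⟨k, acceptsWithin_of_reach h hc (hk.mono (Nat.le_add_right _ _))⟩
  · intro h1
    induction h with
    | refl => simpa using h1
    | @step m c c' c'' z l ρ' σ v w hS h h' ih =>
      have h2 := ih (nodup_of_reach (S := S) (.single (ρ := []) hS h) hc) h1
      rw [add_comm v w, ← add_assoc, cons_append]
      exact (expand_step hc h (n + w)).2 (by simpa [Control.Acc] using h2)

/-- A loop without cost never accepts. -/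
theorem not_acc_of_loop {m : ℕ} {c : M.Control ι} {z : Option M.Γ} {τ : List (Option M.Γ)}
    (h : Reach (M.shapeRule lett) S m c [z] 0 c (z :: τ)) (hc : c.items.Nodup) (hm : 0 < m)
    (n : ι → ℕ) (ρ : List (Option M.Γ)) : ¬ c.Acc lett n (z :: ρ) := by
  rintro ⟨k, hk⟩
  induction k generalizing ρ with
  | zero => exact hk
  | succ k ih =>
    -- Each round reproduces the situation with a smaller step bound: infinite descent.
    exact ih (τ ++ ρ) (acceptsWithin_of_reach (ρ := ρ) h hc (by simpa using hk.mono (by omega)))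

theorem acc_iff_of_halt {c : M.Control ι} {z : Option M.Γ} {p : Prop}
    (h : M.shapeRule lett c z = .halt p) (n : ι → ℕ) (ρ : List (Option M.Γ)) :
    c.Acc lett n (z :: ρ) ↔ p := by
  obtain ⟨u, q, w⟩ := c
  rw [Control.Acc, accepts_iff]
  suffices H : M.shapeRule lett (Control.expand lett n (u, q, w)) z = .halt p by
    simp [H, Outcome.Holds]
  cases w with
  | nil =>
    simp only [shapeRule, Outcome.map_eq_halt] at h
    simp [Control.expand, plain, shapeRule, h]
  | cons x w =>
    rw [shapeRule] at h
    split_ifs at h with hx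
    simp only [Outcome.map_eq_halt] at h
    cases x <;> simp at hx h <;> simp [Control.expand, plain, shapeRule, hx, h, replicate_succ]

open Classical in
/-- The pushdown content below the symbols that the input is able to remove is irrelevant. -/
theorem acceptsWithin_congr {a : A} (ha : M.kind a ≠ .pop) {k : ℕ} {u w : List A} {q : M.Q}
    {σ ρ ρ' : List (Option M.Γ)} (hσ : (u ++ w).countP (· ≠ a) < σ.length)
    (h : AcceptsWithin (M.shapeRule lett) k (M.plain ι u q w) (σ ++ ρ)) :
    AcceptsWithin (M.shapeRule lett) k (M.plain ι u q w) (σ ++ ρ') := by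
  induction k generalizing u w q σ with
  | zero => exact h
  | succ k ih =>
    cases σ with
    | nil => simp at hσ
    | cons t σ =>
      rw [cons_append, AcceptsWithin] at h ⊢
      cases w with
      | nil =>
        simp only [plain, map_nil, shapeRule, Outcome.holds_map] at h ⊢
        cases hr : (M.δN q none t).outcome with
        | halt p => simpa [hr, Outcome.Holds] using h
        | go q' =>
          simp only [hr, Outcome.Holds, Function.comp] at h ⊢
          exact ih (u := []) (w := u) (σ := t :: σ) (by simpa using hσ) h
      | cons c w =>
        by_cases hc : c ∈ M.τ q
        · simp only [shapeRule_skip hc, Outcome.Holds] at h ⊢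
          exact ih (u := u ++ [c]) (w := w) (σ := t :: σ) (by simpa using hσ) h
        · simp only [plain, map_cons, shapeRule, Sum.elim_inl, id, hc, if_false,
            Outcome.holds_map] at h ⊢
          cases hr : M.letterOutcome q c t with
          | halt p => simpa [hr, Outcome.Holds] using h
          | go x =>
            simp only [hr, Outcome.Holds, Function.comp, afterRead, ← append_assoc] at h ⊢
            refine ih (u := u) (w := w) (σ := x.2 ++ σ) ?_ h
            by_cases hca : c = a
            · have := le_length_of_letterOutcome hr (hca ▸ ha)
              simp [hca] at hσ ⊢
              omega
            · simp [hca] at hσ ⊢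
              omega

open Classical in
theorem acc_congr {a : A} (ha : M.kind a ≠ .pop) {c : M.Control ι} {n : ι → ℕ}
    {σ ρ ρ' : List (Option M.Γ)}
    (hσ : (Shape.word lett n c.items).countP (· ≠ a) < σ.length) :
    c.Acc lett n (σ ++ ρ) ↔ c.Acc lett n (σ ++ ρ') := by
  rw [Control.items, Shape.word_append] at hσ
  exact ⟨fun ⟨k, hk⟩ => ⟨k, acceptsWithin_congr ha hσ hk⟩,
    fun ⟨k, hk⟩ => ⟨k, acceptsWithin_congr ha hσ hk⟩⟩

-- Supplies the bound for `acc_congr`: only single letters and the block `x` contribute letters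
-- different from `a`, independently of the sizes of the other blocks.
open Classical in
theorem countP_word_le {a : A} {x : ι} (hx : ∀ i, i ≠ x → lett i = a) (n : ι → ℕ) (s : Shape A ι) :
    (Shape.word lett n s).countP (· ≠ a) ≤ s.length * (n x + 1) := by
  induction s with
  | nil => simp
  | cons y s ih =>
    rw [length_cons, Nat.succ_mul]
    cases y with
    | inl c =>
      rw [Shape.word_inl_cons, countP_cons]
      split_ifs <;> omega
    | inr i =>
      rw [Shape.word_inr_cons, countP_append]
      by_cases hi : i = x
      · subst hi
        have := countP_le_length (p := fun y => decide (y ≠ a)) (l := replicate (n i + 1) (lett i))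
        rw [length_replicate] at this
        omega
      · have : countP (fun y => decide (y ≠ a)) (replicate (n i + 1) (lett i)) = 0 := by
          rw [hx i hi, countP_eq_zero]
          simp
        omega

end NIDPDAwtl

end

/-! ### Symbolic control states on `b^+#b^+a^+` -/

section

open List

open NIDPDAwtl PushdownSystem

namespace UnionLowerBound

variable {M : NIDPDAwtl ABHash}

/-- The block `0` consists of letters `a`, the blocks `1` and `2` of letters `b`. -/
def lett : Fin 3 → ABHash := ![.a, .b, .b]

abbrev hashItem : ABHash ⊕ Fin 3 := .inl .hash

/-- The initial control state on the words `b^+ # b^+ a^+`. -/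
def start (M : NIDPDAwtl ABHash) : M.Control (Fin 3) :=
  ([], M.q₀, [.inr 1, hashItem, .inr 2, .inr 0])

theorem bHashB_inj {i j i' j' : ℕ} (h : bHashB i j = bHashB i' j') : i = i' ∧ j = j' := by
  induction i generalizing i' with
  | zero =>
    cases i' with
    | zero => simpa [ABHash.bHashB_zero] using h
    | succ i' => simp [ABHash.bHashB_zero, ABHash.bHashB_succ] at h
  | succ i ih =>
    cases i' with
    | zero => simp [ABHash.bHashB_zero, ABHash.bHashB_succ] at h
    | succ i' =>
      simp only [ABHash.bHashB_succ, cons.injEq, true_and] at h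
      simpa using ih h

/-- Every block has one letter more than its size parameter; the common offset cancels in the
comparison. -/
theorem acc_start_iff (hM : M.Deterministic) (hL : M.nrLanguage = langL₁ + langL₂) (n : Fin 3 → ℕ) :
    (start M).Acc lett n [none] ↔ n 0 = n 1 ∨ n 0 = n 2 := by
  have h := hM.accepts_iff_nrAcc (ι := Fin 3) (lett := lett) (u := []) (q := M.q₀) (γ := [])
    (w := Shape.word lett n (start M).2.2)
  rw [← mem_nrLanguage, hL, ABHash.mem_union_iff] at h
  have hw : Shape.word lett n (start M).2.2 =
      bHashB (n 1 + 1) (n 2 + 1) ++ replicate (n 0 + 1) .a := by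
    simp [start, lett, bHashB]
  refine Iff.trans (show (start M).Acc lett n [none] ↔ _ from h) ?_
  rw [hw]
  simp only [ABHash.eraseA_append, ABHash.eraseA_bHashB, ABHash.eraseA_replicate_a, append_nil,
    countP_append, ABHash.countP_isA_bHashB, ABHash.countP_isA_replicate_a]
  constructor
  · rintro ⟨i, j, k, -, -, h1, h2, h3⟩
    obtain ⟨rfl, rfl⟩ := bHashB_inj h2
    omega
  · intro h1
    exact ⟨_, _, _, by omega, by omega, by omega, rfl, rfl⟩

/-- The item `#` is still there, and the head is not at the second block of letters `b` unless that
block is translucent. The item `e` may have been deleted. -/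
def Present (e : ABHash ⊕ Fin 3) (c : M.Control (Fin 3)) : Prop :=
  (c.items = [.inr 1, hashItem, .inr 2, e] ∨ c.items = [.inr 1, hashItem, .inr 2]) ∧
    (c.1 = [.inr 1] → .b ∈ M.τ c.2.1) ∧ (c.1 = [.inr 1, hashItem] → .b ∈ M.τ c.2.1)

/-- The item `#` has been deleted, and the head is between the blocks of letters `b`. -/
def Between (e : ABHash ⊕ Fin 3) (c : M.Control (Fin 3)) : Prop :=
  c.1 = [.inr 1] ∧ (c.2.2 = [.inr 2, e] ∨ c.2.2 = [.inr 2])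

/-- The item `#` has been deleted, and the head is to the right of the blocks of letters `b`. -/
def Merged (e : ABHash ⊕ Fin 3) (c : M.Control (Fin 3)) : Prop :=
  c.1 = [.inr 1, .inr 2] ∧ (c.2.2 = [e] ∨ c.2.2 = [])

theorem between_step {e : ABHash ⊕ Fin 3} {c c' : M.Control (Fin 3)} {t : Option M.Γ}
    {l : List (Option M.Γ)} {v : Fin 3 → ℕ} (hc : Between e c)
    (h : M.shapeRule lett c t = .go (c', l, v)) :
    (Between e c' ∨ Merged e c') ∧ v 0 = 0 ∧ v 1 = 0 := by
  obtain ⟨u, q, w⟩ := c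
  obtain ⟨rfl, rfl | rfl⟩ := hc <;> rw [shapeRule] at h <;> split_ifs at h
  · cases h
    simp [Between, Merged]
  · simp only [Outcome.map_eq_go, Prod.mk.injEq] at h
    obtain ⟨p, hp, rfl, rfl, rfl⟩ := h
    simp [Between, Merged, afterRead, readCost]
  · cases h
    simp [Between, Merged]
  · simp only [Outcome.map_eq_go, Prod.mk.injEq] at h
    obtain ⟨p, hp, rfl, rfl, rfl⟩ := h
    simp [Between, Merged, afterRead, readCost]

/-- Reading from the first block keeps the head to its left, so the head gets past this block only
by skipping it, with `b` translucent. As long as no letter is read, the state stays the same and the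
second block is skipped too; reading `#` leads to `Between`. -/
theorem present_step {e : ABHash ⊕ Fin 3} (he : e = .inr 0 ∨ e = .inl .a)
    {c c' : M.Control (Fin 3)} {t : Option M.Γ}
    {l : List (Option M.Γ)} {v : Fin 3 → ℕ} (hc : Present e c)
    (h : M.shapeRule lett c t = .go (c', l, v)) :
    (Present e c' ∨ Between e c') ∧ v 2 = 0 := by
  obtain ⟨u, q, w⟩ := c
  obtain ⟨hc, h1, h2⟩ := hc
  cases w with
  | nil =>
    simp only [shapeRule, Outcome.map_eq_go, Prod.mk.injEq] at h
    obtain ⟨q', -, rfl, -, rfl⟩ := h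
    refine ⟨Or.inl ⟨by simpa [Control.items] using hc, by simp, by simp⟩, by simp⟩
  | cons x w =>
    have key : (u = [] ∧ x = .inr 1 ∧ (w = [hashItem, .inr 2, e] ∨ w = [hashItem, .inr 2])) ∨
        (u = [.inr 1] ∧ x = hashItem ∧ (w = [.inr 2, e] ∨ w = [.inr 2])) ∨
        (u = [.inr 1, hashItem] ∧ x = .inr 2 ∧ (w = [e] ∨ w = [])) ∨
        (u = [.inr 1, hashItem, .inr 2] ∧ x = e ∧ w = []) := by
      simp only [Control.items] at hc
      rcases u with _ | ⟨u1, _ | ⟨u2, _ | ⟨u3, _ | ⟨u4, u⟩⟩⟩⟩ <;> simp at hc ⊢ <;> grind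
    rw [shapeRule] at h
    split_ifs at h with hx
    · cases h
      refine ⟨Or.inl ?_, rfl⟩
      rcases key with ⟨rfl, rfl, rfl | rfl⟩ | ⟨rfl, rfl, rfl | rfl⟩ | ⟨rfl, rfl, rfl | rfl⟩ |
        ⟨rfl, rfl, rfl⟩ <;> simp_all [Present, Control.items, lett]
    · simp only [Outcome.map_eq_go, Prod.mk.injEq] at h
      obtain ⟨p, hp, rfl, rfl, rfl⟩ := h
      rcases key with ⟨rfl, rfl, hw⟩ | ⟨rfl, rfl, hw⟩ | ⟨rfl, rfl, hw⟩ | ⟨rfl, rfl, rfl⟩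
      · refine ⟨Or.inl ⟨by simpa [Control.items, afterRead] using hw, by simp, by simp⟩, rfl⟩
      · exact ⟨Or.inr ⟨rfl, hw⟩, rfl⟩
      · exact absurd (h2 rfl) hx
      · rcases he with rfl | rfl
        · exact ⟨Or.inl ⟨Or.inl rfl, by simp, by simp⟩, rfl⟩
        · exact ⟨Or.inl ⟨Or.inr rfl, by simp, by simp⟩, rfl⟩

/-- The control states in which the blocks of letters `b` are separated by the item `#` or by the
head. -/
def separated (M : NIDPDAwtl ABHash) (e : ABHash ⊕ Fin 3) : Set (M.Control (Fin 3)) :=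
  {c | Present e c ∨ Between e c}

theorem finite_separated (e : ABHash ⊕ Fin 3) : (separated M e).Finite := by
  have := M.finite_alphabet
  refine (finite_controls 4).subset fun c hc => ?_
  show c.items.length ≤ 4
  rcases hc with ⟨h | h, -⟩ | ⟨h, h' | h'⟩
  · simp [h]
  · simp [h]
  · simp [Control.items, h, h']
  · simp [Control.items, h, h']

variable {e : ABHash ⊕ Fin 3} {c c' : M.Control (Fin 3)} {σ σ' : List (Option M.Γ)} {v : Fin 3 → ℕ}
  {m : ℕ}

theorem not_present_of_between (he : e = .inr 0 ∨ e = .inl .a) (hc : Between e c) :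
    ¬ Present e c := by
  rintro ⟨h, -⟩
  obtain ⟨h1, h2 | h2⟩ := hc <;> rcases he with rfl | rfl <;> simp [Control.items, h1, h2] at h

theorem not_separated_of_merged (he : e = .inr 0 ∨ e = .inl .a) (hc : Merged e c) :
    c ∉ separated M e := by
  rintro (⟨h, -⟩ | ⟨h, -⟩)
  · obtain ⟨h1, h2 | h2⟩ := hc <;> rcases he with rfl | rfl <;> simp [Control.items, h1, h2] at h
  · simp [hc.1] at h

theorem separated_or_merged_of_reach (he : e = .inr 0 ∨ e = .inl .a)
    (h : Reach (M.shapeRule lett) (separated M e) m c σ v c' σ') (hc : c ∈ separated M e) :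
    c' ∈ separated M e ∨ Merged e c' := by
  induction h with
  | refl => exact Or.inl hc
  | @step _ _ d _ _ _ _ _ _ _ _ h h' ih =>
    have h1 : d ∈ separated M e ∨ Merged e d := by
      rcases hc with hc | hc
      · exact Or.inl (present_step he hc h).1
      · exact (between_step hc h).1.imp_left Or.inr
    rcases h1 with h1 | h1
    · exact ih h1
    · exact Or.inr (h'.mem_or_eq.resolve_left (not_separated_of_merged he h1) ▸ h1)

/-- `Present` cannot be regained once `#` is deleted, so a run ending there was there throughout and
never read the second block. -/
theorem cost_of_present (he : e = .inr 0 ∨ e = .inl .a)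
    (h : Reach (M.shapeRule lett) (separated M e) m c σ v c' σ') (hc' : Present e c') :
    (c ∈ separated M e → Present e c) ∧ v 2 = 0 := by
  induction h with
  | refl => exact ⟨fun _ => hc', rfl⟩
  | @step _ c d _ _ _ _ _ _ _ hc h h' ih =>
    obtain ⟨ih1, ih2⟩ := ih hc'
    have h1 : Present e c := by
      refine hc.resolve_right fun h1 => ?_
      rcases (between_step h1 h).1 with h2 | h2
      · exact not_present_of_between he h2 (ih1 (Or.inr h2))
      · rcases h'.mem_or_eq with h3 | rfl
        · exact not_separated_of_merged he h2 h3
        · exact not_separated_of_merged he h2 (Or.inl hc')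
    exact ⟨fun _ => h1, by simp [ih2, (present_step he h1 h).2]⟩

/-- As long as the head does not pass the second block, it can read only there. -/
theorem cost_of_between (he : e = .inr 0 ∨ e = .inl .a)
    (h : Reach (M.shapeRule lett) (separated M e) m c σ v c' σ') (hc : Between e c)
    (hc' : c' ∈ separated M e) : v 0 = 0 ∧ v 1 = 0 := by
  induction h with
  | refl => exact ⟨rfl, rfl⟩
  | @step _ c d _ _ _ _ _ _ _ _ h h' ih =>
    obtain ⟨h1, h2, h3⟩ := between_step hc h
    rcases h1 with h1 | h1
    · simp [h2, h3, ih h1 hc']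
    · rcases h'.mem_or_eq with h4 | rfl
      · exact absurd h4 (not_separated_of_merged he h1)
      · exact absurd hc' (not_separated_of_merged he h1)

/-- After an exit, the sizes of the blocks of letters `b` cannot be told apart. -/
theorem acc_of_merged (he : e = .inr 0 ∨ e = .inl .a) (hc : Merged e c) (n : Fin 3 → ℕ) :
    c.Acc lett (n + Pi.single 1 1) σ ↔ c.Acc lett (n + Pi.single 2 1) σ := by
  obtain ⟨u, q, w⟩ := c
  obtain ⟨h1, h2⟩ := hc
  simp only at h1 h2
  subst h1
  have hu : Shape.word lett (n + Pi.single 1 1) [.inr 1, .inr 2] =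
      Shape.word lett (n + Pi.single 2 1) [.inr 1, .inr 2] := by
    simp only [Shape.word_inr_cons, Shape.word_nil, append_nil, lett, Matrix.cons_val_one,
      Matrix.cons_val, replicate_append_replicate]
    congr 1
    simp
    omega
  have hw : Shape.word lett (n + Pi.single 1 1) w = Shape.word lett (n + Pi.single 2 1) w := by
    rw [Shape.word_add_single, Shape.word_add_single] <;>
      rcases he with rfl | rfl <;> rcases h2 with rfl | rfl <;> simp
  rw [Control.Acc, Control.Acc, Control.expand, Control.expand, hu, hw]

end UnionLowerBound

end

/-! ### A loop that grows the store -/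

section

open List

open NIDPDAwtl PushdownSystem

namespace UnionLowerBound

variable {M : NIDPDAwtl ABHash}

/-- The words of `b^+ # b^+ a^+` with block sizes given by `n` that belong to the language. -/
def Good (n : Fin 3 → ℕ) : Prop := n 0 = n 1 ∨ n 0 = n 2

theorem acc_iff_of_loop {S : Set (M.Control (Fin 3))} {m : ℕ} {c : M.Control (Fin 3)}
    {z : Option M.Γ} {τ : List (Option M.Γ)} {w : Fin 3 → ℕ}
    (h : Reach (M.shapeRule lett) S m c [z] w c (z :: τ)) (hc : c.items.Nodup) (n : Fin 3 → ℕ)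
    (t : ℕ) (ρ : List (Option M.Γ)) :
    c.Acc lett (n + t • w) (z :: ρ) ↔ c.Acc lett n (z :: wordPow τ t ++ ρ) :=
  acc_iff_of_reach (h.loop t) hc n ρ

/-- The initial symbolic run can only loop: a halt or an exit would make acceptance insensitive to
sizes that matter, and the bottom symbol is never removed. The loop has a cost, since free loops
never accept, and it grows the store, since otherwise its cost would be a period of the acceptance
condition. -/
theorem exists_growing_loop (hM : M.Deterministic) (hL : M.nrLanguage = langL₁ + langL₂) :
    ∃ (c : M.Control (Fin 3)) (z : Option M.Γ) (τ ρ : List (Option M.Γ)) (v w : Fin 3 → ℕ) (m : ℕ),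
      c ∈ separated M (.inr 0) ∧ Reach (M.shapeRule lett) (separated M (.inr 0)) m c [z] w c (z :: τ) ∧
      τ ≠ [] ∧ z ≠ none ∧
      ∀ n t, c.Acc lett n (z :: wordPow τ t ++ ρ) ↔ Good (n + v + t • w) := by
  have hnd : (start M).items.Nodup := by simp [start, Control.items]
  have hst : start M ∈ separated M (.inr 0) := Or.inl ⟨Or.inl rfl, by simp [start], by simp [start]⟩
  have he : (.inr 0 : ABHash ⊕ Fin 3) = .inr 0 ∨ (.inr 0 : ABHash ⊕ Fin 3) = .inl .a := Or.inl rfl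
  have hfin := M.finite_stack
  have hacc : ∀ {m c σ v}, Reach (M.shapeRule lett) (separated M (.inr 0)) m (start M) [none] v c σ →
      ∀ n, c.Acc lett n σ ↔ Good (n + v) := by
    intro m c σ v h n
    have := acc_iff_of_reach h hnd n []
    rw [append_nil, append_nil] at this
    rw [← this, acc_start_iff hM hL, Good]
  rcases halt_or_exit_or_empty_or_loop (rule := M.shapeRule lett) (finite_separated (.inr 0))
    (start M) [none] with
    ⟨m, v, c, z, ρ, p, h, h'⟩ | ⟨m, v, c, σ, h, h'⟩ | ⟨m, v, c, h⟩ |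
    ⟨m, v, c, z, ρ, m', w, τ, h, hc, hm, h'⟩
  · have h1 := fun n => (hacc h n).symm.trans (acc_iff_of_halt h' n ρ)
    -- After adding `v`, the first vector satisfies `n 0 = n 1`; in the second one the `a`-size
    -- exceeds both `b`-sizes.
    have h2 := (h1 ![v 1, v 0, 0]).trans (h1 ![v 1 + v 2 + 1, 0, 0]).symm
    simp only [Good, Pi.add_apply, Matrix.cons_val] at h2
    omega
  · have h1 := (separated_or_merged_of_reach he h hst).resolve_left h'
    -- The first comparison succeeds exactly if the extra `b` is put into block `1`; block `2` is
    -- too large in both cases.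
    have h2 := acc_of_merged (σ := σ) he h1 ![v 1 + 1, v 0, v 0 + v 1 + 2]
    rw [hacc h, hacc h] at h2
    simp only [Good, Pi.add_apply, Matrix.cons_val, Pi.single_apply] at h2
    simp at h2
    omega
  · obtain ⟨ρ, -, h1⟩ := bottom_of_reach h ⟨[], by simp, rfl⟩
    simp at h1
  · have hnd' := nodup_of_reach h hnd
    have hw : w ≠ 0 := by
      rintro rfl
      refine not_acc_of_loop h' hnd' hm ![v 1, v 0, 0] ρ ((hacc h _).2 ?_)
      simp [Good]
      omega
    have hloop : ∀ n t, c.Acc lett n (z :: wordPow τ t ++ ρ) ↔ Good (n + v + t • w) := by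
      intro n t
      rw [← acc_iff_of_loop h' hnd', hacc h, add_right_comm]
    have hτ : τ ≠ [] := by
      rintro rfl
      have h1 : ∀ n, Good (n + v) ↔ Good (n + v + w) := by
        intro n
        have h2 := hloop n 0
        have h3 := hloop n 1
        simp at h2 h3
        rw [← h2, ← h3]
      -- One comparison holds and the other `b`-size is out of reach. This forces `w 0 = w 1`, and
      -- the next line likewise `w 0 = w 2`.
      have h2 := h1 ![v 1, v 0, v 0 + v 1 + w 0 + 1]
      have h3 := h1 ![v 2, v 0 + v 2 + w 0 + 1, v 0]
      simp only [Good, Pi.add_apply, Matrix.cons_val] at h2 h3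
      have h4 : w 2 = 0 ∨ w 0 = 0 ∧ w 1 = 0 := by
        rcases hc with hc | hc
        · exact Or.inl (cost_of_present he h' hc).2
        · exact Or.inr (cost_of_between he h' hc (Or.inr hc))
      apply hw
      funext i
      fin_cases i <;> simp <;> omega
    refine ⟨c, z, τ, ρ, v, w, m', hc, h', hτ, ?_, hloop⟩
    rintro rfl
    obtain ⟨ρ', h1, h2⟩ := bottom_of_reach h ⟨[], by simp, rfl⟩
    have h3 := (h'.frame ρ)
    obtain ⟨ρ'', h4, h5⟩ := bottom_of_reach h' ⟨[], by simp, rfl⟩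
    cases ρ'' with
    | nil => simp at h5; exact hτ h5
    | cons y ρ'' => simp at h5 h4; exact h4.1 h5.1

/-- A shape with a block replaced by a single letter. -/
def Shape.shrink (lett : Fin 3 → ABHash) (i : Fin 3) (s : Shape ABHash (Fin 3)) :
    Shape ABHash (Fin 3) :=
  s.map (Sum.elim .inl fun j => if j = i then .inl (lett i) else .inr j)

def shrink (i : Fin 3) (c : M.Control (Fin 3)) : M.Control (Fin 3) :=
  (Shape.shrink lett i c.1, c.2.1, Shape.shrink lett i c.2.2)

theorem word_shrink (i : Fin 3) (n : Fin 3 → ℕ) (s : Shape ABHash (Fin 3)) :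
    Shape.word lett n (Shape.shrink lett i s) = Shape.word lett (Function.update n i 0) s := by
  induction s with
  | nil => rfl
  | cons x s ih =>
    rw [Shape.shrink, map_cons]
    rw [Shape.shrink] at ih
    cases x with
    | inl d => simp [ih]
    | inr j =>
      by_cases h : j = i
      · subst h; simp [ih]
      · simp [ih, h]

theorem acc_shrink (i : Fin 3) (n : Fin 3 → ℕ) (c : M.Control (Fin 3)) (σ : List (Option M.Γ)) :
    (shrink i c).Acc lett n σ ↔ c.Acc lett (Function.update n i 0) σ := by
  rw [Control.Acc, Control.Acc, Control.expand, Control.expand, shrink, word_shrink, word_shrink]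

theorem items_shrink {c : M.Control (Fin 3)} (hc : c ∈ separated M (.inr 0)) (i : Fin 3) :
    (shrink i c).items.Nodup ∧ (shrink i c).items.length ≤ 4 ∧ .inr i ∉ (shrink i c).items := by
  have h : (shrink i c).items = Shape.shrink lett i c.items := by
    simp [shrink, Shape.shrink, Control.items]
  have h1 : c.items = [.inr 1, hashItem, .inr 2, .inr 0] ∨ c.items = [.inr 1, hashItem, .inr 2] ∨
      c.items = [.inr 1, .inr 2, .inr 0] ∨ c.items = [.inr 1, .inr 2] := by
    rcases hc with ⟨h | h, -⟩ | ⟨h, h' | h'⟩ <;> simp [*, Control.items] <;>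
      simp [Control.items] at h <;> simp [h]
  rw [h]
  rcases h1 with h1 | h1 | h1 | h1 <;> rw [h1] <;> fin_cases i <;> simp [Shape.shrink, lett]

theorem shrink_eq_singleton {s : Shape ABHash (Fin 3)} (h : Shape.shrink lett 0 s = [.inr 1]) :
    s = [.inr 1] := by
  simp only [Shape.shrink, map_eq_cons_iff, map_eq_nil_iff] at h
  obtain ⟨x | j, s, rfl, hx, rfl⟩ := h
  · simp at hx
  · simp at hx
    split_ifs at hx
    simpa using hx

theorem shrink_eq_pair {s : Shape ABHash (Fin 3)}
    (h : Shape.shrink lett 0 s = [.inr 1, hashItem]) : s = [.inr 1, hashItem] := by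
  simp only [Shape.shrink, map_eq_cons_iff, map_eq_nil_iff] at h
  obtain ⟨x, s, rfl, hx, y | j, s, rfl, hy, rfl⟩ := h
  · simp only [Sum.elim_inl, Sum.inl.injEq] at hy
    subst hy
    have := shrink_eq_singleton (s := [x]) (by simpa [Shape.shrink] using hx)
    simpa using this
  · simp [lett] at hy
    split_ifs at hy; simp at hy

/-- Shrinking the `a`-block turns the item `e` into a single letter, which may later be deleted;
this is why `separated` is parametrised by `e`. -/
theorem shrink_separated {c : M.Control (Fin 3)} (hc : Present (.inr 0) c) :
    shrink 0 c ∈ separated M (.inl .a) := by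
  have h : (shrink 0 c).items = Shape.shrink lett 0 c.items := by
    simp [shrink, Shape.shrink, Control.items]
  obtain ⟨h1, h2, h3⟩ := hc
  left
  refine ⟨?_, ?_, ?_⟩
  · rw [h]
    rcases h1 with h1 | h1 <;> rw [h1] <;> simp [Shape.shrink, lett]
  · intro h4
    exact h2 (shrink_eq_singleton h4)
  · intro h4
    exact h3 (shrink_eq_pair h4)

end UnionLowerBound

end

/-! ### Contradictions from a periodic store -/

section

open List

open NIDPDAwtl PushdownSystem

namespace UnionLowerBound

variable {M : NIDPDAwtl ABHash}

/-- A run that uses the first `i` periods of the store shifts the number of periods by `i` and the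
sizes by its cost. -/
theorem acc_iff_of_reach_periodic {S : Set (M.Control (Fin 3))} {m i : ℕ} {c c' : M.Control (Fin 3)}
    {z : Option M.Γ} {τ ρ σ : List (Option M.Γ)} {v : Fin 3 → ℕ}
    {P : (Fin 3 → ℕ) → ℕ → Prop} (hc : c.items.Nodup)
    (hP : ∀ n t, c.Acc lett n (z :: wordPow τ t ++ ρ) ↔ P n t)
    (h : Reach (M.shapeRule lett) S m c ([z] ++ wordPow τ i) v c' σ) (n : Fin 3 → ℕ) (t : ℕ) :
    c'.Acc lett n (σ ++ (wordPow τ t ++ ρ)) ↔ P (n + v) (i + t) := by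
  rw [← hP, ← acc_iff_of_reach h hc, wordPow_add]
  simp

theorem none_notMem_wordPow {τ : List (Option M.Γ)} (hτ : none ∉ τ) (n : ℕ) :
    none ∉ wordPow τ n := by
  simp only [wordPow, mem_flatten, mem_replicate, not_exists, not_and]
  rintro l ⟨-, rfl⟩
  exact hτ

theorem countP_word_lett_le (n : Fin 3 → ℕ) (s : Shape ABHash (Fin 3)) {N : ℕ} (hs : s.length ≤ N) :
    open Classical in (Shape.word lett n s).countP (· ≠ .b) ≤ N * (n 0 + 1) := by
  classical
  refine (countP_word_le (x := 0) ?_ n s).trans (Nat.mul_le_mul_right _ hs)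
  intro i hi
  fin_cases i
  · exact absurd rfl hi
  · rfl
  · rfl

/-- The block sizes `x` for the letters `a` and `y` for the letters `b`. -/
def sizes (x y : ℕ) : Fin 3 → ℕ := ![x, y, y]

/-- The block counted by the store has been shrunk, so the letters `a` have to be compared with
block `r` or with the number of periods. A halt sees neither; a loop of constant height would be a
period of the condition; a growing loop buries the periods; a descent has to read more letters `a`
than letters of block `r`, which breaks the comparison with that block. -/
theorem false_of_push (hb : M.kind .b = .push) {c : M.Control (Fin 3)} (hc : c.items.Nodup)
    (hlen : c.items.length ≤ 4) {s r : Fin 3} (hsr : s = 1 ∧ r = 2 ∨ s = 2 ∧ r = 1)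
    (hs : .inr s ∉ c.items) {z : Option M.Γ} {τ ρ : List (Option M.Γ)} (hz : none ∉ z :: τ)
    (hτ : τ ≠ []) {d α β δ : ℕ} (hd : 0 < d)
    (H : ∀ n t, c.Acc lett n (z :: wordPow τ t ++ ρ) ↔ n 0 + α = n r + β ∨ n 0 + α = t * d + δ) :
    False := by
  have hfin := M.finite_stack
  have hfin' := M.finite_alphabet
  have hy : ∀ x y, sizes x y r = y := by rcases hsr with ⟨-, rfl⟩ | ⟨-, rfl⟩ <;> simp [sizes]
  have hx : ∀ x y, sizes x y 0 = x := by simp [sizes]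
  have htd : ∀ i t, t ≤ (i + t) * d := fun i t => by nlinarith
  rcases halt_or_exit_or_loop_or_descend (rule := M.shapeRule lett)
    (finite_controls (M := M) (ι := Fin 3) 4) c [z] τ with
    ⟨i, m, v, c', z', ρ', p, h, h'⟩ | ⟨i, m, v, c', σ, h, h'⟩ |
    ⟨i, m, v, c', z', ρ', m', w, τ', h, -, hm, h'⟩ | ⟨i, j, m, v, c', m', w, h, -, hj, h'⟩
  · have h1 := fun n t => (acc_iff_of_reach_periodic hc H h n t).symm.trans (acc_iff_of_halt h' n _)
    have h2 := (h1 (sizes (v r + β) (v 0 + α)) 0).trans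
      (h1 (sizes (v r + β + i * d + δ + 1) 0) 0).symm
    simp only [Pi.add_apply, hx, hy, add_zero] at h2
    generalize i * d = y at h2
    omega
  · exact h' ((items_subperm_of_reach h).length_le.trans hlen)
  · have h1 := acc_iff_of_reach_periodic hc H h
    have hc' := nodup_of_reach h hc
    have hs' : .inr s ∉ c'.items := fun hs' => hs ((items_subperm_of_reach h).subset hs')
    have hws : w s = 0 := by_contra fun hw => hs' (mem_items_of_reach h' hw)
    have hw0 : w ≠ 0 := by
      rintro rfl
      refine not_acc_of_loop h' hc' hm _ _
        ((h1 (sizes (v r + β) (v 0 + α)) 0).2 (Or.inl ?_))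
      simp only [Pi.add_apply, hx, hy]
      omega
    by_cases hτ' : τ' = []
    · subst hτ'
      have h3 : ∀ n t, ((n + v) 0 + α = (n + v) r + β ∨ (n + v) 0 + α = (i + t) * d + δ) ↔
          ((n + w + v) 0 + α = (n + w + v) r + β ∨ (n + w + v) 0 + α = (i + t) * d + δ) := by
        intro n t
        rw [← h1, ← h1]
        exact (acc_iff_of_reach h' hc' n _).symm
      have h4 : w 0 = w r := by
        -- The large number of periods makes the second alternative false, so only the comparison
        -- with block `r` remains.
        have h4 := h3 (sizes (v r + β) (v 0 + α)) (v 0 + v r + w 0 + α + β + δ + 1)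
        have h5 := htd i (v 0 + v r + w 0 + α + β + δ + 1)
        simp only [Pi.add_apply, hx, hy] at h4
        omega
      have h5 : w 0 = 0 := by
        have h5 := htd i (v 0 + α)
        have h6 := h3 (sizes ((i + (v 0 + α)) * d + δ - v 0 - α)
          ((i + (v 0 + α)) * d + δ + w 0 + 1)) (v 0 + α)
        simp only [Pi.add_apply, hx, hy] at h6
        generalize (i + (v 0 + α)) * d = y at h5 h6
        omega
      apply hw0
      funext i
      rcases hsr with ⟨rfl, rfl⟩ | ⟨rfl, rfl⟩ <;> fin_cases i <;> simp <;> omega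
    -- The size `x` meets the comparison with the store at `N` periods. Having `k` symbols from the
    -- growing loop on top hides the periods from the at most `4 * (x + 1)` letters other than `b`.
    -- As `k` is a multiple of `d`, the extra cost `k * w 0` is matched by a whole number of further
    -- periods.
    · set N := v 0 + α + i with hN
      set x := δ + d * N - v 0 - α with hx'
      have h3 : v 0 + α + x = δ + d * N := by
        have : N ≤ d * N := Nat.le_mul_of_pos_left _ hd
        omega
      set k := d * (4 * (x + 1)) with hk
      have hlen' : c'.items.length ≤ 4 := (items_subperm_of_reach h).length_le.trans hlen
      have h4 : ∀ y, open Classical in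
          (Shape.word lett (sizes x y) c'.items).countP (· ≠ .b) < (z' :: wordPow τ' k).length := by
        intro y
        refine lt_of_le_of_lt (countP_word_lett_le _ _ hlen') ?_
        rw [hx, length_cons, length_wordPow, Nat.lt_succ_iff]
        calc 4 * (x + 1) ≤ k := Nat.le_mul_of_pos_left _ hd
          _ ≤ k * τ'.length := Nat.le_mul_of_pos_right _ (length_pos_iff.2 hτ')
      have h5 : ∀ y t, ((sizes x y + k • w + v) 0 + α = (sizes x y + k • w + v) r + β ∨
            (sizes x y + k • w + v) 0 + α = (i + t) * d + δ) ↔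
          ((sizes x y + k • w + v) 0 + α = (sizes x y + k • w + v) r + β ∨
            (sizes x y + k • w + v) 0 + α = (i + (t + 1)) * d + δ) := by
        intro y t
        rw [← h1, ← h1]
        refine (acc_iff_of_loop h' hc' _ _ _).trans (Iff.trans ?_ (acc_iff_of_loop h' hc' _ _ _).symm)
        exact acc_congr (by simp [hb]) (h4 y)
      -- The size of block `r` is too large for the first comparison; the second one holds for this
      -- number of periods and fails for one more.
      have h6 := h5 (x + k * w 0 + v 0 + α + 1) (v 0 + α + 4 * (x + 1) * w 0)
      simp only [Pi.add_apply, Pi.smul_apply, smul_eq_mul, hx, hy] at h6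
      have h7 : (i + (v 0 + α + 4 * (x + 1) * w 0)) * d = d * N + k * w 0 := by
        rw [hN, hk]; ring
      have h8 : (i + (v 0 + α + 4 * (x + 1) * w 0 + 1)) * d = d * N + k * w 0 + d := by
        rw [hN, hk]; ring
      rw [h7, h8] at h6
      generalize k * w 0 = y at h6
      omega
  · have h1 := acc_iff_of_reach_periodic hc H h
    have hc' := nodup_of_reach h hc
    have h2 : ∀ n t, ((n + v) 0 + α = (n + v) r + β ∨ (n + v) 0 + α = (i + t) * d + δ) ↔
        ((n + w + v) 0 + α = (n + w + v) r + β ∨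
          (n + w + v) 0 + α = (i + (j + t)) * d + δ) := by
      intro n t
      rw [← h1, ← h1, wordPow_add, append_assoc]
      exact (acc_iff_of_reach h' hc' n _).symm
    -- Removing `j` periods lowers the store. Letters `b` only push, so `a` pops, and it also has to
    -- undo the pushes of block `r`.
    have h3 : w r < w 0 := by
      have hz' : none ∉ [z] ++ wordPow τ i := by
        simp only [mem_append, not_or]
        exact ⟨fun h => hz (by simp_all), none_notMem_wordPow (fun h => hz (by simp [h])) _⟩
      have h3 := (length_of_reach h' (none_notMem_wordPow (fun h => hz (by simp [h])) j)).2
      have hs' : .inr s ∉ c'.items := fun hs' => hs ((items_subperm_of_reach h).subset hs')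
      have hws : w s = 0 := by_contra fun hw => hs' (mem_items_of_reach h' hw)
      have h4 : 0 < j * τ.length := Nat.mul_pos hj (length_pos_iff.2 hτ)
      have h5 : ∑ i, (M.kind (lett i)).height * (w i : ℤ) =
          (M.kind .a).height * w 0 + w r := by
        rcases hsr with ⟨rfl, rfl⟩ | ⟨rfl, rfl⟩ <;>
          simp [Fin.sum_univ_three, hws, lett, hb, StackOp.height]
      rw [h5, length_wordPow] at h3
      cases hk : M.kind .a <;> simp [hk, StackOp.height] at h3 <;> omega
    have h4 := h2 (sizes (v r + β) (v 0 + α)) (v 0 + v r + w 0 + α + β + δ + 1)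
    simp only [Pi.add_apply, hx, hy] at h4
    have h5 := htd i (j + (v 0 + v r + w 0 + α + β + δ + 1))
    omega

/-- No `a`-block is left, so block letters can only pop. A loop that does not lower the store is
then free and never accepts. A descent uses letters from only one of the `b`-blocks, and the
comparison with the other block breaks because the number of periods has changed. An exit merges the
blocks. -/
theorem false_of_pop (hb : M.kind .b = .pop) {c : M.Control (Fin 3)} (hc : c.items.Nodup)
    (hS : c ∈ separated M (.inl .a)) (hX : .inr 0 ∉ c.items)
    {z : Option M.Γ} {τ ρ : List (Option M.Γ)} (hz : none ∉ z :: τ)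
    (hτ : τ ≠ []) {g α β δ : ℕ} (hg : 0 < g)
    (H : ∀ n t, c.Acc lett n (z :: wordPow τ t ++ ρ) ↔
      t * τ.length + α = n 1 + β ∨ t * g + α = n 2 + δ) : False := by
  have hfin := M.finite_stack
  have he : (.inl .a : ABHash ⊕ Fin 3) = .inr 0 ∨ (.inl .a : ABHash ⊕ Fin 3) = .inl .a := Or.inr rfl
  have hl := length_pos_iff.2 hτ
  have htg : ∀ i t, t ≤ (i + t) * g := fun i t => by nlinarith
  have htl : ∀ i t, t ≤ (i + t) * τ.length := fun i t => by nlinarith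
  have hsum : ∀ {m c' d σ σ' w}, .inr 0 ∉ c'.items → Reach (M.shapeRule lett)
      (separated M (.inl .a)) m c' σ w d σ' →
      w 0 = 0 ∧ ∑ i, (M.kind (lett i)).height * (w i : ℤ) = - w 1 - w 2 := by
    intro m c' d σ σ' w h0 h
    have h1 : w 0 = 0 := by_contra fun hw => h0 (mem_items_of_reach h hw)
    refine ⟨h1, ?_⟩
    simp [Fin.sum_univ_three, h1, lett, hb, StackOp.height]
    ring
  rcases halt_or_exit_or_loop_or_descend (rule := M.shapeRule lett) (finite_separated (.inl .a))
    c [z] τ with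
    ⟨i, m, v, c', z', ρ', p, h, h'⟩ | ⟨i, m, v, c', σ, h, h'⟩ |
    ⟨i, m, v, c', z', ρ', m', w, τ', h, -, hm, h'⟩ | ⟨i, j, m, v, c', m', w, h, hcS, hj, h'⟩ <;>
    have h1 := acc_iff_of_reach_periodic hc H h <;>
    have hX' : .inr 0 ∉ c'.items := fun hs' => hX ((items_subperm_of_reach h).subset hs') <;>
    have hc' := nodup_of_reach h hc <;>
    have hz' : none ∉ [z] ++ wordPow τ i := by
        simp only [mem_append, not_or]
        exact ⟨fun h => hz (by simp_all), none_notMem_wordPow (fun h => hz (by simp [h])) _⟩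
  · have h2 := fun n t => (h1 n t).symm.trans (acc_iff_of_halt h' n _)
    -- With `β + v 1` as the free number of periods the natural subtraction is exact, and the first
    -- comparison holds.
    have h3 := (h2 ![0, (i + (β + v 1)) * τ.length + α - β - v 1, 0] (β + v 1)).trans
      (h2 ![0, (i + (β + v 1)) * τ.length + α + 1, (i + (β + v 1)) * g + α + 1] (β + v 1)).symm
    have h4 := htl i (β + v 1)
    simp only [Pi.add_apply, Matrix.cons_val] at h3
    generalize (i + (β + v 1)) * τ.length = x at h3 h4
    generalize (i + (β + v 1)) * g = y at h3
    omega
  · have h2 := acc_of_merged (σ := σ ++ (wordPow τ (β + v 1 + 1) ++ ρ)) he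
      ((separated_or_merged_of_reach he h hS).resolve_left h')
      ![0, (i + (β + v 1 + 1)) * τ.length + α - β - v 1 - 1, (i + (β + v 1 + 1)) * g + α + 1]
    have h4 := htl i (β + v 1 + 1)
    rw [h1, h1] at h2
    simp only [Pi.add_apply, Matrix.cons_val, Pi.single_apply] at h2
    generalize (i + (β + v 1 + 1)) * τ.length = x at h2 h4
    generalize (i + (β + v 1 + 1)) * g = y at h2
    simp at h2
    omega
  · have hz1 := (length_of_reach h hz').1
    have h2 := (length_of_reach h' (by simp at hz1 ⊢; tauto)).2
    obtain ⟨h3, h4⟩ := hsum hX' h'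
    rw [h4] at h2
    simp at h2
    have hw : w = 0 := by
      funext i
      fin_cases i <;> simp <;> omega
    subst hw
    refine not_acc_of_loop h' hc' hm _ _
      ((h1 ![0, (i + (β + v 1)) * τ.length + α - β - v 1, 0] (β + v 1)).2 (Or.inl ?_))
    have h4 := htl i (β + v 1)
    simp only [Pi.add_apply, Matrix.cons_val]
    omega
  · have h2 := (length_of_reach h' (none_notMem_wordPow (fun h => hz (by simp [h])) j)).2
    obtain ⟨h3, h4⟩ := hsum hX' h'
    rw [h4, length_wordPow] at h2
    simp at h2
    have h5 : ∀ n t, ((i + t) * τ.length + α = (n + v) 1 + β ∨ (i + t) * g + α = (n + v) 2 + δ) ↔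
        ((i + (j + t)) * τ.length + α = (n + w + v) 1 + β ∨
          (i + (j + t)) * g + α = (n + w + v) 2 + δ) := by
      intro n t
      rw [← h1, ← h1, wordPow_add, append_assoc]
      exact (acc_iff_of_reach h' hc' n _).symm
    have hjl : 0 < j * τ.length := Nat.mul_pos hj hl
    have hjg : 0 < j * g := Nat.mul_pos hj hg
    set t := δ + v 2 + β + v 1 with ht
    have h6 := htg i t
    have h7 := htl i t
    have h8 : (i + (j + t)) * g = (i + t) * g + j * g := by ring
    have h9 : (i + (j + t)) * τ.length = (i + t) * τ.length + j * τ.length := by ring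
    rcases hcS with hcS | hcS
    -- The descent is paid by block `1`. Block `2` is chosen to match before it, and the size of
    -- block `1` makes its own comparison fail on both sides; the other case exchanges the blocks.
    · have hw := (cost_of_present he h' hcS).2
      have h10 := h5 ![0, (i + t) * τ.length + j * τ.length + α + 1, (i + t) * g + α - v 2 - δ] t
      simp only [h8, h9, Pi.add_apply, Matrix.cons_val] at h10
      generalize (i + t) * τ.length = x at h7 h10
      generalize (i + t) * g = y at h6 h10
      generalize j * g = y' at hjg h10
      zify at *
      generalize (j : ℤ) * τ.length = x' at hjl h2 h10
      omega
    · have hw := (cost_of_between he h' hcS (Or.inr hcS)).2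
      have h10 := h5 ![0, (i + t) * τ.length + α - v 1 - β, (i + t) * g + j * g + α + j * τ.length + 1] t
      simp only [h8, h9, Pi.add_apply, Matrix.cons_val] at h10
      generalize (i + t) * τ.length = x at h7 h10
      generalize (i + t) * g = y at h6 h10
      generalize j * g = y' at hjg h10
      zify at *
      generalize (j : ℤ) * τ.length = x' at hjl h2 h10
      omega

theorem union_not_mem : langL₁ + langL₂ ∉ familyNrDIDPDAwtl ABHash := by
  rintro ⟨M, hM, hL⟩
  obtain ⟨c, z, τ, ρ, v, w, m, hcS, hloop, hτ, hz, hacc⟩ := exists_growing_loop hM hL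
  have he : (.inr 0 : ABHash ⊕ Fin 3) = .inr 0 ∨ (.inr 0 : ABHash ⊕ Fin 3) = .inl .a := Or.inl rfl
  obtain ⟨hzτ, hlen⟩ := length_of_reach hloop (by simpa using hz.symm)
  have hl := length_pos_iff.2 hτ
  have hw : Present (.inr 0) c ∧ w 2 = 0 ∨ Between (.inr 0) c ∧ w 0 = 0 ∧ w 1 = 0 := by
    rcases hcS with hc | hc
    · exact Or.inl ⟨hc, (cost_of_present he hloop hc).2⟩
    · exact Or.inr ⟨hc, cost_of_between he hloop hc (Or.inr hc)⟩
  have hlen' : (τ.length : ℤ) = (M.kind .a).height * w 0 + (M.kind .b).height * (w 1 + w 2) := by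
    simp [Fin.sum_univ_three, lett] at hlen
    linarith
  have hsh : ∀ i n t, (shrink i c).Acc lett n (z :: wordPow τ t ++ ρ) ↔
      Good (Function.update n i 0 + v + t • w) := fun i n t => by rw [acc_shrink, hacc]
  have hgood : ∀ n t, Good (n + v + t • w) ↔ n 0 + v 0 + t * w 0 = n 1 + v 1 + t * w 1 ∨
      n 0 + v 0 + t * w 0 = n 2 + v 2 + t * w 2 := fun n t => Iff.rfl
  obtain ⟨hnd0, -, hi0⟩ := items_shrink hcS 0
  obtain ⟨hnd1, hlen1, hi1⟩ := items_shrink hcS 1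
  obtain ⟨hnd2, hlen2, hi2⟩ := items_shrink hcS 2
  by_cases hb : M.kind .b = .pop
  · rw [hb] at hlen'
    obtain ⟨hc, hw2⟩ | ⟨hc, hw0, hw1⟩ := hw
    · have hw0 : w 0 = w 1 + τ.length := by
        -- Letters `b` pop, so only pushes by `a` can make the loop grow.
        cases hk : M.kind .a <;> simp [hk, StackOp.height] at hlen' <;> omega
      refine false_of_pop (g := w 0) (α := v 0) (β := v 1) (δ := v 2) (ρ := ρ) hb hnd0
        (shrink_separated hc) hi0 hzτ hτ (by omega) fun n t => ?_
      rw [hsh, hgood, hw2, hw0]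
      simp [mul_add]
      omega
    · simp [hw0, hw1, StackOp.height] at hlen'
      exact hτ hlen'.1
  · by_cases hw0 : w 0 = 0
    · have hb' : M.kind .b = .push := by
        cases hk : M.kind .b
        · rfl
        · exact absurd hk hb
        · simp [hk, hw0, StackOp.height] at hlen'
          exact absurd hlen' hτ
      simp [hb', hw0, StackOp.height] at hlen'
      obtain ⟨hc, hw2⟩ | ⟨hc, -, hw1⟩ := hw
      · refine false_of_push (s := 1) (r := 2) (d := w 1) (α := v 0) (β := v 2) (δ := v 1) (ρ := ρ)
          hb' hnd1 hlen1 (by simp) hi1 hzτ hτ (by omega) fun n t => ?_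
        rw [hsh, hgood, hw2, hw0]
        simp
        omega
      · refine false_of_push (s := 2) (r := 1) (d := w 2) (α := v 0) (β := v 1) (δ := v 2) (ρ := ρ)
          hb' hnd2 hlen2 (by simp) hi2 hzτ hτ (by omega) fun n t => ?_
        rw [hsh, hgood, hw1, hw0]
        simp
        omega
    · obtain ⟨hc, hw2⟩ | ⟨-, hw0', -⟩ := hw
      · have hlen4 : c.items.length ≤ 4 := by
          rcases hc.1 with h | h <;> simp [h]
        -- With `a`-size `v 2`, at most `t` letters can pop, so the `t` periods hide a further one.
        -- The sizes are chosen such that `a` matches block `2` at `t` periods but not at `t + 1`,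
        -- while block `1` is too large for both.
        set t := 4 * (v 2 + 1) with ht
        set n : Fin 3 → ℕ := ![v 2, v 2 + v 0 + (t + 1) * w 0 + 1, v 0 + t * w 0] with hn
        have h1 : c.Acc lett n (z :: wordPow τ t ++ ρ) ↔
            c.Acc lett n (z :: wordPow τ t ++ (τ ++ ρ)) := by
          refine acc_congr hb (lt_of_le_of_lt (countP_word_lett_le _ _ hlen4) ?_)
          rw [length_cons, length_wordPow, Nat.lt_succ_iff]
          exact Nat.le_mul_of_pos_right _ hl
        have h2 : z :: wordPow τ t ++ (τ ++ ρ) = z :: wordPow τ (t + 1) ++ ρ := by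
          simp [wordPow_add]
        rw [h2, hacc, hacc, hgood, hgood, hw2] at h1
        simp only [hn, Matrix.cons_val, Nat.succ_mul] at h1
        generalize t * w 0 = x at h1
        generalize t * w 1 = y at h1
        omega
      · exact hw0 hw0'

end UnionLowerBound

end

theorem proposition5 :
    LanguageFamily.Incomparable familyNrDIDPDAwtl familyNIDPDAwtl ∧
    (Lnsl ∈ familyNrDIDPDAwtl NslLetter ∧ Lnsl ∉ familyNIDPDAwtl NslLetter) ∧
    (langL₁ + langL₂ ∈ familyNIDPDAwtl ABHash ∧
      langL₁ + langL₂ ∉ familyNrDIDPDAwtl ABHash) :=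
  ⟨⟨fun h => NslAutomaton.lnsl_not_mem (h _ NslAutomaton.lnsl_mem),
      fun h => UnionLowerBound.union_not_mem (h _ UnionAutomaton.union_mem)⟩,
    ⟨NslAutomaton.lnsl_mem, NslAutomaton.lnsl_not_mem⟩,
    UnionAutomaton.union_mem, UnionLowerBound.union_not_mem⟩
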